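/- All functions are real- or complex-valued, Lebesgue measurable on $(0,\infty)$, and identified when equal almost everywhere; $L^1$ and $L^\infty$ are the Lebesgue spaces on $(0,\infty)$. The level function $f^o$ of $f$ is the derivative (defined almost everywhere) of the least concave majorant of $x\mapsto\int_0^x|f|$ if that majorant is finite; otherwise $f^o=\lim_{k\to\infty}\min(|f|,k)^o$, an increasing limit. Let $(L^\infty)^o$ be the Banach space of all $f$ with $f^o\in L^\infty$, normed by $\|f\|_{(L^\infty)^o}=\|f^o\|_{L^\infty}$. For compatible couples of Banach spaces $(X_0,X_1)$ and $(Y_0,Y_1)$, write $T:(X_0,X_1)\to(Y_0,Y_1)$ if $T:X_0+X_1\to Y_0+Y_1$ is linear and restricts to a bounded map $X_j\to Y_j$ for $j=0,1$; the norm of $T$ is the larger of the norms of these two restrictions. Let $K(t,x;X_0,X_1)=\inf\{\|x_0\|_{X_0}+t\|x_1\|_{X_1}:x_0\in X_0,\ x_1\in X_1,\ x_0+x_1=x\}$. The couples $(X_0,X_1)$ and $(Y_0,Y_1)$ form a $c$-uniform relative Calderón–Mityagin pair $[(X_0,X_1),(Y_0,Y_1)]$ if, whenever $x\in X_0+X_1$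 and $y\in Y_0+Y_1$ satisfy $K(t,y;Y_0,Y_1)\le K(t,x;X_0,X_1)$ for all $t>0$, there is a $T:(X_0,X_1)\to(Y_0,Y_1)$ of norm at most $c$ with $Tx=y$. The pair is exact if this holds with $c=1$, and $(X_0,X_1)$ is an exact Calderón–Mityagin couple if $[(X_0,X_1),(X_0,X_1)]$ is an exact pair. Call $n\ge 0$ admissible if for each $f\in L^1+(L^\infty)^o$ there is a linear operator $N:(L^1,(L^\infty)^o)\to(L^1,L^\infty)$ of norm at most $n$ with $Nf=f^o$. **Theorem.** The constant $n=2$ is admissible. If $n$ is any admissible constant, then: (a) $(L^1,(L^\infty)^o)$ is an exact Calderón–Mityagin couple; (b) $[(L^1,L^\infty),(L^1,(L^\infty)^o)]$ is an exact relative Calderón–Mityagin pair; (c) $[(L^1,(L^\infty)^o),(L^1,L^\infty)]$ is an $n$-uniform relative Calderón–Mityagin pair; (d) $[(L^1,(L^\infty)^o),(L^1,L^\infty)]$ is not an exact relative Calderón–Mityagin pair. -/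

import Mathlib

open MeasureTheory Set Filter Topology
open scoped ENNReal NNReal

namespace CalderonMityagin

/-- Lebesgue measure on the half line `(0, ∞)`. -/
noncomputable abbrev halfLine : Measure ℝ := volume.restrict (Ioi 0)

/-- `x ↦ ∫₀ˣ u`, with values in `[0, ∞]`. -/
noncomputable def primitive (u : ℝ → ℝ≥0∞) (x : ℝ) : ℝ≥0∞ := ∫⁻ y in Ioo 0 x, u y

/-- `φ` is a (finite) concave majorant of the non-negative function `F` on `(0, ∞)`. -/
def IsConcaveMajorant (F : ℝ → ℝ≥0∞) (φ : ℝ → ℝ) : Prop :=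
  ConcaveOn ℝ (Ioi 0) φ ∧ ∀ y, 0 < y → 0 ≤ φ y ∧ F y ≤ ENNReal.ofReal (φ y)

/-- The least concave majorant of `F` on `(0, ∞)`: the pointwise infimum of all finite concave
majorants, which is `∞` if there are none. -/
noncomputable def leastConcaveMajorant (F : ℝ → ℝ≥0∞) (x : ℝ) : ℝ≥0∞ :=
  ⨅ (φ : ℝ → ℝ) (_ : IsConcaveMajorant F φ), ENNReal.ofReal (φ x)

/-- The derivative of the least concave majorant of `x ↦ ∫₀ˣ u`; the level function of `u` when
this majorant is finite. (A finite concave function is differentiable almost everywhere.) -/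
noncomputable def levelDeriv (u : ℝ → ℝ≥0∞) (x : ℝ) : ℝ≥0∞ :=
  ENNReal.ofReal (deriv (fun y => (leastConcaveMajorant (primitive u) y).toReal) x)

open Classical in
/-- The level function `uᵒ` of a non-negative function `u` on `(0, ∞)`: the derivative of the
least concave majorant of `x ↦ ∫₀ˣ u` if the latter is finite, and otherwise the limit of the
increasing sequence of the level functions of the truncations `min (u, n)`. -/
noncomputable def levelFunction (u : ℝ → ℝ≥0∞) (x : ℝ) : ℝ≥0∞ :=
  if ∀ y, 0 < y → leastConcaveMajorant (primitive u) y ≠ ∞ then levelDeriv u x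
  else ⨆ n : ℕ, levelDeriv (fun y => min (u y) n) x

section LevelFacts

variable {F : ℝ → ℝ≥0∞} {u : ℝ → ℝ≥0∞}

theorem leastConcaveMajorant_le {φ : ℝ → ℝ} (h : IsConcaveMajorant F φ) (x : ℝ) :
    leastConcaveMajorant F x ≤ ENNReal.ofReal (φ x) := iInf₂_le φ h

theorem le_leastConcaveMajorant {x : ℝ} (hx : 0 < x) : F x ≤ leastConcaveMajorant F x :=
  le_iInf₂ fun _ h => (h.2 x hx).2

theorem toReal_lcm_le {φ : ℝ → ℝ} (h : IsConcaveMajorant F φ) {x : ℝ} (hx : 0 < x) :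
    (leastConcaveMajorant F x).toReal ≤ φ x :=
  ENNReal.toReal_le_of_le_ofReal (h.2 x hx).1 (leastConcaveMajorant_le h x)

theorem le_toReal_lcm {x c : ℝ} (hfin : leastConcaveMajorant F x ≠ ∞)
    (h : ∀ φ, IsConcaveMajorant F φ → c ≤ φ x) :
    c ≤ (leastConcaveMajorant F x).toReal := by
  refine (ENNReal.ofReal_le_iff_le_toReal hfin).1 (le_iInf₂ fun φ hφ => ?_)
  exact ENNReal.ofReal_le_ofReal (h φ hφ)

theorem concaveOn_lcm (hfin : ∀ y, 0 < y → leastConcaveMajorant F y ≠ ∞) :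
    ConcaveOn ℝ (Ioi 0) fun y => (leastConcaveMajorant F y).toReal := by
  refine ⟨convex_Ioi 0, fun x hx y hy a b ha hb hab => ?_⟩
  have hz : 0 < a • x + b • y := (convex_Ioi (0 : ℝ)) hx hy ha hb hab
  refine le_toReal_lcm (hfin _ hz) fun φ hφ => ?_
  refine le_trans ?_ (hφ.1.2 hx hy ha hb hab)
  have h1 := toReal_lcm_le hφ hx
  have h2 := toReal_lcm_le hφ hy
  simp only [smul_eq_mul]
  gcongr

theorem monotoneOn_of_concaveOn {g : ℝ → ℝ} (hg : ConcaveOn ℝ (Ioi 0) g)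
    (h0 : ∀ y, 0 ≤ g y) : MonotoneOn g (Ioi 0) := by
  intro x hx y hy hxy
  by_contra! hlt
  have hxy' : x < y := lt_of_le_of_ne hxy (by rintro rfl; exact lt_irrefl _ hlt)
  set s := (g y - g x) / (y - x) with hs
  have hs0 : s < 0 := div_neg_of_neg_of_pos (by linarith) (by linarith)
  set z := y + (g y + 1) / (-s) with hz
  have hp : 0 < (g y + 1) / (-s) := div_pos (by linarith [h0 y]) (by linarith)
  have hyz : y < z := by linarith
  have h := hg.slope_anti_adjacent hx (show z ∈ Ioi (0 : ℝ) from lt_trans hy hyz) hxy' hyz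
  rw [← hs, div_le_iff₀ (by linarith)] at h
  have : s * (z - y) = -(g y + 1) := by
    have hs1 : s ≠ 0 := hs0.ne
    rw [hz]; field_simp; ring
  linarith [h0 z]

theorem isConcaveMajorant_affine {a b : ℝ} (ha : 0 ≤ a) (hb : 0 ≤ b)
    (h : ∀ y, 0 < y → F y ≤ ENNReal.ofReal (a + b * y)) :
    IsConcaveMajorant F fun y => a + b * y := by
  refine ⟨?_, fun y hy => ⟨by positivity, h y hy⟩⟩
  refine ⟨convex_Ioi 0, fun x _ y _ s t _ _ hst => le_of_eq ?_⟩
  simp only [smul_eq_mul]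
  linear_combination (a : ℝ) * hst

theorem lcm_ne_top_of_linear {M : ℝ≥0} (h : ∀ x, 0 < x → F x ≤ M * ENNReal.ofReal x) :
    IsConcaveMajorant F fun y => 0 + (M : ℝ) * y := by
  refine isConcaveMajorant_affine le_rfl M.2 fun y hy => (h y hy).trans (le_of_eq ?_)
  rw [zero_add, ENNReal.ofReal_mul M.coe_nonneg, ENNReal.ofReal_coe_nnreal]

theorem levelDeriv_le {M : ℝ≥0} (h : ∀ x, 0 < x → primitive u x ≤ M * ENNReal.ofReal x)
    {x : ℝ} (hx : 0 < x) : levelDeriv u x ≤ M := by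
  have hmaj := lcm_ne_top_of_linear h
  have hfin : ∀ y, 0 < y → leastConcaveMajorant (primitive u) y ≠ ∞ := fun y _ =>
    ne_top_of_le_ne_top ENNReal.ofReal_ne_top (leastConcaveMajorant_le hmaj y)
  have hc := concaveOn_lcm hfin
  rw [levelDeriv, ENNReal.ofReal_le_iff_le_toReal ENNReal.coe_ne_top, ENNReal.coe_toReal]
  set g := fun y => (leastConcaveMajorant (primitive u) y).toReal with hg
  by_cases hd : DifferentiableAt ℝ g x
  swap
  · rw [deriv_zero_of_not_differentiableAt hd]; exact M.2
  have key : ∀ y, 0 < y → y < x → deriv g x * (x - y) ≤ M * x := by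
    intro y hy hyx
    have h1 := hc.deriv_le_slope hy hx hyx hd
    rw [slope_def_field, le_div_iff₀ (by linarith)] at h1
    have h2 : g x ≤ 0 + M * x := toReal_lcm_le hmaj hx
    have h3 : 0 ≤ g y := ENNReal.toReal_nonneg
    linarith
  have hlim : Tendsto (fun y => deriv g x * (x - y)) (𝓝[>] 0) (𝓝 (deriv g x * (x - 0))) :=
    (Continuous.tendsto (by fun_prop) 0).mono_left nhdsWithin_le_nhds
  have := le_of_tendsto hlim (by
    filter_upwards [Ioo_mem_nhdsGT hx] with y hy using key y hy.1 hy.2)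
  rw [sub_zero] at this
  exact le_of_mul_le_mul_right this hx

theorem primitive_mono {x y : ℝ} (h : x ≤ y) : primitive u x ≤ primitive u y :=
  lintegral_mono_set (Ioo_subset_Ioo_right h)

theorem exists_primitive_le {x : ℝ} (hx : 0 < x) (h : primitive u x ≠ ∞) {ε : ℝ} (hε : 0 < ε) :
    ∃ δ, 0 < δ ∧ primitive u δ ≤ ENNReal.ofReal ε := by
  obtain ⟨η, hη, H⟩ := exists_pos_setLIntegral_lt_of_measure_lt (μ := volume.restrict (Ioo 0 x))
    (f := u) h (ENNReal.ofReal_pos.2 hε).ne'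
  obtain ⟨r, hr0, hr⟩ : ∃ r : ℝ, 0 < r ∧ ENNReal.ofReal r < η := by
    obtain ⟨q, hq0, hq⟩ := ENNReal.lt_iff_exists_nnreal_btwn.1 hη
    exact ⟨q, by exact_mod_cast hq0, by simpa using hq⟩
  refine ⟨min r x, lt_min hr0 hx, ?_⟩
  have h2 := H (Ioo 0 (min r x)) (by
    refine lt_of_le_of_lt (Measure.restrict_apply_le _ _) (lt_of_le_of_lt ?_ hr)
    rw [Real.volume_Ioo]
    exact ENNReal.ofReal_le_ofReal (by simp))
  rw [Measure.restrict_restrict measurableSet_Ioo,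
    inter_eq_left.2 (Ioo_subset_Ioo_right (min_le_right _ _))] at h2
  exact h2.le

theorem primitive_le_of_levelDeriv_le {M : ℝ≥0}
    (hfin : ∀ y, 0 < y → leastConcaveMajorant (primitive u) y ≠ ∞)
    (h : ∀ᵐ x ∂halfLine, levelDeriv u x ≤ M) {x : ℝ} (hx : 0 < x) :
    primitive u x ≤ M * ENNReal.ofReal x := by
  have hc := concaveOn_lcm hfin
  have hle : ∀ y, 0 < y → primitive u y ≤ ENNReal.ofReal
      (leastConcaveMajorant (primitive u) y).toReal := fun y hy => by
    rw [ENNReal.ofReal_toReal (hfin y hy)]; exact le_leastConcaveMajorant hy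
  have hle' : ∀ φ, IsConcaveMajorant (primitive u) φ → ∀ y, 0 < y →
      (leastConcaveMajorant (primitive u) y).toReal ≤ φ y := fun φ hφ y hy => toReal_lcm_le hφ hy
  unfold levelDeriv at h
  set g := fun y => (leastConcaveMajorant (primitive u) y).toReal with hg
  have hg0 : ∀ y, 0 ≤ g y := fun y => ENNReal.toReal_nonneg
  have hmono := monotoneOn_of_concaveOn hc hg0
  have step : ∀ y z, 0 < y → y < z → g z ≤ g y + M * (z - y) := by
    intro y z hy hyz
    have hdiff : ∀ᵐ w ∂halfLine, DifferentiableWithinAt ℝ g (Ioi 0) w :=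
      (ae_restrict_iff' measurableSet_Ioi).2 hmono.ae_differentiableWithinAt_of_mem
    have hboth := h.and hdiff
    obtain ⟨w, hw, hw1, hw2⟩ : ∃ w ∈ Ioo 0 y, ENNReal.ofReal (deriv g w) ≤ M ∧
        DifferentiableWithinAt ℝ g (Ioi 0) w := by
      by_contra! hcon
      have hnull : halfLine (Ioo 0 y) = 0 := by
        refine measure_mono_null (fun w hw => ?_) (ae_iff.1 hboth)
        exact fun hh => hcon w hw hh.1 hh.2
      rw [Measure.restrict_apply measurableSet_Ioo, inter_eq_left.2 Ioo_subset_Ioi_self,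
        Real.volume_Ioo] at hnull
      simp only [sub_zero, ENNReal.ofReal_eq_zero] at hnull
      linarith
    have hd : DifferentiableAt ℝ g w := hw2.differentiableAt (Ioi_mem_nhds hw.1)
    rw [ENNReal.ofReal_le_iff_le_toReal ENNReal.coe_ne_top, ENNReal.coe_toReal] at hw1
    have h1 := hc.slope_le_deriv hw.1 hy hw.2 hd
    rw [slope_def_field] at h1
    have h2 := hc.slope_anti_adjacent hw.1 (lt_trans hy hyz : (0:ℝ) < z) hw.2 hyz
    have h3 := h2.trans (h1.trans hw1)
    rw [div_le_iff₀ (by linarith)] at h3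
    linarith
  have main : ∀ ε : ℝ, 0 < ε → g x ≤ ε + M * x := by
    intro ε hε
    obtain ⟨δ, hδ, hδε⟩ := exists_primitive_le hx
      (ne_top_of_le_ne_top ENNReal.ofReal_ne_top (hle x hx)) hε
    set C : ℝ := g δ / δ + M with hC
    have hC0 : 0 ≤ C := add_nonneg (div_nonneg (hg0 _) hδ.le) M.2
    have hmaj : IsConcaveMajorant (primitive u) fun y => ε + C * y := by
      refine isConcaveMajorant_affine hε.le hC0 fun y hy => ?_
      rcases le_total y δ with hyδ | hyδ
      · exact (primitive_mono hyδ).trans (hδε.trans (ENNReal.ofReal_le_ofReal (by nlinarith)))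
      · refine (hle y hy).trans (ENNReal.ofReal_le_ofReal ?_)
        have h1 : g y ≤ g δ + M * (y - δ) := by
          rcases eq_or_lt_of_le hyδ with rfl | hlt
          · simp
          · exact step δ y hδ hlt
        have h2 : g δ ≤ g δ / δ * y := by
          calc g δ = g δ / δ * δ := by field_simp
            _ ≤ g δ / δ * y := mul_le_mul_of_nonneg_left hyδ (div_nonneg (hg0 _) hδ.le)
        have h3 : (M : ℝ) * (y - δ) ≤ M * y := by
          nlinarith [M.coe_nonneg]
        show g y ≤ ε + C * y
        rw [hC]; nlinarith
    have hb := hle' _ hmaj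
    have hlim : Tendsto (fun y => ε + C * y + M * (x - y)) (𝓝[>] 0)
        (𝓝 (ε + C * 0 + M * (x - 0))) :=
      (Continuous.tendsto (by fun_prop) 0).mono_left nhdsWithin_le_nhds
    have := ge_of_tendsto hlim (b := g x) (by
      filter_upwards [Ioo_mem_nhdsGT hx] with y hy
      have h1 : g y ≤ ε + C * y := hb y hy.1
      linarith [step y x hy.1 hy.2])
    simpa using this
  have hfinal : g x ≤ M * x := le_of_forall_pos_le_add fun ε hε => by linarith [main ε hε]
  refine (hle x hx).trans ((ENNReal.ofReal_le_ofReal hfinal).trans (le_of_eq ?_))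
  rw [ENNReal.ofReal_mul M.coe_nonneg, ENNReal.ofReal_coe_nnreal]

/-- The essential supremum of the level function is `sup_{x > 0} (1/x) ∫₀ˣ u`. -/
theorem essSup_levelFunction_le_iff (hu : AEMeasurable u halfLine) (M : ℝ≥0∞) :
    essSup (levelFunction u) halfLine ≤ M ↔
      ∀ x, 0 < x → primitive u x ≤ M * ENNReal.ofReal x := by
  induction M with
  | top =>
    refine iff_of_true le_top fun x hx => ?_
    rw [ENNReal.top_mul (ENNReal.ofReal_pos.2 hx).ne']
    exact le_top
  | coe M =>
    constructor
    · intro h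
      have hae : ∀ᵐ x ∂halfLine, levelFunction u x ≤ M := by
        filter_upwards [ENNReal.ae_le_essSup (μ := halfLine) (levelFunction u)] with x hx
        exact hx.trans h
      by_cases hfin : ∀ y, 0 < y → leastConcaveMajorant (primitive u) y ≠ ∞
      · simp only [levelFunction, if_pos hfin] at hae
        exact fun x hx => primitive_le_of_levelDeriv_le hfin hae hx
      · simp only [levelFunction, if_neg hfin, iSup_le_iff] at hae
        have htr : ∀ (n : ℕ) (x : ℝ), 0 < x →
            primitive (fun y => min (u y) n) x ≤ M * ENNReal.ofReal x := by
          intro n x hx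
          have hlin : ∀ z, 0 < z → primitive (fun y => min (u y) n) z ≤
              ((n : ℝ≥0) : ℝ≥0∞) * ENNReal.ofReal z := by
            intro z hz
            calc primitive (fun y => min (u y) n) z
                ≤ ∫⁻ _ in Ioo 0 z, (n : ℝ≥0∞) := lintegral_mono fun y => min_le_right _ _
              _ = _ := by simp
          refine primitive_le_of_levelDeriv_le (fun y _ => ?_) ?_ hx
          · exact ne_top_of_le_ne_top ENNReal.ofReal_ne_top
              (leastConcaveMajorant_le (lcm_ne_top_of_linear hlin) y)
          · filter_upwards [hae] with y hy using hy n
        intro x hx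
        have hmc : primitive u x = ⨆ n : ℕ, primitive (fun y => min (u y) n) x := by
          unfold primitive
          rw [← lintegral_iSup']
          · refine lintegral_congr fun y => ?_
            refine le_antisymm ?_ (iSup_le fun n => min_le_left _ _)
            refine le_of_forall_lt fun c hc => ?_
            obtain ⟨n, hn⟩ := ENNReal.exists_nat_gt (ne_top_of_lt hc)
            exact lt_of_lt_of_le (lt_min hc hn) (le_iSup (fun n : ℕ => min (u y) n) n)
          · intro n
            exact ((hu.mono_measure (Measure.restrict_mono Ioo_subset_Ioi_self le_rfl)).min
              aemeasurable_const)
          · refine Eventually.of_forall fun y m n hmn => ?_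
            exact min_le_min_left _ (by exact_mod_cast hmn)
        rw [hmc]
        exact iSup_le fun n => htr n x hx
    · intro h
      have hfin : ∀ y, 0 < y → leastConcaveMajorant (primitive u) y ≠ ∞ := fun y _ =>
        ne_top_of_le_ne_top ENNReal.ofReal_ne_top
          (leastConcaveMajorant_le (lcm_ne_top_of_linear h) y)
      refine essSup_le_of_ae_le _ ?_
      filter_upwards [ae_restrict_mem measurableSet_Ioi] with x hx
      simp only [levelFunction, if_pos hfin]
      exact levelDeriv_le h hx

end LevelFacts

/-! ### Banach spaces and couples inside a common vector space -/

section Couples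

variable (𝕜 : Type*) [RCLike 𝕜]

/-- A Banach space that is a linear subspace of a vector space `V`, given by its norm, extended by `∞` to the vectors outside the space. -/
structure BanachSubspace (V : Type*) [AddCommGroup V] [Module 𝕜 V] where
  /-- The norm; the space consists of the vectors of finite norm. -/
  nrm : V → ℝ≥0∞
  eq_zero : ∀ v, nrm v = 0 → v = 0
  smul_eq : ∀ (c : 𝕜) (v : V), nrm (c • v) = ‖c‖ₑ * nrm v
  add_le : ∀ v w, nrm (v + w) ≤ nrm v + nrm w
  complete : ∀ s : ℕ → V, (∀ k, nrm (s k) < ∞) →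
    (∀ ε : ℝ≥0∞, 0 < ε → ∃ N, ∀ m, N ≤ m → ∀ n, N ≤ n → nrm (s m - s n) < ε) →
    ∃ v, nrm v < ∞ ∧ Tendsto (fun n => nrm (s n - v)) atTop (𝓝 0)

variable {𝕜} {V W : Type*} [AddCommGroup V] [Module 𝕜 V] [AddCommGroup W] [Module 𝕜 W]

/-- The underlying vector space of a Banach subspace. -/
def BanachSubspace.space (X : BanachSubspace 𝕜 V) : Submodule 𝕜 V where
  carrier := {v | X.nrm v < ∞}
  zero_mem' := by
    have h := X.smul_eq 0 0
    rw [enorm_zero, zero_mul, smul_zero] at h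
    simp [h]
  add_mem' {v w} hv hw := lt_of_le_of_lt (X.add_le v w) (ENNReal.add_lt_top.2 ⟨hv, hw⟩)
  smul_mem' c v hv := by
    show X.nrm (c • v) < ∞
    rw [X.smul_eq]
    exact ENNReal.mul_lt_top enorm_lt_top hv

variable (𝕜 V) in
/-- A compatible couple `(X₀, X₁)` of Banach spaces. The condition `separated` says that
`inf {‖x₀‖ + ‖x₁‖ : x₀ + x₁ = x}` is a norm on `X₀ + X₁`; it holds if and only if `X₀` and `X₁`
embed continuously, with the given identifications, in some Hausdorff topological vector space. -/
structure CompatibleCouple where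
  X₀ : BanachSubspace 𝕜 V
  X₁ : BanachSubspace 𝕜 V
  separated : ∀ v, (∀ ε : ℝ≥0∞, 0 < ε → ∃ a b, a + b = v ∧ X₀.nrm a + X₁.nrm b < ε) → v = 0

namespace CompatibleCouple

/-- The space `X₀ + X₁`. -/
def sum (X : CompatibleCouple 𝕜 V) : Submodule 𝕜 V := X.X₀.space ⊔ X.X₁.space

/-- The `K`-functional `K(t, x; X₀, X₁)`. (Decompositions with `x₀ ∉ X₀` or `x₁ ∉ X₁` contribute
the value `∞` when `t > 0`.) -/
noncomputable def K (X : CompatibleCouple 𝕜 V) (t : ℝ≥0) (x : V) : ℝ≥0∞ :=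
  ⨅ (x₀ : V) (x₁ : V) (_ : x₀ + x₁ = x), X.X₀.nrm x₀ + t * X.X₁.nrm x₁

/-- The linear operator `T : X₀ + X₁ → Y₀ + Y₁` maps `X_j` boundedly into `Y_j` for `j = 0, 1`,
and its norm as an operator `(X₀, X₁) → (Y₀, Y₁)` is at most `c`. -/
def NormAtMost {X : CompatibleCouple 𝕜 V} {Y : CompatibleCouple 𝕜 W} (T : X.sum →ₗ[𝕜] Y.sum)
    (c : ℝ≥0) : Prop :=
  (∀ x : X.sum, (x : V) ∈ X.X₀.space → Y.X₀.nrm (T x) ≤ c * X.X₀.nrm x) ∧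
  (∀ x : X.sum, (x : V) ∈ X.X₁.space → Y.X₁.nrm (T x) ≤ c * X.X₁.nrm x)

/-- `[(X₀, X₁), (Y₀, Y₁)]` is a `c`-uniform relative Calderón–Mityagin pair. -/
def IsRelativeCMPair (c : ℝ≥0) (X : CompatibleCouple 𝕜 V) (Y : CompatibleCouple 𝕜 W) : Prop :=
  ∀ (x : X.sum) (y : Y.sum), (∀ t : ℝ≥0, 0 < t → Y.K t y ≤ X.K t x) →
    ∃ T : X.sum →ₗ[𝕜] Y.sum, NormAtMost T c ∧ T x = y

/-- Exact relative Calderón–Mityagin pairs. -/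
def IsExactRelativeCMPair (X : CompatibleCouple 𝕜 V) (Y : CompatibleCouple 𝕜 W) : Prop :=
  IsRelativeCMPair 1 X Y

/-- Exact Calderón–Mityagin couples. -/
def IsExactCMCouple (X : CompatibleCouple 𝕜 V) : Prop :=
  IsExactRelativeCMPair X X

end CompatibleCouple

end Couples

/-! ### The spaces `L¹`, `L^∞` and `(L^∞)ᵒ` on the half line -/

section Spaces

variable (𝕜 : Type*) [RCLike 𝕜]

/-- Measurable functions on `(0, ∞)`, up to equality almost everywhere. -/
abbrev L0 : Type _ := ℝ →ₘ[halfLine] 𝕜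

/-- The Lebesgue space `Lᵖ` on `(0, ∞)`. -/
noncomputable def lebesgue (p : ℝ≥0∞) (hp : 1 ≤ p) : BanachSubspace 𝕜 (L0 𝕜) where
  nrm f := eLpNorm f p halfLine
  eq_zero f h := by
    rw [eLpNorm_eq_zero_iff f.aestronglyMeasurable (by positivity)] at h
    exact AEEqFun.ext (h.trans AEEqFun.coeFn_zero.symm)
  smul_eq c f := by
    rw [eLpNorm_congr_ae (AEEqFun.coeFn_smul c f), eLpNorm_const_smul]
  add_le f g := by
    rw [eLpNorm_congr_ae (AEEqFun.coeFn_add f g)]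
    exact eLpNorm_add_le f.aestronglyMeasurable g.aestronglyMeasurable hp
  complete s hs hc := by
    have : Fact (1 ≤ p) := ⟨hp⟩
    let σ : ℕ → Lp 𝕜 p halfLine := fun k => ⟨s k, Lp.mem_Lp_iff_eLpNorm_lt_top.2 (hs k)⟩
    have hσ : ∀ (m : ℕ) (g : Lp 𝕜 p halfLine),
        edist (σ m) g = eLpNorm (s m - (g : L0 𝕜) : L0 𝕜) p halfLine := fun m g => by
      rw [Lp.edist_def]
      exact (eLpNorm_congr_ae (AEEqFun.coeFn_sub _ _)).symm
    have hcs : CauchySeq σ := by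
      refine EMetric.cauchySeq_iff.2 fun ε hε => ?_
      obtain ⟨N, hN⟩ := hc ε hε
      exact ⟨N, fun m hm n hn => by rw [hσ]; exact hN m hm n hn⟩
    obtain ⟨g, hg⟩ := cauchySeq_tendsto_of_complete hcs
    refine ⟨g, Lp.mem_Lp_iff_eLpNorm_lt_top.1 g.2, ?_⟩
    simpa only [hσ] using tendsto_iff_edist_tendsto_0.1 hg

variable {𝕜}

/-- The norm of `f` in `(L^∞)ᵒ`, that is, the `L^∞` norm of the level function of `f`. -/
noncomputable def levelNorm (f : L0 𝕜) : ℝ≥0∞ :=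
  essSup (levelFunction fun x => ‖f x‖ₑ) halfLine

theorem levelNorm_le_iff (f : L0 𝕜) (M : ℝ≥0∞) : levelNorm f ≤ M ↔
    ∀ x, 0 < x → ∫⁻ y in Ioo 0 x, ‖f y‖ₑ ≤ M * ENNReal.ofReal x :=
  essSup_levelFunction_le_iff f.aestronglyMeasurable.enorm M

theorem lintegral_le_levelNorm (f : L0 𝕜) {x : ℝ} (hx : 0 < x) :
    ∫⁻ y in Ioo 0 x, ‖f y‖ₑ ≤ levelNorm f * ENNReal.ofReal x :=
  (levelNorm_le_iff f _).1 le_rfl x hx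

theorem ae_Ioo {P : ℝ → Prop} (h : ∀ᵐ x ∂halfLine, P x) (x : ℝ) :
    ∀ᵐ y ∂volume.restrict (Ioo 0 x), P y :=
  ae_mono (Measure.restrict_mono Ioo_subset_Ioi_self le_rfl) h

theorem ae_halfLine {P : ℝ → Prop} (h : ∀ n : ℕ, ∀ᵐ y ∂volume.restrict (Ioo (0 : ℝ) (n + 1)), P y) :
    ∀ᵐ x ∂halfLine, P x := by
  have hU : Ioi (0 : ℝ) = ⋃ n : ℕ, Ioo (0 : ℝ) (n + 1) := by
    ext x
    simp only [mem_Ioi, mem_iUnion, mem_Ioo]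
    refine ⟨fun hx => ?_, fun ⟨n, hn⟩ => hn.1⟩
    obtain ⟨n, hn⟩ := exists_nat_gt x
    exact ⟨n, hx, by linarith⟩
  rw [halfLine, hU, ae_restrict_iUnion_iff]
  exact h

theorem levelNorm_eq_zero (f : L0 𝕜) (h : levelNorm f = 0) : f = 0 := by
  refine AEEqFun.ext (EventuallyEq.trans ?_ AEEqFun.coeFn_zero.symm)
  refine ae_halfLine fun n => ?_
  have h1 := lintegral_le_levelNorm f (x := n + 1) (by positivity)
  rw [h, zero_mul, nonpos_iff_eq_zero, lintegral_eq_zero_iff'] at h1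
  · filter_upwards [h1] with y hy
    simpa using hy
  · exact (f.aestronglyMeasurable.mono_measure
      (Measure.restrict_mono Ioo_subset_Ioi_self le_rfl)).enorm

theorem levelNorm_smul_le (c : 𝕜) (f : L0 𝕜) : levelNorm (c • f) ≤ ‖c‖ₑ * levelNorm f := by
  refine (levelNorm_le_iff _ _).2 fun x hx => ?_
  have h : ∫⁻ y in Ioo 0 x, ‖(c • f : L0 𝕜) y‖ₑ = ‖c‖ₑ * ∫⁻ y in Ioo 0 x, ‖f y‖ₑ := by
    rw [← lintegral_const_mul' _ _ enorm_ne_top]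
    refine lintegral_congr_ae ?_
    filter_upwards [ae_Ioo (AEEqFun.coeFn_smul c f) x] with y hy
    rw [hy, Pi.smul_apply, enorm_smul]
  rw [h, mul_assoc]
  gcongr
  exact lintegral_le_levelNorm f hx

theorem levelNorm_add_le (f g : L0 𝕜) : levelNorm (f + g) ≤ levelNorm f + levelNorm g := by
  refine (levelNorm_le_iff _ _).2 fun x hx => ?_
  calc ∫⁻ y in Ioo 0 x, ‖(f + g : L0 𝕜) y‖ₑ
      ≤ ∫⁻ y in Ioo 0 x, (‖f y‖ₑ + ‖g y‖ₑ) := by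
        refine lintegral_mono_ae ?_
        filter_upwards [ae_Ioo (AEEqFun.coeFn_add f g) x] with y hy
        rw [hy]
        exact enorm_add_le _ _
    _ = (∫⁻ y in Ioo 0 x, ‖f y‖ₑ) + ∫⁻ y in Ioo 0 x, ‖g y‖ₑ :=
        lintegral_add_left' (f.aestronglyMeasurable.mono_measure
          (Measure.restrict_mono Ioo_subset_Ioi_self le_rfl)).enorm _
    _ ≤ (levelNorm f + levelNorm g) * ENNReal.ofReal x := by
        rw [add_mul]
        exact add_le_add (lintegral_le_levelNorm f hx) (lintegral_le_levelNorm g hx)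

theorem levelNorm_complete (s : ℕ → L0 𝕜) (hs : ∀ k, levelNorm (s k) < ∞)
    (hc : ∀ ε : ℝ≥0∞, 0 < ε → ∃ N, ∀ m, N ≤ m → ∀ n, N ≤ n → levelNorm (s m - s n) < ε) :
    ∃ v, levelNorm v < ∞ ∧ Tendsto (fun n => levelNorm (s n - v)) atTop (𝓝 0) := by
  have hmeas : ∀ (f : L0 𝕜) (x : ℝ), AEStronglyMeasurable f (volume.restrict (Ioo 0 x)) :=
    fun f x => f.aestronglyMeasurable.mono_measure
      (Measure.restrict_mono Ioo_subset_Ioi_self le_rfl)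
  choose N hN using fun k : ℕ => hc ((2 : ℝ≥0∞)⁻¹ ^ k)
    (ENNReal.pow_pos (ENNReal.inv_pos.2 (by simp)) k)
  -- a rapidly Cauchy subsequence
  let κ : ℕ → ℕ := fun k => k + ∑ i ∈ Finset.range (k + 1), N i
  have hκ : ∀ i k, i ≤ k → N i ≤ κ k := fun i k hik => by
    have h := Finset.single_le_sum (f := N) (fun _ _ => Nat.zero_le _)
      (Finset.mem_range.2 (Nat.lt_succ_of_le hik))
    exact h.trans (Nat.le_add_left _ _)
  have hκk : ∀ k, k ≤ κ k := fun k => Nat.le_add_right _ _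
  have hlim : ∀ᵐ x ∂halfLine, ∃ l : 𝕜, Tendsto (fun k => s (κ k) x) atTop (𝓝 l) := by
    refine ae_halfLine fun n => ?_
    have hpos : ENNReal.ofReal ((n : ℝ) + 1) ≠ 0 := (ENNReal.ofReal_pos.2 (by positivity)).ne'
    refine Lp.ae_tendsto_of_cauchy_eLpNorm (p := 1) (fun k => hmeas _ _) le_rfl
      (B := fun k => (2 : ℝ≥0∞)⁻¹ ^ k * ENNReal.ofReal ((n : ℝ) + 1)) ?_ fun k i j hi hj => ?_
    · rw [ENNReal.tsum_mul_right, ENNReal.tsum_geometric]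
      exact ENNReal.mul_ne_top (by simp) ENNReal.ofReal_ne_top
    · rw [eLpNorm_one_eq_lintegral_enorm]
      calc ∫⁻ y in Ioo (0 : ℝ) (n + 1), ‖(⇑(s (κ i)) - ⇑(s (κ j))) y‖ₑ
          = ∫⁻ y in Ioo (0 : ℝ) (n + 1), ‖(s (κ i) - s (κ j) : L0 𝕜) y‖ₑ := by
            refine lintegral_congr_ae ?_
            filter_upwards [ae_Ioo (AEEqFun.coeFn_sub (s (κ i)) (s (κ j))) (n + 1)] with y hy
            rw [hy]
        _ ≤ levelNorm (s (κ i) - s (κ j)) * ENNReal.ofReal ((n : ℝ) + 1) :=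
            lintegral_le_levelNorm _ (by positivity)
        _ < (2 : ℝ≥0∞)⁻¹ ^ k * ENNReal.ofReal ((n : ℝ) + 1) :=
            ENNReal.mul_lt_mul_left hpos ENNReal.ofReal_ne_top (hN k _ (hκ k i hi) _ (hκ k j hj))
  obtain ⟨v, hvm, hv⟩ := exists_stronglyMeasurable_limit_of_tendsto_ae
    (fun k => (s (κ k)).aestronglyMeasurable) hlim
  let w : L0 𝕜 := AEEqFun.mk v hvm.aestronglyMeasurable
  have hw : ∀ᵐ x ∂halfLine, Tendsto (fun k => s (κ k) x) atTop (𝓝 (w x)) := by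
    filter_upwards [hv, AEEqFun.coeFn_mk v hvm.aestronglyMeasurable] with x h1 h2
    rw [h2]; exact h1
  have hbd : ∀ (ε : ℝ≥0∞) (m : ℕ), (∃ K, ∀ n, K ≤ n → levelNorm (s m - s n) ≤ ε) →
      levelNorm (s m - w) ≤ ε := by
    rintro ε m ⟨K, hK⟩
    refine (levelNorm_le_iff _ _).2 fun x hx => ?_
    calc ∫⁻ y in Ioo 0 x, ‖(s m - w : L0 𝕜) y‖ₑ
        = ∫⁻ y in Ioo 0 x, liminf (fun k => ‖(s m - s (κ k) : L0 𝕜) y‖ₑ) atTop := by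
          refine lintegral_congr_ae ?_
          have hall := ae_all_iff.2 fun k => AEEqFun.coeFn_sub (s m) (s (κ k))
          filter_upwards [ae_Ioo hw x, ae_Ioo (AEEqFun.coeFn_sub (s m) w) x, ae_Ioo hall x]
            with y h1 h2 h3
          rw [h2]
          simp only [h3, Pi.sub_apply]
          exact ((tendsto_const_nhds.sub h1).enorm.liminf_eq).symm
      _ ≤ liminf (fun k => ∫⁻ y in Ioo 0 x, ‖(s m - s (κ k) : L0 𝕜) y‖ₑ) atTop :=
          lintegral_liminf_le' fun k => (hmeas _ _).enorm
      _ ≤ ε * ENNReal.ofReal x := by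
          refine liminf_le_of_frequently_le' (Eventually.frequently ?_)
          filter_upwards [eventually_ge_atTop K] with k hk
          refine (lintegral_le_levelNorm _ hx).trans ?_
          gcongr
          exact hK _ (hk.trans (hκk k))
  have htend : Tendsto (fun n => levelNorm (s n - w)) atTop (𝓝 0) := by
    refine ENNReal.tendsto_nhds_zero.2 fun ε hε => ?_
    obtain ⟨M, hM⟩ := hc ε hε
    filter_upwards [eventually_ge_atTop M] with m hm
    exact hbd ε m ⟨M, fun n hn => (hM m hm n hn).le⟩
  refine ⟨w, ?_, htend⟩
  obtain ⟨m, hm⟩ := ((ENNReal.tendsto_nhds_zero.1 htend) 1 one_pos).exists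
  have h1 : w = s m + (-1 : 𝕜) • (s m - w) := by
    have h2 : (-1 : 𝕜) • (s m - w) = -(s m - w) := neg_one_smul 𝕜 (s m - w)
    rw [h2, neg_sub, add_sub_cancel]
  rw [h1]
  refine lt_of_le_of_lt (levelNorm_add_le _ _) (ENNReal.add_lt_top.2 ⟨hs m, ?_⟩)
  refine lt_of_le_of_lt (levelNorm_smul_le _ _) (ENNReal.mul_lt_top enorm_lt_top ?_)
  exact lt_of_le_of_lt hm ENNReal.one_lt_top

variable (𝕜)

/-- The space `(L^∞)ᵒ` of the functions whose level function belongs to `L^∞`. -/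
noncomputable def levelLinfty : BanachSubspace 𝕜 (L0 𝕜) where
  nrm := levelNorm
  eq_zero := levelNorm_eq_zero
  smul_eq c f := by
    refine le_antisymm (levelNorm_smul_le c f) ?_
    rcases eq_or_ne c 0 with rfl | hc
    · simp
    have h := levelNorm_smul_le c⁻¹ (c • f)
    rw [smul_smul, inv_mul_cancel₀ hc, one_smul] at h
    calc ‖c‖ₑ * levelNorm f ≤ ‖c‖ₑ * (‖c⁻¹‖ₑ * levelNorm (c • f)) := by gcongr
      _ = levelNorm (c • f) := by
        rw [← mul_assoc, ← enorm_mul, mul_inv_cancel₀ hc, enorm_one, one_mul]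
  add_le := levelNorm_add_le
  complete := levelNorm_complete

variable {𝕜}

theorem levelNorm_le_eLpNorm (f : L0 𝕜) : levelNorm f ≤ eLpNorm f ∞ halfLine := by
  refine (levelNorm_le_iff _ _).2 fun x hx => ?_
  calc ∫⁻ y in Ioo 0 x, ‖f y‖ₑ ≤ ∫⁻ _ in Ioo 0 x, eLpNorm f ∞ halfLine := by
        refine lintegral_mono_ae ?_
        rw [eLpNorm_exponent_top]
        exact ae_Ioo (enorm_ae_le_eLpNormEssSup f halfLine) x
    _ = _ := by simp

theorem separated_level (v : L0 𝕜)
    (h : ∀ ε : ℝ≥0∞, 0 < ε → ∃ a b : L0 𝕜, a + b = v ∧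
      eLpNorm a 1 halfLine + levelNorm b < ε) : v = 0 := by
  refine levelNorm_eq_zero v (nonpos_iff_eq_zero.1 ((levelNorm_le_iff _ _).2 fun x hx => ?_))
  rw [zero_mul]
  refine le_of_forall_gt fun δ hδ => ?_
  have hC : (1 + ENNReal.ofReal x) ≠ ∞ := by simp
  have hC0 : (1 + ENNReal.ofReal x) ≠ 0 := by simp
  obtain ⟨a, b, rfl, hab⟩ := h (δ / (1 + ENNReal.ofReal x)) (ENNReal.div_pos hδ.ne' hC)
  calc ∫⁻ y in Ioo 0 x, ‖(a + b : L0 𝕜) y‖ₑ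
      ≤ ∫⁻ y in Ioo 0 x, (‖a y‖ₑ + ‖b y‖ₑ) := by
        refine lintegral_mono_ae ?_
        filter_upwards [ae_Ioo (AEEqFun.coeFn_add a b) x] with y hy
        rw [hy]
        exact enorm_add_le _ _
    _ = (∫⁻ y in Ioo 0 x, ‖a y‖ₑ) + ∫⁻ y in Ioo 0 x, ‖b y‖ₑ :=
        lintegral_add_left' (a.aestronglyMeasurable.mono_measure
          (Measure.restrict_mono Ioo_subset_Ioi_self le_rfl)).enorm _
    _ ≤ eLpNorm a 1 halfLine + levelNorm b * ENNReal.ofReal x := by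
        refine add_le_add ?_ (lintegral_le_levelNorm b hx)
        rw [eLpNorm_one_eq_lintegral_enorm]
        exact lintegral_mono_set Ioo_subset_Ioi_self
    _ ≤ (eLpNorm a 1 halfLine + levelNorm b) * (1 + ENNReal.ofReal x) := by
        rw [add_mul, mul_add, mul_add, mul_one, mul_one]
        exact add_le_add le_self_add le_add_self
    _ < δ := (ENNReal.lt_div_iff_mul_lt (Or.inl hC0) (Or.inl hC)).1 hab

variable (𝕜)

/-- The couple `(L¹, L^∞)` on the half line. -/
noncomputable def coupleL1Linfty : CompatibleCouple 𝕜 (L0 𝕜) where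
  X₀ := lebesgue 𝕜 1 le_rfl
  X₁ := lebesgue 𝕜 ∞ le_top
  separated v h := separated_level v fun ε hε => by
    obtain ⟨a, b, hab, hlt⟩ := h ε hε
    exact ⟨a, b, hab, lt_of_le_of_lt (add_le_add le_rfl (levelNorm_le_eLpNorm b)) hlt⟩

/-- The couple `(L¹, (L^∞)ᵒ)` on the half line. -/
noncomputable def coupleL1LevelLinfty : CompatibleCouple 𝕜 (L0 𝕜) where
  X₀ := lebesgue 𝕜 1 le_rfl
  X₁ := levelLinfty 𝕜
  separated := separated_level

/-- The constant `n` is such that for each `f ∈ L¹ + (L^∞)ᵒ` there is a linear operator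
`N : (L¹, (L^∞)ᵒ) → (L¹, L^∞)` of norm at most `n` with `N f = fᵒ`. -/
def IsLevelConstant (n : ℝ≥0) : Prop :=
  ∀ f : (coupleL1LevelLinfty 𝕜).sum,
    ∃ N : (coupleL1LevelLinfty 𝕜).sum →ₗ[𝕜] (coupleL1Linfty 𝕜).sum,
      CompatibleCouple.NormAtMost N n ∧
      ∀ᵐ x ∂halfLine, (N f : L0 𝕜) x =
        (((levelFunction fun y => ‖(f : L0 𝕜) y‖ₑ) x).toReal : 𝕜)

end Spaces

end CalderonMityagin

open CalderonMityagin

/-! Write `x → y` when some operator of norm at most `c` maps `x` to `y` (`IsImage`). These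
relations compose, the constants multiply, and for `c = 1` they do not increase the `K`-functional.
So it suffices to factor `x → y` through functions whose `K`-functional is known.

The norm of `(L^∞)ᵒ` is `sup (1/t) ∫₀ᵗ |f|` (`levelNorm_le_iff`). Hence an operator that increases
none of the integrals `∫₀ᵗ |h|` has norm at most one on `(L¹, (L^∞)ᵒ)`. This gives the basic tool
`isImage_of_lintegral_le`: if `∫₀ᵗ |y| ≤ ∫₀ᵗ |f|` for all `t`, then `f → y` in that couple, by
monotone transport of the mass of `f` to the right.

Always `∫₀ᵗ |y| ≤ K(t, y; L¹, (L^∞)ᵒ) ≤ K(t, y; L¹, L^∞)`, and the last quantity is at most `∫₀ᵗ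
|y|` for decreasing `y` (`lintegral_le_K`, `K_level_le_K`, `K_le_lintegral`). So decreasing
functions are the right intermediate points.

In `(L¹, (L^∞)ᵒ)` the intermediate point is the level function. The primitive of `fᵒ` is the least
concave majorant of that of `|f|`, so `fᵒ → f` by transport. Conversely `f → fᵒ`, because `fᵒ`
equals `|f|` on the set where primitive and majorant touch and is a mean of `|f|` on each gap of
that set, where the majorant is affine; on an unbounded gap the mean is a limit along an ultrafilter
(`isImage_levelL0`). In `(L¹, L^∞)` the intermediate point is the decreasing rearrangement, reached
and left by conditional expectation over the common law of two functions with equal distribution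
above the level at which the distribution becomes infinite, together with a generalized limit for
the part below it (`exists_rearrangement`).

Then (a) is `x → xᵒ → y`. For (b), pass from `x` to its rearrangement `w`, then transport `w → y`.
For (c), let `w` be the rearrangement of `y`; then `x → w` by (a), the admissible operator sends `w`
to `wᵒ = w` in `L¹ + L^∞`, and `w → y`. The constant 2 is admissible since a decreasing `w` is fixed
by `h ↦ w(x) (∫ w)⁻¹ ∫ h`, with integrals over `(x/2, x)` (`isImage_two_of_isDecreasing`). For (d),
no operator of norm one fixes the decreasing staircase with values 2 and 1
(`not_isImage_staircase`). -/

namespace CalderonMityagin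

/-! ### Composition of operators between couples -/

section Images

variable {𝕜 : Type*} [RCLike 𝕜] {U V W : Type*} [AddCommGroup U] [Module 𝕜 U]
  [AddCommGroup V] [Module 𝕜 V] [AddCommGroup W] [Module 𝕜 W]

namespace CompatibleCouple

/-- `y` is the image of `x` under an operator `X → Y` of norm at most `c`. -/
def IsImage (c : ℝ≥0) (X : CompatibleCouple 𝕜 V) (Y : CompatibleCouple 𝕜 W) (x : V) (y : W) :
    Prop :=
  ∃ (hx : x ∈ X.sum) (hy : y ∈ Y.sum) (T : X.sum →ₗ[𝕜] Y.sum),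
    NormAtMost T c ∧ T ⟨x, hx⟩ = ⟨y, hy⟩

theorem mem_sum_left {X : CompatibleCouple 𝕜 V} {v : V} (h : X.X₀.nrm v < ∞) : v ∈ X.sum :=
  Submodule.mem_sup_left h

theorem mem_sum_right {X : CompatibleCouple 𝕜 V} {v : V} (h : X.X₁.nrm v < ∞) : v ∈ X.sum :=
  Submodule.mem_sup_right h

theorem mem_sum_iff {X : CompatibleCouple 𝕜 V} {v : V} :
    v ∈ X.sum ↔ ∃ a b, X.X₀.nrm a < ∞ ∧ X.X₁.nrm b < ∞ ∧ a + b = v := by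
  rw [sum, Submodule.mem_sup]
  exact ⟨fun ⟨a, ha, b, hb, h⟩ => ⟨a, b, ha, hb, h⟩, fun ⟨a, b, ha, hb, h⟩ => ⟨a, ha, b, hb, h⟩⟩

theorem IsImage.mem_right {c : ℝ≥0} {X : CompatibleCouple 𝕜 V} {Y : CompatibleCouple 𝕜 W} {x : V}
    {y : W} (h : IsImage c X Y x y) : y ∈ Y.sum := let ⟨_, hy, _⟩ := h; hy

theorem IsImage.trans {c d : ℝ≥0} {X : CompatibleCouple 𝕜 U} {Y : CompatibleCouple 𝕜 V}
    {Z : CompatibleCouple 𝕜 W} {x : U} {y : V} {z : W} (h₁ : IsImage c X Y x y)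
    (h₂ : IsImage d Y Z y z) : IsImage (d * c) X Z x z := by
  obtain ⟨hx, hy, T, hT, hxy⟩ := h₁
  obtain ⟨hy', hz, S, hS, hyz⟩ := h₂
  refine ⟨hx, hz, S ∘ₗ T, ⟨fun v hv => ?_, fun v hv => ?_⟩, by simp [hxy, hyz]⟩
  · have h := hT.1 v hv
    have hm : Y.X₀.nrm (T v) < ∞ := h.trans_lt (ENNReal.mul_lt_top ENNReal.coe_lt_top hv)
    refine (hS.1 (T v) hm).trans ?_
    rw [ENNReal.coe_mul, mul_assoc]
    gcongr
  · have h := hT.2 v hv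
    have hm : Y.X₁.nrm (T v) < ∞ := h.trans_lt (ENNReal.mul_lt_top ENNReal.coe_lt_top hv)
    refine (hS.2 (T v) hm).trans ?_
    rw [ENNReal.coe_mul, mul_assoc]
    gcongr

/-- An operator given on vectors, additive and homogeneous on `X₀ + X₁` and with bounds on
`X₀` and `X₁`, yields images. -/
theorem IsImage.of_map {c : ℝ≥0} {X : CompatibleCouple 𝕜 V} {Y : CompatibleCouple 𝕜 W}
    (T : V → W) (hadd : ∀ v ∈ X.sum, ∀ w ∈ X.sum, T (v + w) = T v + T w)
    (hsmul : ∀ (r : 𝕜), ∀ v ∈ X.sum, T (r • v) = r • T v)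
    (h₀ : ∀ v, X.X₀.nrm v < ∞ → Y.X₀.nrm (T v) ≤ c * X.X₀.nrm v)
    (h₁ : ∀ v, X.X₁.nrm v < ∞ → Y.X₁.nrm (T v) ≤ c * X.X₁.nrm v)
    {x : V} (hx : x ∈ X.sum) : IsImage c X Y x (T x) := by
  have hmem : ∀ v ∈ X.sum, T v ∈ Y.sum := by
    intro v hv
    obtain ⟨a, b, ha, hb, rfl⟩ := mem_sum_iff.1 hv
    rw [hadd a (mem_sum_left ha) b (mem_sum_right hb)]
    refine add_mem (mem_sum_left ?_) (mem_sum_right ?_)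
    · exact (h₀ a ha).trans_lt (ENNReal.mul_lt_top ENNReal.coe_lt_top ha)
    · exact (h₁ b hb).trans_lt (ENNReal.mul_lt_top ENNReal.coe_lt_top hb)
  refine ⟨hx, hmem x hx,
    { toFun := fun v => ⟨T v, hmem v v.2⟩
      map_add' := fun v w => Subtype.ext (hadd v v.2 w w.2)
      map_smul' := fun r v => Subtype.ext (hsmul r v v.2) }, ⟨fun v hv => ?_, fun v hv => ?_⟩, rfl⟩
  · exact h₀ v hv
  · exact h₁ v hv

/-- The `K`-functional does not increase under operators of norm at most one. -/
theorem IsImage.K_le {X : CompatibleCouple 𝕜 V} {Y : CompatibleCouple 𝕜 W} {x : V} {y : W}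
    (h : IsImage 1 X Y x y) {t : ℝ≥0} (ht : 0 < t) : Y.K t y ≤ X.K t x := by
  obtain ⟨hx, hy, T, hT, hxy⟩ := h
  refine le_iInf₂ fun a b => le_iInf fun hab => ?_
  rcases eq_or_ne (X.X₀.nrm a) ∞ with ha | ha
  · simp [ha]
  rcases eq_or_ne (X.X₁.nrm b) ∞ with hb | hb
  · simp [hb, ENNReal.mul_top, ht.ne']
  have ha' : a ∈ X.sum := mem_sum_left (lt_top_iff_ne_top.2 ha)
  have hb' : b ∈ X.sum := mem_sum_right (lt_top_iff_ne_top.2 hb)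
  have hsum : (T ⟨a, ha'⟩ : W) + T ⟨b, hb'⟩ = y := by
    have h1 : (⟨a, ha'⟩ : X.sum) + ⟨b, hb'⟩ = ⟨x, hx⟩ := Subtype.ext hab
    rw [← Submodule.coe_add, ← map_add, h1, hxy]
  refine (iInf₂_le (T ⟨a, ha'⟩ : W) (T ⟨b, hb'⟩ : W)).trans ((iInf_le _ hsum).trans ?_)
  have h1 := hT.1 ⟨a, ha'⟩ (lt_top_iff_ne_top.2 ha)
  have h2 := hT.2 ⟨b, hb'⟩ (lt_top_iff_ne_top.2 hb)
  simp only [ENNReal.coe_one, one_mul] at h1 h2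
  gcongr

end CompatibleCouple

end Images

/-! ### Function-space preliminaries and bounds for the `K`-functional -/

section FunctionSpaces

open CompatibleCouple

variable {𝕜 : Type*} [RCLike 𝕜]

/-- An operator given by its values on functions yields images. -/
theorem isImage_of_fun {c : ℝ≥0} {X Y : CompatibleCouple 𝕜 (L0 𝕜)} (T : L0 𝕜 → ℝ → 𝕜)
    (hm : ∀ h ∈ X.sum, AEStronglyMeasurable (T h) halfLine)
    (hadd : ∀ h ∈ X.sum, ∀ k ∈ X.sum, ∀ᵐ x ∂halfLine, T (h + k) x = T h x + T k x)
    (hsmul : ∀ (r : 𝕜), ∀ h ∈ X.sum, ∀ᵐ x ∂halfLine, T (r • h) x = r * T h x)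
    (h₀ : ∀ h k : L0 𝕜, X.X₀.nrm h < ∞ → k =ᵐ[halfLine] T h → Y.X₀.nrm k ≤ c * X.X₀.nrm h)
    (h₁ : ∀ h k : L0 𝕜, X.X₁.nrm h < ∞ → k =ᵐ[halfLine] T h → Y.X₁.nrm k ≤ c * X.X₁.nrm h)
    {x y : L0 𝕜} (hx : x ∈ X.sum) (hxy : y =ᵐ[halfLine] T x) : IsImage c X Y x y := by
  classical
  -- Measurability of `T h` is only available on `X₀ + X₁`; the value elsewhere is irrelevant.
  let S : L0 𝕜 → L0 𝕜 := fun h => if hh : h ∈ X.sum then AEEqFun.mk (T h) (hm h hh) else 0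
  have hS : ∀ h ∈ X.sum, S h =ᵐ[halfLine] T h := fun h hh => by
    simp only [S, dif_pos hh]
    exact AEEqFun.coeFn_mk _ _
  have hSx : S x = y := AEEqFun.ext ((hS x hx).trans hxy.symm)
  rw [← hSx]
  refine IsImage.of_map S (fun h hh k hk => AEEqFun.ext ?_) (fun r h hh => AEEqFun.ext ?_)
    (fun h hh => h₀ h _ hh (hS h (mem_sum_left hh)))
    (fun h hh => h₁ h _ hh (hS h (mem_sum_right hh))) hx
  · filter_upwards [hS _ (add_mem hh hk), hS h hh, hS k hk, AEEqFun.coeFn_add (S h) (S k),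
      hadd h hh k hk] with x h1 h2 h3 h4 h5
    rw [h1, h4, Pi.add_apply, h2, h3, h5]
  · filter_upwards [hS _ (X.sum.smul_mem r hh), hS h hh, AEEqFun.coeFn_smul r (S h),
      hsmul r h hh] with x h1 h2 h3 h4
    rw [h1, h3, Pi.smul_apply, h2, h4, smul_eq_mul]

theorem nrm_L1 (h : L0 𝕜) : (lebesgue 𝕜 1 le_rfl).nrm h = ∫⁻ x in Ioi 0, ‖h x‖ₑ :=
  eLpNorm_one_eq_lintegral_enorm

theorem nrm_Linfty_le_iff (h : L0 𝕜) (M : ℝ≥0∞) :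
    (lebesgue 𝕜 ∞ le_top).nrm h ≤ M ↔ ∀ᵐ x ∂halfLine, ‖h x‖ₑ ≤ M := by
  change eLpNorm h ∞ halfLine ≤ M ↔ _
  rw [eLpNorm_exponent_top]
  refine ⟨fun H => ?_, fun H => essSup_le_of_ae_le _ H⟩
  filter_upwards [enorm_ae_le_eLpNormEssSup h halfLine] with x hx using hx.trans H

theorem setLIntegral_Ioo_le (u : ℝ → ℝ≥0∞) (t : ℝ) :
    ∫⁻ x in Ioo 0 t, u x ≤ ∫⁻ x in Ioi 0, u x := lintegral_mono_set Ioo_subset_Ioi_self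

theorem aestronglyMeasurable_Ioo (h : L0 𝕜) (t : ℝ) :
    AEStronglyMeasurable h (volume.restrict (Ioo 0 t)) :=
  h.aestronglyMeasurable.mono_measure (Measure.restrict_mono Ioo_subset_Ioi_self le_rfl)

theorem lintegral_add_le_add (a b : L0 𝕜) (t : ℝ) :
    ∫⁻ x in Ioo 0 t, ‖(a + b : L0 𝕜) x‖ₑ ≤
      (∫⁻ x in Ioo 0 t, ‖a x‖ₑ) + ∫⁻ x in Ioo 0 t, ‖b x‖ₑ := by
  rw [← lintegral_add_left' (aestronglyMeasurable_Ioo a t).enorm]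
  refine lintegral_mono_ae ?_
  filter_upwards [ae_Ioo (AEEqFun.coeFn_add a b) t] with y hy
  rw [hy]
  exact enorm_add_le _ _

/-- The primitive of the modulus of an element of `L¹ + (L^∞)ᵒ` grows at most linearly. -/
theorem exists_affine_bound {h : L0 𝕜} (hh : h ∈ (coupleL1LevelLinfty 𝕜).sum) :
    ∃ A B : ℝ≥0, ∀ t, 0 < t →
      ∫⁻ x in Ioo 0 t, ‖h x‖ₑ ≤ A + B * ENNReal.ofReal t := by
  obtain ⟨a, b, ha, hb, rfl⟩ := mem_sum_iff.1 hh
  refine ⟨(∫⁻ x in Ioi 0, ‖a x‖ₑ).toNNReal, (levelNorm b).toNNReal, fun t ht => ?_⟩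
  have ha' : ∫⁻ x in Ioi 0, ‖a x‖ₑ ≠ ∞ := by rw [← nrm_L1]; exact ha.ne
  rw [ENNReal.coe_toNNReal ha', ENNReal.coe_toNNReal (show levelNorm b ≠ ∞ from hb.ne)]
  exact (lintegral_add_le_add a b t).trans
    (add_le_add (setLIntegral_Ioo_le _ _) (lintegral_le_levelNorm b ht))

theorem lintegral_Ioo_lt_top {h : L0 𝕜} (hh : h ∈ (coupleL1LevelLinfty 𝕜).sum) (t : ℝ) :
    ∫⁻ x in Ioo 0 t, ‖h x‖ₑ < ∞ := by
  obtain ⟨A, B, H⟩ := exists_affine_bound hh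
  rcases le_or_gt t 0 with ht | ht
  · simp [Ioo_eq_empty (not_lt.2 ht)]
  · refine (H t ht).trans_lt (ENNReal.add_lt_top.2 ⟨by simp, ENNReal.mul_lt_top (by simp) (by simp)⟩)

theorem integrableOn_Ioo {h : L0 𝕜} (hh : h ∈ (coupleL1LevelLinfty 𝕜).sum) (t : ℝ) :
    IntegrableOn h (Ioo 0 t) :=
  ⟨aestronglyMeasurable_Ioo h t, lintegral_Ioo_lt_top hh t⟩

theorem sum_le_sum_level : (coupleL1Linfty 𝕜).sum ≤ (coupleL1LevelLinfty 𝕜).sum := by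
  intro v hv
  obtain ⟨a, b, ha, hb, rfl⟩ := mem_sum_iff.1 hv
  exact add_mem (mem_sum_left ha) (mem_sum_right ((levelNorm_le_eLpNorm b).trans_lt hb))

/-- The identity is an operator `(L¹, L^∞) → (L¹, (L^∞)ᵒ)`. -/
theorem isImage_id {x : L0 𝕜} (hx : x ∈ (coupleL1Linfty 𝕜).sum) :
    IsImage 1 (coupleL1Linfty 𝕜) (coupleL1LevelLinfty 𝕜) x x :=
  IsImage.of_map id (fun _ _ _ _ => rfl) (fun _ _ _ => rfl) (fun v _ => by
    rw [ENNReal.coe_one, one_mul]; exact le_rfl) (fun v _ => by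
    rw [ENNReal.coe_one, one_mul]; exact levelNorm_le_eLpNorm v) hx

/-- The norms of both spaces of the couple are monotone with respect to the modulus. -/
def IsSolid (X : CompatibleCouple 𝕜 (L0 𝕜)) : Prop :=
  ∀ h k : L0 𝕜, (∀ᵐ x ∂halfLine, ‖k x‖ₑ ≤ ‖h x‖ₑ) →
    X.X₀.nrm k ≤ X.X₀.nrm h ∧ X.X₁.nrm k ≤ X.X₁.nrm h

theorem nrm_L1_mono {h k : L0 𝕜} (hk : ∀ᵐ x ∂halfLine, ‖k x‖ₑ ≤ ‖h x‖ₑ) :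
    (lebesgue 𝕜 1 le_rfl).nrm k ≤ (lebesgue 𝕜 1 le_rfl).nrm h := by
  rw [nrm_L1, nrm_L1]
  exact lintegral_mono_ae hk

theorem solid_Linfty : IsSolid (coupleL1Linfty 𝕜) := fun h k hk =>
  ⟨nrm_L1_mono hk, (nrm_Linfty_le_iff k _).2 (by
    filter_upwards [hk, (nrm_Linfty_le_iff h _).1 le_rfl] with x h1 h2 using h1.trans h2)⟩

theorem solid_level : IsSolid (coupleL1LevelLinfty 𝕜) := fun h k hk =>
  ⟨nrm_L1_mono hk, (levelNorm_le_iff k _).2 fun t ht =>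
    (lintegral_mono_ae (ae_Ioo hk t)).trans (lintegral_le_levelNorm h ht)⟩

/-- A function is mapped to every function of smaller modulus by a multiplier. -/
theorem isImage_of_enorm_le {X : CompatibleCouple 𝕜 (L0 𝕜)} (hX : IsSolid X) {f k : L0 𝕜}
    (hf : f ∈ X.sum) (hk : ∀ᵐ x ∂halfLine, ‖k x‖ₑ ≤ ‖f x‖ₑ) : IsImage 1 X X f k := by
  let T : L0 𝕜 → ℝ → 𝕜 := fun h x => k x / f x * h x
  have hbd : ∀ h v : L0 𝕜, v =ᵐ[halfLine] T h → ∀ᵐ x ∂halfLine, ‖v x‖ₑ ≤ ‖h x‖ₑ := by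
    intro h v hv
    filter_upwards [hv, hk] with x h1 h2
    rw [h1, ← ofReal_norm, ← ofReal_norm, norm_mul, norm_div]
    refine ENNReal.ofReal_le_ofReal (mul_le_of_le_one_left (norm_nonneg _) ?_)
    rw [← ofReal_norm, ← ofReal_norm, ENNReal.ofReal_le_ofReal_iff (norm_nonneg _)] at h2
    exact div_le_one_of_le₀ h2 (norm_nonneg _)
  refine isImage_of_fun T (fun h _ => ?_) (fun h _ v _ => ?_) (fun r h _ => ?_)
    (fun h v _ hv => ?_) (fun h v _ hv => ?_) hf ?_
  · exact ((k.stronglyMeasurable.measurable.div f.stronglyMeasurable.measurable).mul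
      h.stronglyMeasurable.measurable).aestronglyMeasurable
  · filter_upwards [AEEqFun.coeFn_add h v] with x hx
    simp only [T, hx, Pi.add_apply, mul_add]
  · filter_upwards [AEEqFun.coeFn_smul r h] with x hx
    simp only [T, hx, Pi.smul_apply, smul_eq_mul]
    ring
  · rw [ENNReal.coe_one, one_mul]
    exact (hX h v (hbd h v hv)).1
  · rw [ENNReal.coe_one, one_mul]
    exact (hX h v (hbd h v hv)).2
  · filter_upwards [hk] with x hx
    rcases eq_or_ne (f x) 0 with h0 | h0
    · rw [h0, enorm_zero, nonpos_iff_eq_zero, enorm_eq_zero] at hx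
      simp [T, hx]
    · simp only [T]
      rw [div_mul_cancel₀ _ h0]

/-- For any decomposition `a + b`, the integral of `|a|` over `(0, t)` is at most its `L¹` norm, and
that of `|b|` is at most `t` times its level norm. -/
theorem lintegral_le_K (y : L0 𝕜) {t : ℝ≥0} (ht : 0 < t) :
    ∫⁻ x in Ioo 0 (t : ℝ), ‖y x‖ₑ ≤ (coupleL1LevelLinfty 𝕜).K t y := by
  refine le_iInf₂ fun a b => le_iInf fun hab => ?_
  subst hab
  refine (lintegral_add_le_add a b t).trans (add_le_add ?_ ?_)
  · exact (setLIntegral_Ioo_le _ _).trans (nrm_L1 a).ge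
  · refine (lintegral_le_levelNorm b (by exact_mod_cast ht)).trans ?_
    rw [mul_comm, ENNReal.ofReal_coe_nnreal]
    exact le_rfl

theorem K_le_add (X : CompatibleCouple 𝕜 (L0 𝕜)) (t : ℝ≥0) {a b x : L0 𝕜} (h : a + b = x) :
    X.K t x ≤ X.X₀.nrm a + t * X.X₁.nrm b :=
  (iInf₂_le a b).trans (iInf_le _ h)

/-- The elements of `L⁰` that have a decreasing non-negative representative. -/
def IsDecreasing (w : L0 𝕜) : Prop :=
  ∃ p : ℝ → ℝ, Measurable p ∧ AntitoneOn p (Ioi 0) ∧ (∀ x, 0 ≤ p x) ∧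
    ∀ᵐ x ∂halfLine, w x = (p x : 𝕜)

/-- Cut `p` at the height `s = p t`: the part above `s` lives on `(0, t)`, and the part below has
norm at most `s`, so the cost is at most `∫₀ᵗ (p - s) + t s`. -/
theorem K_le_lintegral {w : L0 𝕜} (hw : IsDecreasing w) {t : ℝ≥0} (ht : 0 < t) :
    (coupleL1Linfty 𝕜).K t w ≤ ∫⁻ x in Ioo 0 (t : ℝ), ‖w x‖ₑ := by
  obtain ⟨p, hpm, hp, hp0, hwp⟩ := hw
  have ht' : (0 : ℝ) < t := by exact_mod_cast ht
  set s := p t with hs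
  have hm1 : AEStronglyMeasurable (fun x => ((max (p x - s) 0 : ℝ) : 𝕜)) halfLine :=
    (RCLike.measurable_ofReal.comp ((hpm.sub_const s).max measurable_const)).aestronglyMeasurable
  have hm2 : AEStronglyMeasurable (fun x => ((min (p x) s : ℝ) : 𝕜)) halfLine :=
    (RCLike.measurable_ofReal.comp (hpm.min measurable_const)).aestronglyMeasurable
  have hsum : (AEEqFun.mk _ hm1 + AEEqFun.mk _ hm2 : L0 𝕜) = w := by
    refine AEEqFun.ext ?_
    filter_upwards [AEEqFun.coeFn_add (AEEqFun.mk _ hm1) (AEEqFun.mk _ hm2),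
      AEEqFun.coeFn_mk _ hm1, AEEqFun.coeFn_mk _ hm2, hwp] with x h1 h2 h3 h4
    rw [h1, Pi.add_apply, h2, h3, h4, ← RCLike.ofReal_add]
    congr 1
    rcases le_total (p x) s with h | h
    · rw [max_eq_right (by linarith), min_eq_left h, zero_add]
    · rw [max_eq_left (by linarith), min_eq_right h]; ring
  refine (K_le_add _ t hsum).trans ?_
  have hn1 : (coupleL1Linfty 𝕜).X₀.nrm (AEEqFun.mk _ hm1) =
      ∫⁻ x in Ioo 0 (t : ℝ), ENNReal.ofReal (p x - s) := by
    rw [show (coupleL1Linfty 𝕜).X₀ = lebesgue 𝕜 1 le_rfl from rfl, nrm_L1]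
    have h1 : ∫⁻ x in Ioi 0, ‖(AEEqFun.mk _ hm1 : L0 𝕜) x‖ₑ =
        ∫⁻ x in Ioi 0, (Ioo 0 (t : ℝ)).indicator (fun x => ENNReal.ofReal (p x - s)) x := by
      refine lintegral_congr_ae ?_
      filter_upwards [AEEqFun.coeFn_mk _ hm1, ae_restrict_mem measurableSet_Ioi] with x hx hx0
      rw [hx, ← ofReal_norm, RCLike.norm_ofReal, abs_of_nonneg (le_max_right _ _)]
      by_cases hxt : x ∈ Ioo 0 (t : ℝ)
      · rw [indicator_of_mem hxt, max_eq_left]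
        exact sub_nonneg.2 (hp hx0 ht' hxt.2.le)
      · rw [indicator_of_notMem hxt, max_eq_right, ENNReal.ofReal_zero]
        have : (t : ℝ) ≤ x := by
          by_contra! h
          exact hxt ⟨hx0, h⟩
        exact sub_nonpos.2 (hp ht' hx0 this)
    rw [h1, lintegral_indicator measurableSet_Ioo,
      Measure.restrict_restrict measurableSet_Ioo, inter_eq_left.2 Ioo_subset_Ioi_self]
  have hn2 : (coupleL1Linfty 𝕜).X₁.nrm (AEEqFun.mk _ hm2) ≤ ENNReal.ofReal s := by
    refine (nrm_Linfty_le_iff _ _).2 ?_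
    filter_upwards [AEEqFun.coeFn_mk _ hm2] with x hx
    rw [hx, ← ofReal_norm, RCLike.norm_ofReal, abs_of_nonneg (le_min (hp0 x) (hp0 t))]
    exact ENNReal.ofReal_le_ofReal (min_le_right _ _)
  rw [hn1]
  calc (∫⁻ x in Ioo 0 (t : ℝ), ENNReal.ofReal (p x - s)) +
        t * (coupleL1Linfty 𝕜).X₁.nrm (AEEqFun.mk _ hm2)
      ≤ (∫⁻ x in Ioo 0 (t : ℝ), ENNReal.ofReal (p x - s)) +
        ∫⁻ x in Ioo 0 (t : ℝ), ENNReal.ofReal s := by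
        gcongr
        simp only [lintegral_const, MeasurableSet.univ, Measure.restrict_apply, univ_inter,
          Real.volume_Ioo, sub_zero, ENNReal.ofReal_coe_nnreal]
        rw [mul_comm]
        gcongr
    _ = ∫⁻ x in Ioo 0 (t : ℝ), ‖w x‖ₑ := by
        rw [← lintegral_add_right _ measurable_const]
        refine lintegral_congr_ae ?_
        filter_upwards [ae_Ioo hwp t, ae_restrict_mem measurableSet_Ioo] with x hx hxt
        have h1 : s ≤ p x := hp hxt.1 ht' hxt.2.le
        rw [hx, ← ofReal_norm, RCLike.norm_ofReal, abs_of_nonneg (hp0 x),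
          ← ENNReal.ofReal_add (by linarith) (hp0 t)]
        congr 1
        ring

end FunctionSpaces

/-! ### The primitive of the modulus -/

section Primitives

open CompatibleCouple

variable {𝕜 : Type*} [RCLike 𝕜]

theorem Ioi_eq_iUnion_Ioo : Ioi (0 : ℝ) = ⋃ n : ℕ, Ioo (0 : ℝ) (n + 1) := by
  ext x
  simp only [mem_Ioi, mem_iUnion, mem_Ioo]
  refine ⟨fun hx => ?_, fun ⟨n, hn⟩ => hn.1⟩
  obtain ⟨n, hn⟩ := exists_nat_gt x
  exact ⟨n, hx, by linarith⟩

theorem lintegral_Ioi_le {u : ℝ → ℝ≥0∞} {C : ℝ≥0∞}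
    (h : ∀ t : ℝ, 0 < t → ∫⁻ x in Ioo 0 t, u x ≤ C) : ∫⁻ x in Ioi 0, u x ≤ C := by
  rw [Ioi_eq_iUnion_Ioo, setLIntegral_iUnion_of_directed]
  · exact iSup_le fun n => h _ (by positivity)
  · refine (Monotone.directed_le fun m n hmn => Ioo_subset_Ioo_right ?_)
    have : (m : ℝ) ≤ n := by exact_mod_cast hmn
    linarith

/-- `x ↦ ∫₀ˣ |h|`, with real values. -/
noncomputable def realPrimitive (h : L0 𝕜) (t : ℝ) : ℝ := ∫ x in Ioo 0 t, ‖h x‖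

variable {h : L0 𝕜}

theorem ofReal_realPrimitive (hh : h ∈ (coupleL1LevelLinfty 𝕜).sum) (t : ℝ) :
    ENNReal.ofReal (realPrimitive h t) = ∫⁻ x in Ioo 0 t, ‖h x‖ₑ :=
  ofReal_integral_norm_eq_lintegral_enorm (integrableOn_Ioo hh t)

theorem realPrimitive_nonneg (h : L0 𝕜) (t : ℝ) : 0 ≤ realPrimitive h t :=
  integral_nonneg fun _ => norm_nonneg _

theorem realPrimitive_of_nonpos (h : L0 𝕜) {t : ℝ} (ht : t ≤ 0) : realPrimitive h t = 0 := by
  simp [realPrimitive, Ioo_eq_empty (not_lt.2 ht)]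

theorem monotone_realPrimitive (hh : h ∈ (coupleL1LevelLinfty 𝕜).sum) :
    Monotone (realPrimitive h) := fun _ t hst =>
  setIntegral_mono_set (integrableOn_Ioo hh t).norm (ae_of_all _ fun _ => norm_nonneg _)
    (Ioo_subset_Ioo_right hst).eventuallyLE

theorem intervalIntegrable_indicator (hh : h ∈ (coupleL1LevelLinfty 𝕜).sum) (a b : ℝ) :
    IntervalIntegrable ((Ioi 0).indicator fun x => ‖h x‖) volume a b := by
  rw [intervalIntegrable_iff, integrableOn_indicator_iff measurableSet_Ioi]
  refine IntegrableOn.mono_set (integrableOn_Ioo hh (max a b + 1)).norm fun x hx => ?_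
  exact ⟨hx.1, hx.2.2.trans_lt (lt_add_one _)⟩

/-- Extending `|h|` by zero to the left of the origin makes the formula valid for every real `t`, so
that results on interval integrals give continuity and almost everywhere differentiability. -/
theorem realPrimitive_eq_intervalIntegral (h : L0 𝕜) (t : ℝ) :
    realPrimitive h t = ∫ x in (0 : ℝ)..t, (Ioi 0).indicator (fun x => ‖h x‖) x := by
  rcases le_total t 0 with ht | ht
  · rw [realPrimitive_of_nonpos h ht, intervalIntegral.integral_of_ge ht,
      setIntegral_eq_zero_of_forall_eq_zero, neg_zero]
    exact fun x hx => indicator_of_notMem (not_lt.2 hx.2) _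
  · rw [realPrimitive, intervalIntegral.integral_of_le ht, integral_Ioc_eq_integral_Ioo]
    refine setIntegral_congr_fun measurableSet_Ioo fun x hx => ?_
    exact (indicator_of_mem (show x ∈ Ioi (0 : ℝ) from hx.1) fun x => ‖h x‖).symm

theorem continuous_realPrimitive (hh : h ∈ (coupleL1LevelLinfty 𝕜).sum) :
    Continuous (realPrimitive h) := by
  have := intervalIntegral.continuous_primitive (intervalIntegrable_indicator hh) 0
  exact this.congr fun t => (realPrimitive_eq_intervalIntegral h t).symm

end Primitives

/-! ### Monotone transport of mass to the right -/

section Transport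

open CompatibleCouple

variable {𝕜 : Type*} [RCLike 𝕜]

/-- The increasing map which transports the measure `|y(z)| dz` to `|f(x)| dx`. -/
noncomputable def transportMap (f y : L0 𝕜) (z : ℝ) : ℝ :=
  sInf {x | 0 ≤ x ∧ realPrimitive y z ≤ realPrimitive f x}

variable {f y : L0 𝕜}

theorem transportMap_nonneg (f y : L0 𝕜) (z : ℝ) : 0 ≤ transportMap f y z :=
  Real.sInf_nonneg fun _ hx => hx.1

theorem transportMap_set_nonempty (hfy : ∀ t, 0 < t → realPrimitive y t ≤ realPrimitive f t)
    (z : ℝ) :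
    {x | 0 ≤ x ∧ realPrimitive y z ≤ realPrimitive f x}.Nonempty := by
  rcases le_or_gt z 0 with hz | hz
  · exact ⟨0, le_rfl, by rw [realPrimitive_of_nonpos y hz]; exact realPrimitive_nonneg f 0⟩
  · exact ⟨z, hz.le, hfy z hz⟩

/-- The infimum is attained because the primitive of `|f|` is continuous. This Galois connection
carries the monotonicity of the map, the bound by the identity and the computation of the
pushforward. -/
theorem transportMap_le_iff (hf : f ∈ (coupleL1LevelLinfty 𝕜).sum)
    (hfy : ∀ t, 0 < t → realPrimitive y t ≤ realPrimitive f t)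
    {z r : ℝ} (hr : 0 ≤ r) :
    transportMap f y z ≤ r ↔ realPrimitive y z ≤ realPrimitive f r := by
  refine ⟨fun h => ?_, fun h => csInf_le ⟨0, fun x hx => hx.1⟩ ⟨hr, h⟩⟩
  have hcl : IsClosed {x | 0 ≤ x ∧ realPrimitive y z ≤ realPrimitive f x} :=
    (isClosed_le continuous_const continuous_id).inter
      (isClosed_le continuous_const (continuous_realPrimitive hf))
  have hmem := hcl.csInf_mem (transportMap_set_nonempty hfy z) ⟨0, fun x hx => hx.1⟩
  exact hmem.2.trans (monotone_realPrimitive hf h)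

theorem monotone_transportMap (hf : f ∈ (coupleL1LevelLinfty 𝕜).sum)
    (hy : y ∈ (coupleL1LevelLinfty 𝕜).sum)
    (hfy : ∀ t, 0 < t → realPrimitive y t ≤ realPrimitive f t)
    : Monotone (transportMap f y) := fun _ b hab =>
  (transportMap_le_iff hf hfy (transportMap_nonneg f y b)).2
    ((monotone_realPrimitive hy hab).trans
      ((transportMap_le_iff hf hfy (transportMap_nonneg f y b)).1 le_rfl))

theorem transportMap_le_self (hf : f ∈ (coupleL1LevelLinfty 𝕜).sum)
    (hfy : ∀ t, 0 < t → realPrimitive y t ≤ realPrimitive f t)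
    {z : ℝ} (hz : 0 < z) : transportMap f y z ≤ z :=
  (transportMap_le_iff hf hfy hz.le).2 (hfy z hz)

/-- The mass of `|y|` on a sublevel set of its own primitive. -/
theorem lintegral_sublevel (hy : y ∈ (coupleL1LevelLinfty 𝕜).sum)
    {t s : ℝ} (ht : 0 < t) (hs : 0 ≤ s) :
    ∫⁻ z in Ioo 0 t ∩ {z | realPrimitive y z ≤ s}, ‖y z‖ₑ =
      ENNReal.ofReal (min (realPrimitive y t) s) := by
  have hmono := monotone_realPrimitive hy
  have hcont := continuous_realPrimitive hy
  rcases le_or_gt (realPrimitive y t) s with h | h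
  · rw [min_eq_left h, ofReal_realPrimitive hy, inter_eq_left.2]
    exact fun z hz => (hmono hz.2.le).trans h
  · rw [min_eq_right h.le]
    -- The sublevel set is an interval up to its largest point `r`; the intermediate value theorem
    -- shows that the primitive equals `s` at `r`.
    set A := Icc 0 t ∩ {z | realPrimitive y z ≤ s} with hA
    have hAc : IsClosed A := isClosed_Icc.inter (isClosed_le hcont continuous_const)
    have hA0 : A.Nonempty := ⟨0, ⟨le_rfl, ht.le⟩, by
      simpa [realPrimitive_of_nonpos y le_rfl] using hs⟩
    have hAb : BddAbove A := ⟨t, fun z hz => hz.1.2⟩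
    set r := sSup A with hr
    have hrA : r ∈ A := hAc.csSup_mem hA0 hAb
    have hrt : r < t := lt_of_le_of_ne hrA.1.2 (by
      intro h'
      exact absurd hrA.2 (by rw [h']; exact not_le.2 h))
    have hrs : realPrimitive y r = s := by
      refine le_antisymm hrA.2 (le_of_not_gt fun hlt => ?_)
      obtain ⟨q, hq, hqs⟩ := intermediate_value_Icc hrt.le hcont.continuousOn ⟨hlt.le, h.le⟩
      have hqA : q ∈ A := ⟨⟨hrA.1.1.trans hq.1, hq.2⟩, hqs.le⟩
      have hqr : q ≤ r := le_csSup hAb hqA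
      have : q = r := le_antisymm hqr hq.1
      rw [this] at hqs
      exact hlt.ne hqs
    have hset : Ioo 0 t ∩ {z | realPrimitive y z ≤ s} = Ioc 0 r := by
      ext z
      constructor
      · rintro ⟨hz, hzs⟩
        exact ⟨hz.1, le_csSup hAb ⟨⟨hz.1.le, hz.2.le⟩, hzs⟩⟩
      · rintro ⟨hz0, hzr⟩
        exact ⟨⟨hz0, hzr.trans_lt hrt⟩, (hmono hzr).trans hrA.2⟩
    rw [hset, setLIntegral_congr Ioo_ae_eq_Ioc.symm, ← ofReal_realPrimitive hy, hrs]

/-- Finite measures on the line are determined by the sets `Iic r`. With `F` and `Y` the primitives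
of `|f|` and `|y|` and `q` the image of `t`, one has `F q = Y t`, and both sides give `Iic r` the
mass `min (F q) (F r) = F (min q r)` when `r ≥ 0`. -/
theorem map_transportMap (hf : f ∈ (coupleL1LevelLinfty 𝕜).sum)
    (hy : y ∈ (coupleL1LevelLinfty 𝕜).sum)
    (hfy : ∀ t, 0 < t → realPrimitive y t ≤ realPrimitive f t)
    {t : ℝ} (ht : 0 < t) :
    Measure.map (transportMap f y) ((volume.restrict (Ioo 0 t)).withDensity fun z => ‖y z‖ₑ) =
      (volume.restrict (Ioo 0 (transportMap f y t))).withDensity fun x => ‖f x‖ₑ := by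
  have hm : Measurable (transportMap f y) := (monotone_transportMap hf hy hfy).measurable
  have hfin : IsFiniteMeasure ((volume.restrict (Ioo 0 t)).withDensity fun z => ‖y z‖ₑ) :=
    isFiniteMeasure_withDensity (lintegral_Ioo_lt_top hy t).ne
  refine Measure.ext_of_Iic _ _ fun r => ?_
  rw [Measure.map_apply hm measurableSet_Iic, withDensity_apply _ (hm measurableSet_Iic),
    withDensity_apply _ measurableSet_Iic, Measure.restrict_restrict (hm measurableSet_Iic),
    Measure.restrict_restrict measurableSet_Iic]
  set q := transportMap f y t with hq
  have hq0 : 0 ≤ q := transportMap_nonneg f y t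
  have hqt : realPrimitive f q = realPrimitive y t := by
    refine le_antisymm ?_ ((transportMap_le_iff hf hfy hq0).1 le_rfl)
    rcases hq0.eq_or_lt with h0 | h0
    · rw [← h0, realPrimitive_of_nonpos f le_rfl]; exact realPrimitive_nonneg y t
    -- To the left of `q` the primitive of `|f|` is still below its target; pass to the limit at
    -- `q`.
    · refine le_of_tendsto ((continuous_realPrimitive hf).continuousAt.tendsto.mono_left
        (nhdsWithin_le_nhds (s := Iio q))) ?_
      filter_upwards [Ioo_mem_nhdsLT h0] with r hr
      exact (not_le.1 fun h => absurd ((transportMap_le_iff hf hfy hr.1.le).2 h)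
        (not_le.2 hr.2)).le
  rcases lt_or_ge r 0 with hr | hr
  · have h1 : transportMap f y ⁻¹' Iic r ∩ Ioo 0 t = ∅ := by
      ext z
      simp only [mem_inter_iff, mem_preimage, mem_Iic, mem_empty_iff_false, iff_false, not_and]
      exact fun h => absurd (h.trans_lt hr) (not_lt.2 (transportMap_nonneg f y z))
    have h2 : Iic r ∩ Ioo 0 q = ∅ := by
      ext z
      simp only [mem_inter_iff, mem_Iic, mem_Ioo, mem_empty_iff_false, iff_false, not_and]
      intro h h'
      linarith
    rw [h1, h2]
    simp
  · have h1 : transportMap f y ⁻¹' Iic r ∩ Ioo 0 t =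
        Ioo 0 t ∩ {z | realPrimitive y z ≤ realPrimitive f r} := by
      rw [inter_comm]
      congr 1
      ext z
      exact transportMap_le_iff hf hfy hr
    rw [h1, lintegral_sublevel hy ht (realPrimitive_nonneg f r), ← hqt,
      ← (monotone_realPrimitive hf).map_min, ofReal_realPrimitive hf]
    refine setLIntegral_congr ?_
    rcases le_or_gt q r with h | h
    · have : Ioo 0 q ⊆ Iic r := fun z hz => hz.2.le.trans h
      rw [min_eq_left h, inter_eq_right.2 this]
      exact EventuallyEq.rfl
    · rw [min_eq_right h.le]
      have : Iic r ∩ Ioo 0 q = Ioc 0 r := by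
        ext z
        simp only [mem_inter_iff, mem_Iic, mem_Ioo, mem_Ioc]
        constructor
        · rintro ⟨h1, h2, h3⟩; exact ⟨h2, h1⟩
        · rintro ⟨h1, h2⟩; exact ⟨h2, h1, h2.trans_lt h⟩
      rw [this]
      exact Ioo_ae_eq_Ioc

theorem lintegral_transport_le (hf : f ∈ (coupleL1LevelLinfty 𝕜).sum)
    (hy : y ∈ (coupleL1LevelLinfty 𝕜).sum)
    (hfy : ∀ t, 0 < t → realPrimitive y t ≤ realPrimitive f t)
    {φ : ℝ → ℝ≥0∞} (hφ : Measurable φ) {t : ℝ} (ht : 0 < t) :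
    ∫⁻ z in Ioo 0 t, ‖y z‖ₑ * φ (transportMap f y z) ≤ ∫⁻ x in Ioo 0 t, ‖f x‖ₑ * φ x := by
  have hm : Measurable (transportMap f y) := (monotone_transportMap hf hy hfy).measurable
  have hym : Measurable fun z => ‖y z‖ₑ := y.stronglyMeasurable.measurable.enorm
  have hfm : Measurable fun z => ‖f z‖ₑ := f.stronglyMeasurable.measurable.enorm
  calc ∫⁻ z in Ioo 0 t, ‖y z‖ₑ * φ (transportMap f y z)
      = ∫⁻ x in Ioo 0 (transportMap f y t), ‖f x‖ₑ * φ x := by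
        have h := lintegral_withDensity_eq_lintegral_mul (volume.restrict (Ioo 0 t)) hym
          (hφ.comp hm)
        have h' := lintegral_withDensity_eq_lintegral_mul
          (volume.restrict (Ioo 0 (transportMap f y t))) hfm hφ
        rw [← map_transportMap hf hy hfy ht, lintegral_map hφ hm] at h'
        exact h.symm.trans h'
    _ ≤ _ := lintegral_mono_set (Ioo_subset_Ioo_right (transportMap_le_self hf hfy ht))

/-- The transport map may be constant on intervals, so preimages of null sets need not be null. They
carry no mass of `|y|`, however, which is enough for an operator with the factor `y` to be well
defined on classes of functions. -/
theorem ae_transport (hf : f ∈ (coupleL1LevelLinfty 𝕜).sum)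
    (hy : y ∈ (coupleL1LevelLinfty 𝕜).sum)
    (hfy : ∀ t, 0 < t → realPrimitive y t ≤ realPrimitive f t)
    {N : Set ℝ} (hN : MeasurableSet N)
    (h : ∀ᵐ x ∂halfLine, x ∈ N → f x = 0) :
    ∀ᵐ z ∂halfLine, transportMap f y z ∈ N → y z = 0 := by
  have hm : Measurable (transportMap f y) := (monotone_transportMap hf hy hfy).measurable
  have hym : Measurable fun z => ‖y z‖ₑ := y.stronglyMeasurable.measurable.enorm
  refine ae_halfLine fun n => ?_
  have h1 := lintegral_transport_le hf hy hfy (φ := N.indicator 1) (measurable_one.indicator hN)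
    (t := n + 1) (by positivity)
  have h2 : ∫⁻ x in Ioo (0 : ℝ) (n + 1), ‖f x‖ₑ * N.indicator 1 x = 0 := by
    rw [← lintegral_zero (μ := volume.restrict (Ioo (0 : ℝ) (n + 1)))]
    refine lintegral_congr_ae ?_
    filter_upwards [ae_Ioo h (n + 1)] with x hx
    by_cases hxN : x ∈ N
    · simp [hx hxN]
    · simp [hxN]
  rw [h2, nonpos_iff_eq_zero] at h1
  filter_upwards [(lintegral_eq_zero_iff
    (hym.mul ((measurable_one.indicator hN).comp hm))).1 h1] with z hz hzN
  simpa [hzN] using hz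

theorem ae_transport_of_ae (hf : f ∈ (coupleL1LevelLinfty 𝕜).sum)
    (hy : y ∈ (coupleL1LevelLinfty 𝕜).sum)
    (hfy : ∀ t, 0 < t → realPrimitive y t ≤ realPrimitive f t)
    {P : ℝ → Prop} (h : ∀ᵐ x ∂halfLine, P x) :
    ∀ᵐ z ∂halfLine, P (transportMap f y z) ∨ y z = 0 := by
  obtain ⟨N, hPN, hNm, hN0⟩ := exists_measurable_superset_of_null (ae_iff.1 h)
  have h1 : ∀ᵐ x ∂halfLine, x ∈ N → f x = 0 := by
    filter_upwards [measure_eq_zero_iff_ae_notMem.1 hN0] with x hx hx'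
    exact absurd hx' hx
  filter_upwards [ae_transport hf hy hfy hNm h1] with z hz
  by_cases hz' : transportMap f y z ∈ N
  · exact Or.inr (hz hz')
  · exact Or.inl (by_contra fun hc => hz' (hPN hc))

/-- If `∫₀ᵗ |y| ≤ ∫₀ᵗ |f|` for all `t`, then mass can be moved to the right so as to turn `f`
into `y`. -/
theorem isImage_of_lintegral_le (hf : f ∈ (coupleL1LevelLinfty 𝕜).sum)
    (hy : y ∈ (coupleL1LevelLinfty 𝕜).sum)
    (hfy : ∀ t : ℝ≥0, 0 < t → ∫⁻ x in Ioo 0 (t : ℝ), ‖y x‖ₑ ≤ ∫⁻ x in Ioo 0 (t : ℝ), ‖f x‖ₑ) :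
    IsImage 1 (coupleL1LevelLinfty 𝕜) (coupleL1LevelLinfty 𝕜) f y := by
  replace hfy : ∀ t, 0 < t → realPrimitive y t ≤ realPrimitive f t := fun t ht => by
    have := hfy ⟨t, ht.le⟩ ht
    change ∫⁻ x in Ioo 0 t, ‖y x‖ₑ ≤ ∫⁻ x in Ioo 0 t, ‖f x‖ₑ at this
    rwa [← ofReal_realPrimitive hy, ← ofReal_realPrimitive hf,
      ENNReal.ofReal_le_ofReal_iff (realPrimitive_nonneg _ _)] at this
  have hm : Measurable (transportMap f y) := (monotone_transportMap hf hy hfy).measurable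
  -- Relative to `f`, the density `h / f` is carried along by the transport and multiplied by `y`.
  -- Formally `T f = y`; where `f` vanishes at the transported point, division by zero gives `0`,
  -- and `y` is zero there almost everywhere.
  let T : L0 𝕜 → ℝ → 𝕜 := fun h z => y z * (h (transportMap f y z) / f (transportMap f y z))
  have hbd : ∀ h k : L0 𝕜, k =ᵐ[halfLine] T h → ∀ t : ℝ, 0 < t →
      ∫⁻ x in Ioo 0 t, ‖k x‖ₑ ≤ ∫⁻ x in Ioo 0 t, ‖h x‖ₑ := by
    intro h k hk t ht
    calc ∫⁻ x in Ioo 0 t, ‖k x‖ₑ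
        = ∫⁻ x in Ioo 0 t, ‖y x‖ₑ *
          (fun z => ‖h z / f z‖ₑ) (transportMap f y x) := by
          refine lintegral_congr_ae ?_
          filter_upwards [ae_Ioo hk t] with x hx
          rw [hx, enorm_mul]
      _ ≤ ∫⁻ x in Ioo 0 t, ‖f x‖ₑ * ‖h x / f x‖ₑ :=
          lintegral_transport_le hf hy hfy
            (h.stronglyMeasurable.measurable.div f.stronglyMeasurable.measurable).enorm ht
      _ ≤ ∫⁻ x in Ioo 0 t, ‖h x‖ₑ := by
          refine lintegral_mono fun x => ?_
          rw [← enorm_mul]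
          rcases eq_or_ne (f x) 0 with h0 | h0
          · simp [h0]
          · rw [mul_div_cancel₀ _ h0]
  refine isImage_of_fun T (fun h _ => ?_) (fun h _ k _ => ?_) (fun r h _ => ?_)
    (fun h k hh hk => ?_) (fun h k hh hk => ?_) hf ?_
  · exact (y.stronglyMeasurable.measurable.mul ((h.stronglyMeasurable.measurable.comp hm).div
      (f.stronglyMeasurable.measurable.comp hm))).aestronglyMeasurable
  · filter_upwards [ae_transport_of_ae hf hy hfy (AEEqFun.coeFn_add h k)] with z hz
    rcases hz with hz | hz
    · simp only [T, hz, Pi.add_apply]; ring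
    · simp [T, hz]
  · filter_upwards [ae_transport_of_ae hf hy hfy (AEEqFun.coeFn_smul r h)] with z hz
    rcases hz with hz | hz
    · simp only [T, hz, Pi.smul_apply, smul_eq_mul]; ring
    · simp [T, hz]
  · rw [ENNReal.coe_one, one_mul]
    refine (nrm_L1 k).trans_le (lintegral_Ioi_le fun t ht => (hbd h k hk t ht).trans ?_)
    exact (setLIntegral_Ioo_le _ _).trans (nrm_L1 h).ge
  · rw [ENNReal.coe_one, one_mul]
    exact (levelNorm_le_iff k _).2 fun t ht =>
      (hbd h k hk t ht).trans (lintegral_le_levelNorm h ht)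
  · have hz0 : MeasurableSet {x | f x = 0} :=
      f.stronglyMeasurable.measurable (measurableSet_singleton 0)
    filter_upwards [ae_transport hf hy hfy hz0 (ae_of_all _ fun x hx => hx)] with z hz
    by_cases h0 : f (transportMap f y z) = 0
    · simp [T, hz h0]
    · simp [T, div_self h0]

end Transport

/-! ### Generalized limits of averages -/

section GeneralizedLimits

open CompatibleCouple

variable {𝕜 : Type*} [RCLike 𝕜]

/-- A generalized limit, along an ultrafilter, of the averages of `h` over the sets `B n`. -/
noncomputable def limAverage (B : ℕ → Set ℝ) (h : L0 𝕜) : 𝕜 :=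
  limUnder (hyperfilter ℕ : Filter ℕ) fun n => ⨍ x in B n, h x

/-- The averages of `|h|` over the sets `B n` exist and are bounded. -/
def HasBoundedAverages (B : ℕ → Set ℝ) (h : L0 𝕜) : Prop :=
  (∀ n, IntegrableOn h (B n)) ∧ ∃ C : ℝ, ∀ n, ⨍ x in B n, ‖h x‖ ≤ C

theorem norm_setAverage_le (f : ℝ → 𝕜) (s : Set ℝ) : ‖⨍ x in s, f x‖ ≤ ⨍ x in s, ‖f x‖ := by
  rw [setAverage_eq, setAverage_eq, norm_smul, norm_inv, Real.norm_of_nonneg measureReal_nonneg,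
    smul_eq_mul]
  gcongr
  exact norm_integral_le_integral_norm _

/-- The averages stay in a closed ball, which is compact, so they converge along an ultrafilter.
Thus `limAverage` is a genuine limit, and linearity and bounds pass to it. -/
theorem tendsto_limAverage {B : ℕ → Set ℝ} {h : L0 𝕜} (hh : HasBoundedAverages B h) :
    Tendsto (fun n => ⨍ x in B n, h x) (hyperfilter ℕ) (𝓝 (limAverage B h)) := by
  obtain ⟨C, hC⟩ := hh.2
  refine tendsto_nhds_limUnder ?_
  obtain ⟨l, -, hl⟩ := (isCompact_closedBall (0 : 𝕜) C).ultrafilter_le_nhds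
    ((hyperfilter ℕ).map fun n => ⨍ x in B n, h x) (by
      rw [Ultrafilter.coe_map]
      refine tendsto_principal.2 (Eventually.of_forall fun n => ?_)
      rw [mem_closedBall_zero_iff]
      exact (norm_setAverage_le _ _).trans (hC n))
  exact ⟨l, hl⟩

theorem limAverage_eq {B : ℕ → Set ℝ} {h : L0 𝕜} {l : 𝕜}
    (hl : Tendsto (fun n => ⨍ x in B n, h x) atTop (𝓝 l)) : limAverage B h = l :=
  (hl.mono_left Nat.hyperfilter_le_atTop).limUnder_eq

theorem ae_restrict_of_subset_Ioi {B : Set ℝ} (hB : B ⊆ Ioi 0) {P : ℝ → Prop}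
    (h : ∀ᵐ x ∂halfLine, P x) : ∀ᵐ x ∂volume.restrict B, P x :=
  ae_mono (Measure.restrict_mono hB le_rfl) h

theorem HasBoundedAverages.add {B : ℕ → Set ℝ} (hB : ∀ n, B n ⊆ Ioi 0) {h k : L0 𝕜}
    (hh : HasBoundedAverages B h) (hk : HasBoundedAverages B k) :
    HasBoundedAverages B (h + k) := by
  obtain ⟨C, hC⟩ := hh.2
  obtain ⟨D, hD⟩ := hk.2
  have hae : ∀ n, (h + k : L0 𝕜) =ᵐ[volume.restrict (B n)] (⇑h + ⇑k) := fun n =>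
    ae_restrict_of_subset_Ioi (hB n) (AEEqFun.coeFn_add h k)
  have hinteg : ∀ n, IntegrableOn (⇑(h + k : L0 𝕜)) (B n) := fun n =>
    ((hh.1 n).add (hk.1 n)).congr (hae n).symm
  refine ⟨hinteg, C + D, fun n => ?_⟩
  refine le_trans ?_ (add_le_add (hC n) (hD n))
  simp only [setAverage_eq, smul_eq_mul]
  rw [← mul_add, ← integral_add (hh.1 n).norm (hk.1 n).norm]
  refine mul_le_mul_of_nonneg_left ?_ (inv_nonneg.2 measureReal_nonneg)
  refine integral_mono_ae (hinteg n).norm ((hh.1 n).norm.add (hk.1 n).norm) ?_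
  filter_upwards [hae n] with x hx
  simp only [hx, Pi.add_apply]
  exact norm_add_le _ _

theorem limAverage_add {B : ℕ → Set ℝ} (hB : ∀ n, B n ⊆ Ioi 0) {h k : L0 𝕜}
    (hh : HasBoundedAverages B h) (hk : HasBoundedAverages B k) :
    limAverage B (h + k) = limAverage B h + limAverage B k := by
  refine tendsto_nhds_unique (tendsto_limAverage (hh.add hB hk)) ?_
  refine ((tendsto_limAverage hh).add (tendsto_limAverage hk)).congr fun n => ?_
  simp only [setAverage_eq]
  rw [← smul_add, ← integral_add (hh.1 n) (hk.1 n)]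
  congr 1
  refine integral_congr_ae ?_
  filter_upwards [ae_restrict_of_subset_Ioi (hB n) (AEEqFun.coeFn_add h k)] with x hx
  rw [hx, Pi.add_apply]

theorem limAverage_smul {B : ℕ → Set ℝ} (hB : ∀ n, B n ⊆ Ioi 0) (r : 𝕜) {h : L0 𝕜}
    (hh : HasBoundedAverages B h) : limAverage B (r • h) = r * limAverage B h := by
  refine ((((tendsto_limAverage hh).const_mul r).congr fun n => ?_).limUnder_eq)
  simp only [setAverage_eq]
  rw [← smul_eq_mul, smul_comm, ← integral_smul]
  congr 1
  refine integral_congr_ae ?_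
  filter_upwards [ae_restrict_of_subset_Ioi (hB n) (AEEqFun.coeFn_smul r h)] with x hx
  rw [hx, Pi.smul_apply]

theorem norm_limAverage_le {B : ℕ → Set ℝ} {h : L0 𝕜} (hh : HasBoundedAverages B h)
    {u : ℕ → ℝ} {M : ℝ} (hu : ∀ n, ⨍ x in B n, ‖h x‖ ≤ u n) (hM : Tendsto u atTop (𝓝 M)) :
    ‖limAverage B h‖ ≤ M :=
  le_of_tendsto_of_tendsto (tendsto_limAverage hh).norm (hM.mono_left Nat.hyperfilter_le_atTop)
    (Eventually.of_forall fun n => (norm_setAverage_le _ _).trans (hu n))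

theorem setAverage_norm_le_of_L1 {B : Set ℝ} (hB : B ⊆ Ioi 0) {h : L0 𝕜}
    (hh : IntegrableOn h (Ioi 0)) :
    ⨍ x in B, ‖h x‖ ≤ (volume.real B)⁻¹ * ∫ x in Ioi 0, ‖h x‖ := by
  rw [setAverage_eq, smul_eq_mul]
  refine mul_le_mul_of_nonneg_left ?_ (inv_nonneg.2 measureReal_nonneg)
  exact setIntegral_mono_set hh.norm (ae_of_all _ fun _ => norm_nonneg _) hB.eventuallyLE

theorem integrableOn_Ioi_of_nrm {h : L0 𝕜} (hh : (lebesgue 𝕜 1 le_rfl).nrm h < ∞) :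
    IntegrableOn h (Ioi 0) :=
  ⟨h.aestronglyMeasurable, by rw [nrm_L1] at hh; exact hh⟩

theorem hasBoundedAverages_of_L1 {B : ℕ → Set ℝ} (hB : ∀ n, B n ⊆ Ioi 0)
    (hvol : ∀ n, 1 ≤ volume.real (B n)) {h : L0 𝕜}
    (hh : (lebesgue 𝕜 1 le_rfl).nrm h < ∞) : HasBoundedAverages B h := by
  have hinteg := integrableOn_Ioi_of_nrm hh
  refine ⟨fun n => hinteg.mono_set (hB n), ∫ x in Ioi 0, ‖h x‖, fun n => ?_⟩
  refine (setAverage_norm_le_of_L1 (hB n) hinteg).trans ?_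
  have h0 : 0 ≤ ∫ x in Ioi 0, ‖h x‖ := integral_nonneg fun _ => norm_nonneg _
  exact mul_le_of_le_one_left h0 (inv_le_one_of_one_le₀ (hvol n))

/-- The integrals of `|h|` stay bounded while the volumes of the sets tend to infinity. An operator
may therefore use such a functional at no cost in `L¹`. -/
theorem limAverage_of_L1 {B : ℕ → Set ℝ} (hB : ∀ n, B n ⊆ Ioi 0)
    (hvol : ∀ n, 1 ≤ volume.real (B n)) (hvol' : Tendsto (fun n => volume.real (B n)) atTop atTop)
    {h : L0 𝕜} (hh : (lebesgue 𝕜 1 le_rfl).nrm h < ∞) : limAverage B h = 0 := by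
  have hinteg := integrableOn_Ioi_of_nrm hh
  have h1 := norm_limAverage_le (hasBoundedAverages_of_L1 hB hvol hh)
    (fun n => setAverage_norm_le_of_L1 (hB n) hinteg)
    ((tendsto_inv_atTop_zero.comp hvol').mul_const _)
  rw [zero_mul] at h1
  exact norm_le_zero_iff.1 h1

end GeneralizedLimits

/-! ### Integral operators over moving intervals -/

section IntervalMeans

variable {𝕜 : Type*} [RCLike 𝕜]

theorem measurableSet_between {α β : ℝ → ℝ} (hα : Measurable α) (hβ : Measurable β) :
    MeasurableSet {q : ℝ × ℝ | α q.1 < q.2 ∧ q.2 < β q.1} :=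
  (measurableSet_lt (hα.comp measurable_fst) measurable_snd).inter
    (measurableSet_lt measurable_snd (hβ.comp measurable_fst))

theorem stronglyMeasurable_integral_Ioo {α β : ℝ → ℝ} (hα : Measurable α) (hβ : Measurable β)
    {h : ℝ → 𝕜} (hh : StronglyMeasurable h) :
    StronglyMeasurable fun s => ∫ z in Ioo (α s) (β s), h z := by
  have h1 : StronglyMeasurable fun q : ℝ × ℝ =>
      {q : ℝ × ℝ | α q.1 < q.2 ∧ q.2 < β q.1}.indicator (fun q => h q.2) q :=
    (hh.comp_measurable measurable_snd).indicator (measurableSet_between hα hβ)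
  have h2 := h1.integral_prod_right' (ν := volume)
  convert h2 using 2 with s
  rw [← integral_indicator measurableSet_Ioo]
  rfl

/-- Tonelli's theorem for integral operators whose kernel is `c(s)` on the interval
`(α(s), β(s))`. -/
theorem lintegral_mul_lintegral_Ioo_le {α β : ℝ → ℝ} (hα : Measurable α) (hβ : Measurable β)
    {c : ℝ → ℝ≥0∞} (hc : Measurable c) {u : ℝ → ℝ≥0∞} (hu : Measurable u) {E E' : Set ℝ}
    (hE' : MeasurableSet E') {C : ℝ≥0∞}
    (hker : ∀ z, ∫⁻ s in E, {s | α s < z ∧ z < β s}.indicator c s ≤ E'.indicator (fun _ => C) z) :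
    ∫⁻ s in E, c s * ∫⁻ z in Ioo (α s) (β s), u z ≤ C * ∫⁻ z in E', u z := by
  have hm : Measurable fun q : ℝ × ℝ =>
      {q : ℝ × ℝ | α q.1 < q.2 ∧ q.2 < β q.1}.indicator (fun q => c q.1 * u q.2) q :=
    ((hc.comp measurable_fst).mul (hu.comp measurable_snd)).indicator
      (measurableSet_between hα hβ)
  calc ∫⁻ s in E, c s * ∫⁻ z in Ioo (α s) (β s), u z
      = ∫⁻ s in E, ∫⁻ z, {q : ℝ × ℝ | α q.1 < q.2 ∧ q.2 < β q.1}.indicator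
          (fun q => c q.1 * u q.2) (s, z) := by
        refine lintegral_congr fun s => ?_
        rw [← lintegral_const_mul _ hu, ← lintegral_indicator measurableSet_Ioo]
        rfl
    _ = ∫⁻ z, ∫⁻ s in E, {q : ℝ × ℝ | α q.1 < q.2 ∧ q.2 < β q.1}.indicator
          (fun q => c q.1 * u q.2) (s, z) := lintegral_lintegral_swap hm.aemeasurable
    _ = ∫⁻ z, (∫⁻ s in E, {s | α s < z ∧ z < β s}.indicator c s) * u z := by
        refine lintegral_congr fun z => ?_
        have hmz : MeasurableSet {s | α s < z ∧ z < β s} :=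
          (measurableSet_lt hα measurable_const).inter (measurableSet_lt measurable_const hβ)
        rw [← lintegral_mul_const _ (hc.indicator hmz)]
        refine lintegral_congr fun s => ?_
        by_cases hs : α s < z ∧ z < β s
        · rw [indicator_of_mem (show s ∈ {s | α s < z ∧ z < β s} from hs),
            indicator_of_mem (show (s, z) ∈ {q : ℝ × ℝ | α q.1 < q.2 ∧ q.2 < β q.1} from hs)]
        · rw [indicator_of_notMem (show s ∉ {s | α s < z ∧ z < β s} from hs),
            indicator_of_notMem (show (s, z) ∉ {q : ℝ × ℝ | α q.1 < q.2 ∧ q.2 < β q.1} from hs),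
            zero_mul]
    _ ≤ ∫⁻ z, E'.indicator (fun _ => C) z * u z := by
        gcongr with z
        exact hker z
    _ = C * ∫⁻ z in E', u z := by
        rw [← lintegral_const_mul _ hu, ← lintegral_indicator hE']
        refine lintegral_congr fun z => ?_
        by_cases hz : z ∈ E' <;> simp [hz]

end IntervalMeans

/-! ### Decreasing functions: the operator of norm two and the level function -/

section Decreasing

open CompatibleCouple

variable {𝕜 : Type*} [RCLike 𝕜]

theorem enorm_ofReal_eq {r : ℝ} (hr : 0 ≤ r) : ‖(r : 𝕜)‖ₑ = ENNReal.ofReal r := by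
  rw [← ofReal_norm, RCLike.norm_ofReal, abs_of_nonneg hr]

theorem integrableOn_Ioo_of_antitoneOn {p : ℝ → ℝ} (hp : AntitoneOn p (Ioi 0)) {a b : ℝ}
    (ha : 0 < a) : IntegrableOn p (Ioo a b) :=
  ((hp.mono fun _ hx => ha.trans_le hx.1).integrableOn_isCompact isCompact_Icc).mono_set
    Ioo_subset_Icc_self

theorem mul_le_integral_Ioo {p : ℝ → ℝ} (hp : AntitoneOn p (Ioi 0)) {a b : ℝ} (ha : 0 < a)
    (hab : a < b) : p b * (b - a) ≤ ∫ x in Ioo a b, p x := by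
  have h := setIntegral_mono_on (μ := volume) (s := Ioo a b) (f := fun _ => p b) (g := p)
    (by simp) (integrableOn_Ioo_of_antitoneOn hp ha) measurableSet_Ioo
    (fun x hx => hp (ha.trans hx.1) (ha.trans hab) hx.2.le)
  rw [setIntegral_const, Real.volume_real_Ioo_of_le hab.le, smul_eq_mul] at h
  linarith

theorem integral_Ioo_le_mul {p : ℝ → ℝ} (hp : AntitoneOn p (Ioi 0)) {a b : ℝ} (ha : 0 < a)
    (hab : a < b) : ∫ x in Ioo a b, p x ≤ p a * (b - a) := by
  have h := setIntegral_mono_on (μ := volume) (s := Ioo a b) (f := p) (g := fun _ => p a)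
    (integrableOn_Ioo_of_antitoneOn hp ha) (by simp) measurableSet_Ioo
    (fun x hx => hp ha (ha.trans hx.1) hx.1.le)
  rw [setIntegral_const, Real.volume_real_Ioo_of_le hab.le, smul_eq_mul] at h
  linarith

/-- The admissible `s` fill at most the interval `(z, 2z)` of length `z`, on which `2 / s ≤ 2 / z`.
The factor 2 is the bound for the operator on `L¹`. -/
theorem lintegral_doubling_kernel (z : ℝ) :
    ∫⁻ s in Ioi 0, {s : ℝ | s / 2 < z ∧ z < s}.indicator (fun s => ENNReal.ofReal (2 / s)) s ≤
      (Ioi (0 : ℝ)).indicator (fun _ => 2) z := by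
  have hm : MeasurableSet {s : ℝ | s / 2 < z ∧ z < s} :=
    (measurableSet_lt (measurable_id.div_const 2) measurable_const).inter
      (measurableSet_lt measurable_const measurable_id)
  rw [lintegral_indicator hm, Measure.restrict_restrict hm]
  rcases le_or_gt z 0 with hz | hz
  · have : {s : ℝ | s / 2 < z ∧ z < s} ∩ Ioi 0 = ∅ := by
      ext s
      simp only [mem_inter_iff, mem_ofPred_eq, mem_Ioi, mem_empty_iff_false, iff_false]
      rintro ⟨⟨h1, h2⟩, h3⟩
      linarith
    rw [this]
    simp
  · have : {s : ℝ | s / 2 < z ∧ z < s} ∩ Ioi 0 ⊆ Ioo z (2 * z) := by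
      rintro s ⟨⟨h1, h2⟩, h3⟩
      exact ⟨h2, by linarith⟩
    rw [indicator_of_mem (show z ∈ Ioi (0 : ℝ) from hz)]
    calc _ ≤ ∫⁻ s in Ioo z (2 * z), ENNReal.ofReal (2 / s) := lintegral_mono_set this
      _ ≤ ∫⁻ s in Ioo z (2 * z), ENNReal.ofReal (2 / z) := by
        refine setLIntegral_mono measurable_const fun s hs => ENNReal.ofReal_le_ofReal ?_
        exact div_le_div_of_nonneg_left (by norm_num) hz hs.1.le
      _ = 2 := by
        rw [setLIntegral_const, Real.volume_Ioo, ← ENNReal.ofReal_mul (by positivity),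
          show 2 / z * (2 * z - z) = 2 by field_simp; ring]
        simp

/-- A decreasing function is fixed by an operator `(L¹, (L^∞)ᵒ) → (L¹, L^∞)` of norm at most two. -/
theorem isImage_two_of_isDecreasing {w : L0 𝕜} (hw : w ∈ (coupleL1LevelLinfty 𝕜).sum)
    (hd : IsDecreasing w) :
    IsImage 2 (coupleL1LevelLinfty 𝕜) (coupleL1Linfty 𝕜) w w := by
  obtain ⟨p, hpm, hp, hp0, hwp⟩ := hd
  let P : ℝ → ℝ := fun x => ∫ z in Ioo (x / 2) x, p z
  have hα : Measurable fun x : ℝ => x / 2 := measurable_id.div_const 2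
  have hPm : Measurable P :=
    (stronglyMeasurable_integral_Ioo (𝕜 := ℝ) hα measurable_id hpm.stronglyMeasurable).measurable
  have hP : ∀ x, 0 < x → p x * (x / 2) ≤ P x := fun x hx => by
    have := mul_le_integral_Ioo hp (half_pos hx) (half_lt_self hx)
    rwa [sub_half] at this
  have hP0 : ∀ x, 0 ≤ P x := fun x => integral_nonneg fun z => hp0 z
  have hθ0 : ∀ x, 0 ≤ p x / P x := fun x =>
    div_nonneg (hp0 x) (hP0 x)
  have hθ : ∀ x, 0 < x → p x / P x ≤ 2 / x := fun x hx => by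
    rcases (hP0 x).eq_or_lt with h | h
    · rw [← h, div_zero]; positivity
    · rw [div_le_div_iff₀ h hx]
      linarith [hP x hx]
  -- The multiplier makes `T w = w`. Since `p` decreases, `P x ≥ p x * (x / 2)`, so the multiplier
  -- is at most `2 / x`; this gives the bound 2 on both spaces.
  let T : L0 𝕜 → ℝ → 𝕜 := fun h x => ((p x / P x : ℝ) : 𝕜) * ∫ z in Ioo (x / 2) x, h z
  have hsub : ∀ x : ℝ, 0 < x → Ioo (x / 2) x ⊆ Ioo 0 x := fun x hx =>
    Ioo_subset_Ioo_left (by positivity)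
  have hinteg : ∀ h ∈ (coupleL1LevelLinfty 𝕜).sum, ∀ x : ℝ, 0 < x →
      IntegrableOn h (Ioo (x / 2) x) := fun h hh x hx =>
    (integrableOn_Ioo hh x).mono_set (hsub x hx)
  have hbd : ∀ (h : L0 𝕜) (x : ℝ), 0 < x →
      ‖T h x‖ₑ ≤ ENNReal.ofReal (2 / x) * ∫⁻ z in Ioo (x / 2) x, ‖h z‖ₑ := by
    intro h x hx
    simp only [T]
    rw [enorm_mul, enorm_ofReal_eq (hθ0 x)]
    exact mul_le_mul' (ENNReal.ofReal_le_ofReal (hθ x hx)) (enorm_integral_le_lintegral_enorm _)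
  refine isImage_of_fun T (fun h _ => ?_) (fun h hh k hk => ?_) (fun r h hh => ?_)
    (fun h k hh hk => ?_) (fun h k hh hk => ?_) hw ?_
  · exact ((RCLike.measurable_ofReal.comp (hpm.div hPm)).mul (stronglyMeasurable_integral_Ioo hα
      measurable_id h.stronglyMeasurable).measurable).aestronglyMeasurable
  · filter_upwards [ae_restrict_mem measurableSet_Ioi] with x hx
    simp only [T]
    rw [← mul_add, ← integral_add (hinteg h hh x hx) (hinteg k hk x hx)]
    congr 1
    refine integral_congr_ae (ae_restrict_of_subset_Ioi ((hsub x hx).trans Ioo_subset_Ioi_self) ?_)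
    filter_upwards [AEEqFun.coeFn_add h k] with z hz
    rw [hz, Pi.add_apply]
  · filter_upwards [ae_restrict_mem measurableSet_Ioi] with x hx
    simp only [T]
    rw [mul_left_comm, ← integral_const_mul r]
    congr 1
    refine integral_congr_ae (ae_restrict_of_subset_Ioi ((hsub x hx).trans Ioo_subset_Ioi_self) ?_)
    filter_upwards [AEEqFun.coeFn_smul r h] with z hz
    rw [hz, Pi.smul_apply, smul_eq_mul]
  · refine (nrm_L1 k).trans_le ?_
    rw [show (coupleL1LevelLinfty 𝕜).X₀.nrm h = _ from nrm_L1 h]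
    calc ∫⁻ x in Ioi 0, ‖k x‖ₑ
        ≤ ∫⁻ x in Ioi 0, ENNReal.ofReal (2 / x) * ∫⁻ z in Ioo (x / 2) x, ‖h z‖ₑ := by
          refine lintegral_mono_ae ?_
          filter_upwards [hk, ae_restrict_mem measurableSet_Ioi] with x hx hx0
          rw [hx]
          exact hbd h x hx0
      _ ≤ _ := lintegral_mul_lintegral_Ioo_le hα measurable_id
          (measurable_const.div measurable_id).ennreal_ofReal
          h.stronglyMeasurable.measurable.enorm measurableSet_Ioi lintegral_doubling_kernel
  · refine (nrm_Linfty_le_iff k _).2 ?_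
    filter_upwards [hk, ae_restrict_mem measurableSet_Ioi] with x hx hx0
    rw [hx]
    refine (hbd h x hx0).trans ?_
    have h1 : ∫⁻ z in Ioo (x / 2) x, ‖h z‖ₑ ≤ levelNorm h * ENNReal.ofReal x :=
      (lintegral_mono_set (hsub x hx0)).trans (lintegral_le_levelNorm h hx0)
    calc ENNReal.ofReal (2 / x) * ∫⁻ z in Ioo (x / 2) x, ‖h z‖ₑ
        ≤ ENNReal.ofReal (2 / x) * (levelNorm h * ENNReal.ofReal x) := by gcongr
      _ = ENNReal.ofReal (2 / x * x) * levelNorm h := by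
          rw [ENNReal.ofReal_mul (div_nonneg zero_le_two (le_of_lt hx0))]; ring
      _ = 2 * levelNorm h := by
          rw [div_mul_cancel₀ _ (ne_of_gt hx0)]; simp
  · filter_upwards [hwp, ae_restrict_mem measurableSet_Ioi] with x hx hx0
    have h1 : ∫ z in Ioo (x / 2) x, w z = ((P x : ℝ) : 𝕜) := by
      simp only [P]
      rw [← integral_ofReal]
      exact integral_congr_ae
        (ae_restrict_of_subset_Ioi ((hsub x hx0).trans Ioo_subset_Ioi_self) hwp)
    simp only [T]
    rw [h1, hx, ← RCLike.ofReal_mul]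
    congr 1
    rcases (hP0 x).eq_or_lt with h | h
    -- If `P x = 0` the quotient defaults to zero, which is correct because then `p x = 0`.
    · have h2 := hP x hx0
      rw [← h] at h2 ⊢
      rw [mul_zero]
      have hx0' : (0 : ℝ) < x := hx0
      nlinarith [hp0 x]
    · rw [div_mul_cancel₀ _ h.ne']

variable {h : L0 𝕜}

theorem realPrimitive_sub (hh : h ∈ (coupleL1LevelLinfty 𝕜).sum) {s t : ℝ} (hs : 0 ≤ s)
    (hst : s ≤ t) : realPrimitive h t - realPrimitive h s = ∫ x in Ioo s t, ‖h x‖ := by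
  rw [realPrimitive_eq_intervalIntegral, realPrimitive_eq_intervalIntegral,
    intervalIntegral.integral_interval_sub_left (intervalIntegrable_indicator hh _ _)
      (intervalIntegrable_indicator hh _ _), intervalIntegral.integral_of_le hst,
    integral_Ioc_eq_integral_Ioo]
  refine setIntegral_congr_fun measurableSet_Ioo fun x hx => ?_
  exact indicator_of_mem (show x ∈ Ioi (0 : ℝ) from hs.trans_lt hx.1) fun x => ‖h x‖

theorem ae_hasDerivAt_realPrimitive (hh : h ∈ (coupleL1LevelLinfty 𝕜).sum) :
    ∀ᵐ x ∂halfLine, HasDerivAt (realPrimitive h) ‖h x‖ x := by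
  have hloc : LocallyIntegrable ((Ioi 0).indicator fun x => ‖h x‖) volume := by
    rw [locallyIntegrable_iff]
    intro K hK
    obtain ⟨R, hR⟩ := hK.isBounded.subset_closedBall 0
    rw [Real.closedBall_eq_Icc] at hR
    have := (intervalIntegrable_indicator hh (-(|R| + 1)) (|R| + 1)).1
    refine this.mono_set fun x hx => ?_
    have h1 := hR hx
    have h2 := le_abs_self R
    exact ⟨by linarith [h1.1], by linarith [h1.2]⟩
  filter_upwards [ae_restrict_of_ae (LocallyIntegrable.ae_hasDerivAt_integral hloc),
    ae_restrict_mem measurableSet_Ioi] with x hx hx0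
  have h1 := hx 0
  rw [indicator_of_mem hx0] at h1
  exact h1.congr_of_eventuallyEq (Eventually.of_forall fun t => realPrimitive_eq_intervalIntegral h t)

theorem primitive_eq_ofReal (hh : h ∈ (coupleL1LevelLinfty 𝕜).sum) (t : ℝ) :
    primitive (fun x => ‖h x‖ₑ) t = ENNReal.ofReal (realPrimitive h t) :=
  (ofReal_realPrimitive hh t).symm

theorem lcm_primitive_ne_top (hh : h ∈ (coupleL1LevelLinfty 𝕜).sum) (y : ℝ) :
    leastConcaveMajorant (primitive fun x => ‖h x‖ₑ) y ≠ ∞ := by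
  obtain ⟨A, B, H⟩ := exists_affine_bound hh
  refine ne_top_of_le_ne_top ENNReal.ofReal_ne_top (leastConcaveMajorant_le
    (isConcaveMajorant_affine A.2 B.2 fun t ht => (H t ht).trans (le_of_eq ?_)) y)
  rw [ENNReal.ofReal_add A.2 (mul_nonneg B.2 ht.le), ENNReal.ofReal_mul B.2,
    show ((A : ℝ≥0).1 : ℝ) = (A : ℝ) from rfl, show ((B : ℝ≥0).1 : ℝ) = (B : ℝ) from rfl,
    ENNReal.ofReal_coe_nnreal, ENNReal.ofReal_coe_nnreal]

theorem levelFunction_eq_levelDeriv (hh : h ∈ (coupleL1LevelLinfty 𝕜).sum) :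
    (levelFunction fun x => ‖h x‖ₑ) = levelDeriv fun x => ‖h x‖ₑ := by
  funext x
  rw [levelFunction, if_pos fun y _ => lcm_primitive_ne_top hh y]

/-- A decreasing function is its own level function. -/
theorem levelFunction_of_isDecreasing (hh : h ∈ (coupleL1LevelLinfty 𝕜).sum)
    (hd : IsDecreasing h) :
    ∀ᵐ x ∂halfLine, h x = (((levelFunction fun y => ‖h y‖ₑ) x).toReal : 𝕜) := by
  obtain ⟨p, hpm, hp, hp0, hhp⟩ := hd
  have hnorm : ∀ᵐ x ∂halfLine, ‖h x‖ = p x := by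
    filter_upwards [hhp] with x hx
    rw [hx, RCLike.norm_ofReal, abs_of_nonneg (hp0 x)]
  have hsub : ∀ a b : ℝ, 0 < a → a < b →
      realPrimitive h b - realPrimitive h a = ∫ x in Ioo a b, p x := fun a b ha hab => by
    rw [realPrimitive_sub hh ha.le hab.le]
    exact integral_congr_ae (ae_restrict_of_subset_Ioi (fun x hx => ha.trans hx.1) hnorm)
  -- The mean of `p` over an interval ending at `y` is at least `p y`, and over an interval starting
  -- at `y` at most `p y`. So the primitive is concave and is its own least concave majorant.
  have hmaj : IsConcaveMajorant (primitive fun x => ‖h x‖ₑ) (realPrimitive h) := by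
    refine ⟨concaveOn_of_slope_anti_adjacent (convex_Ioi 0) fun {x y z} hx hz hxy hyz => ?_,
      fun y hy => ⟨realPrimitive_nonneg h y, (primitive_eq_ofReal hh y).le⟩⟩
    have hx' : (0 : ℝ) < x := hx
    rw [hsub x y hx hxy, hsub y z (hx'.trans hxy) hyz]
    have h1 := mul_le_integral_Ioo hp hx' hxy
    have h2 := integral_Ioo_le_mul hp (hx'.trans hxy) hyz
    rw [← le_div_iff₀ (by linarith)] at h1
    rw [← div_le_iff₀ (by linarith)] at h2
    exact h2.trans h1
  have hlcm : ∀ y, 0 < y → (leastConcaveMajorant (primitive fun x => ‖h x‖ₑ) y).toReal =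
      realPrimitive h y := fun y hy => by
    rw [le_antisymm (leastConcaveMajorant_le hmaj y)
      ((primitive_eq_ofReal hh y).symm.trans_le (le_leastConcaveMajorant hy)),
      ENNReal.toReal_ofReal (realPrimitive_nonneg h y)]
  filter_upwards [hhp, hnorm, ae_hasDerivAt_realPrimitive hh, ae_restrict_mem measurableSet_Ioi]
    with x h1 h2 h3 h4
  have h5 : (fun y => (leastConcaveMajorant (primitive fun x => ‖h x‖ₑ) y).toReal) =ᶠ[𝓝 x]
      realPrimitive h := by
    filter_upwards [Ioi_mem_nhds h4] with y hy using hlcm y hy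
  rw [levelFunction_eq_levelDeriv hh, levelDeriv, h5.deriv_eq, h3.deriv, h2, h1,
    ENNReal.toReal_ofReal (hp0 x)]

end Decreasing

/-! ### Affine pieces of the least concave majorant -/

section ConcaveMajorants

/-- `g` is the least concave majorant on `[0, ∞)` of the increasing function `F`, and is continuous
with `g 0 = 0`. -/
structure IsLeastConcaveMajorant (F g : ℝ → ℝ) : Prop where
  mono : Monotone F
  nonneg : ∀ t, 0 ≤ F t
  cont_left : Continuous F
  concave : ConcaveOn ℝ (Ici 0) g
  cont : ContinuousOn g (Ici 0)
  zero : g 0 = 0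
  le : ∀ t, 0 ≤ t → F t ≤ g t
  least : ∀ ψ : ℝ → ℝ, ConcaveOn ℝ (Ioi 0) ψ → (∀ t, 0 < t → F t ≤ ψ t) → ∀ t, 0 < t → g t ≤ ψ t

theorem concaveOn_affine (a b : ℝ) (s : Set ℝ) (hs : Convex ℝ s) :
    ConcaveOn ℝ s fun t => a + b * t := by
  refine ⟨hs, fun x _ y _ c d _ _ hcd => le_of_eq ?_⟩
  simp only [smul_eq_mul]
  linear_combination a * hcd

variable {F g : ℝ → ℝ}

theorem concaveOn_chord_le {s : Set ℝ} (hg : ConcaveOn ℝ s g) {x t z : ℝ} (hx : x ∈ s)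
    (hz : z ∈ s) (hxt : x ≤ t) (htz : t ≤ z) (hxz : x < z) :
    g x + (g z - g x) / (z - x) * (t - x) ≤ g t := by
  rcases hxt.eq_or_lt with rfl | hxt
  · simp
  rcases htz.eq_or_lt with rfl | htz
  · rw [div_mul_cancel₀ _ (by linarith)]; linarith
  have h := hg.slope_anti_adjacent hx hz hxt htz
  rw [div_le_div_iff₀ (by linarith) (by linarith)] at h
  have h1 : (g z - g x) / (z - x) * (t - x) ≤ g t - g x := by
    rw [div_mul_eq_mul_div, div_le_iff₀ (by linarith)]
    nlinarith
  linarith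

theorem concaveOn_le_chord {s : Set ℝ} (hg : ConcaveOn ℝ s g) {x t z : ℝ} (hx : x ∈ s)
    (ht : t ∈ s) (hz : z ∈ s) (hxz : x < z) (h : t < x ∨ z < t) :
    g t ≤ g x + (g z - g x) / (z - x) * (t - x) := by
  rcases h with h | h
  · have h1 := hg.slope_anti_adjacent ht hz h hxz
    rw [le_div_iff₀ (by linarith)] at h1
    nlinarith
  · have h1 := hg.slope_anti_adjacent hx ht hxz h
    rw [div_le_iff₀ (by linarith)] at h1
    have h2 : (g z - g x) / (z - x) * (z - x) = g z - g x := div_mul_cancel₀ _ (by linarith)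
    nlinarith

/-- The least concave majorant is affine on the intervals where it is not attained. -/
theorem IsLeastConcaveMajorant.affine (H : IsLeastConcaveMajorant F g) {x z : ℝ} (hx : 0 ≤ x)
    (hxz : x < z) (hgap : ∀ t ∈ Ioo x z, F t < g t) {t : ℝ} (ht : t ∈ Icc x z) :
    g t = g x + (g z - g x) / (z - x) * (t - x) := by
  set m := (g z - g x) / (z - x) with hm
  have hz : 0 ≤ z := hx.trans hxz.le
  have hIcc : Icc x z ⊆ Ici 0 := fun u hu => hx.trans hu.1
  refine le_antisymm ?_ (concaveOn_chord_le H.concave hx hz ht.1 ht.2 hxz)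
  by_contra! hlt
  -- `k` is the excess of `g` over its chord, with maximum `δ > 0` at `y`. Where it is at least `δ /
  -- 2`, on a compact subset of the open gap, `g - F` has a positive minimum `η`.
  let k : ℝ → ℝ := fun u => g u - (g x + m * (u - x))
  have hk : ContinuousOn k (Icc x z) := (H.cont.mono hIcc).sub (by fun_prop)
  obtain ⟨y, hy, hmax⟩ := isCompact_Icc.exists_isMaxOn (nonempty_Icc.2 hxz.le) hk
  set δ := k y with hδ
  have hδ0 : 0 < δ := lt_of_lt_of_le (sub_pos.2 hlt) (hmax ht)
  have hkx : k x = 0 := by simp [k]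
  have hkz : k z = 0 := by
    simp only [k, hm]
    rw [div_mul_cancel₀ _ (by linarith)]; ring
  let K := Icc x z ∩ k ⁻¹' Ici (δ / 2)
  have hKc : IsCompact K := isCompact_Icc.of_isClosed_subset
    (hk.preimage_isClosed_of_isClosed isClosed_Icc isClosed_Ici) inter_subset_left
  have hKo : K ⊆ Ioo x z := by
    rintro u ⟨hu, hu'⟩
    have hu'' : δ / 2 ≤ k u := hu'
    refine ⟨lt_of_le_of_ne hu.1 ?_, lt_of_le_of_ne hu.2 ?_⟩
    · rintro rfl; linarith
    · rintro rfl; linarith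
  have hyK : y ∈ K := ⟨hy, by show δ / 2 ≤ k y; linarith⟩
  have hgF : ContinuousOn (fun u => g u - F u) K :=
    (H.cont.mono (inter_subset_left.trans hIcc)).sub H.cont_left.continuousOn
  obtain ⟨q, hq, hmin⟩ := hKc.exists_isMinOn ⟨y, hyK⟩ hgF
  set η := g q - F q with hη
  have hη0 : 0 < η := sub_pos.2 (hgap q (hKo hq))
  set ε := min (δ / 2) η with hε
  have hε0 : 0 < ε := lt_min (by linarith) hη0
  have hεδ : ε ≤ δ / 2 := min_le_left _ _
  have hεη : ε ≤ η := min_le_right _ _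
  -- Cutting `g` along the chord raised by `δ - ε` leaves a concave function. It still majorizes
  -- `F`: on `K` because `ε ≤ η`, elsewhere in the interval because `ε ≤ δ / 2`, and outside because
  -- `g` lies below the chord there. At `y` it is smaller than `g` by `ε`, against minimality.
  let ψ : ℝ → ℝ := g ⊓ fun u => (g x - m * x + δ - ε) + m * u
  have hψ : ConcaveOn ℝ (Ioi 0) ψ :=
    (H.concave.subset Ioi_subset_Ici_self (convex_Ioi 0)).inf
      (concaveOn_affine _ _ _ (convex_Ioi 0))
  have hψF : ∀ u, 0 < u → F u ≤ ψ u := by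
    intro u hu
    refine le_inf (H.le u hu.le) ?_
    have hgu := H.le u hu.le
    by_cases hux : u ∈ Icc x z
    · have hku : k u ≤ δ := hmax hux
      by_cases huK : u ∈ K
      · have h1 : η ≤ g u - F u := hmin huK
        simp only [k] at hku
        linarith
      · have h1 : k u < δ / 2 := not_le.1 fun h => huK ⟨hux, h⟩
        simp only [k] at h1
        linarith
    · have h1 : g u ≤ g x + m * (u - x) := by
        refine concaveOn_le_chord H.concave hx hu.le hz hxz ?_
        by_contra! hcon
        exact hux ⟨hcon.1, hcon.2⟩
      linarith
  have hy0 : 0 < y := hx.trans_lt (hKo hyK).1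
  have h1 := (H.least ψ hψ hψF y hy0).trans inf_le_right
  have h2 : g y - (g x + m * (y - x)) = δ := rfl
  linarith

/-- On an unbounded interval where it is not attained, the least concave majorant is affine, and
its slope is the upper limit of the mean slopes of `F`. -/
theorem IsLeastConcaveMajorant.affine_unbounded (H : IsLeastConcaveMajorant F g) {a : ℝ}
    (ha : 0 ≤ a) (hgap : ∀ t, a < t → F t < g t) :
    ∃ m, (∀ t, a ≤ t → g t = g a + m * (t - a)) ∧
      ∀ ε, 0 < ε → ∀ Y, ∃ y, Y < y ∧ F a + (m - ε) * (y - a) ≤ F y := by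
  have haff : ∀ t, a ≤ t → g t = g a + (g (a + 1) - g a) * (t - a) := fun t ht => by
    have hlt : a < max t (a + 1) := lt_max_of_lt_right (lt_add_one a)
    have h1 := H.affine ha hlt (fun u hu => hgap u hu.1) (t := t) ⟨ht, le_max_left _ _⟩
    have h2 := H.affine ha hlt (fun u hu => hgap u hu.1) (t := a + 1)
      ⟨by linarith, le_max_right _ _⟩
    rw [h1, h2]
    ring
  refine ⟨g (a + 1) - g a, haff, fun ε hε Y => ?_⟩
  set m := g (a + 1) - g a with hm
  rcases le_or_gt (m - ε) 0 with hmε | hmε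
  -- A nonpositive slope is attained everywhere, as `F` is increasing.
  · refine ⟨max Y a + 1, by linarith [le_max_left Y a], ?_⟩
    have h1 : a ≤ max Y a + 1 := by linarith [le_max_right Y a]
    have h2 := H.mono h1
    nlinarith
  · by_contra! hcon
    set W := max Y a with hW
    have hWa : a ≤ W := le_max_right _ _
    have hg : ∀ t, 0 ≤ t → 0 ≤ g t := fun t ht => (H.nonneg t).trans (H.le t ht)
    have hga := hg a ha
    have hgW := hg W (ha.trans hWa)
    -- If `F` stayed below the line of slope `m - ε` from `W` on, it would have an affine majorant
    -- of that slope; the term `g W` in the intercept covers `t ≤ W`. But `g` itself has slope `m`.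
    have hmaj : ∀ t, 0 < t → F t ≤ (g W + g a) + (m - ε) * t := by
      intro t ht
      rcases le_or_gt t W with htW | htW
      · have h1 := (H.mono htW).trans (H.le W (ha.trans hWa))
        nlinarith [mul_pos hmε ht]
      · have h1 := hcon t (lt_of_le_of_lt (le_max_left _ _) htW)
        have h2 := H.le a ha
        nlinarith
    have hle := H.least _ (concaveOn_affine _ _ _ (convex_Ioi 0)) hmaj
    -- Far enough out for the loss `ε * (t - a)` of slope to exceed the surplus `g W + m * a` by
    -- one.
    set t := a + (g W + m * a + 1) / ε with ht
    have hm0 : 0 ≤ m := by linarith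
    have hpos : 0 < (g W + m * a + 1) / ε :=
      div_pos (by nlinarith [mul_nonneg hm0 ha]) hε
    have h1 := hle t (by linarith)
    rw [haff t (by linarith)] at h1
    have h2 : ε * (t - a) = g W + m * a + 1 := by
      rw [ht]; field_simp; ring
    nlinarith

end ConcaveMajorants

/-! ### The gaps of a closed set -/

section Gaps

/-- The left end of the gap of `Z` that contains `t`. -/
noncomputable def gapLeft (Z : Set ℝ) (t : ℝ) : ℝ := sSup (Z ∩ Iic t)

open Classical in
/-- The right end of the gap of `Z` that contains `t`, if the gap is bounded. -/
noncomputable def gapRight (Z : Set ℝ) (t : ℝ) : ℝ :=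
  if (Z ∩ Ici t).Nonempty then sInf (Z ∩ Ici t) else t

/-- The points which are not to the right of the whole set `Z`. -/
def notBeyond (Z : Set ℝ) : Set ℝ := {s | ∃ w ∈ Z, s ≤ w}

/-- `Z` is a closed subset of `[0, ∞)` that contains `0`. -/
structure IsContactSet (Z : Set ℝ) : Prop where
  closed : IsClosed Z
  zero_mem : (0 : ℝ) ∈ Z
  nonneg : ∀ t ∈ Z, 0 ≤ t

variable {Z : Set ℝ}

theorem IsContactSet.gapLeft_mem (hZ : IsContactSet Z) {t : ℝ} (ht : 0 ≤ t) :
    gapLeft Z t ∈ Z ∩ Iic t :=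
  (hZ.closed.inter isClosed_Iic).csSup_mem ⟨0, hZ.zero_mem, ht⟩ ⟨t, fun _ hx => hx.2⟩

theorem le_gapLeft {w t : ℝ} (hw : w ∈ Z) (hwt : w ≤ t) : w ≤ gapLeft Z t :=
  le_csSup ⟨t, fun _ hx => hx.2⟩ ⟨hw, hwt⟩

theorem IsContactSet.gapLeft_nonneg (hZ : IsContactSet Z) (t : ℝ) : 0 ≤ gapLeft Z t :=
  Real.sSup_nonneg fun w hw => hZ.nonneg w hw.1

theorem IsContactSet.monotone_gapLeft (hZ : IsContactSet Z) : Monotone (gapLeft Z) := by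
  intro s t hst
  rcases lt_or_ge s 0 with hs | hs
  · have : Z ∩ Iic s = ∅ := by
      ext w
      simp only [mem_inter_iff, mem_Iic, mem_empty_iff_false, iff_false, not_and, not_le]
      exact fun hw => hs.trans_le (hZ.nonneg w hw)
    rw [gapLeft, this, Real.sSup_empty]
    exact hZ.gapLeft_nonneg t
  · have h := hZ.gapLeft_mem hs
    exact le_gapLeft h.1 (h.2.trans hst)

theorem nonempty_inter_Ici {t : ℝ} (ht : t ∈ notBeyond Z) : (Z ∩ Ici t).Nonempty :=
  let ⟨w, hw, htw⟩ := ht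
  ⟨w, hw, htw⟩

theorem IsContactSet.gapRight_mem (hZ : IsContactSet Z) {t : ℝ} (ht : t ∈ notBeyond Z) :
    gapRight Z t ∈ Z ∩ Ici t := by
  rw [gapRight, if_pos (nonempty_inter_Ici ht)]
  exact (hZ.closed.inter isClosed_Ici).csInf_mem (nonempty_inter_Ici ht) ⟨t, fun _ hx => hx.2⟩

theorem gapRight_le {w t : ℝ} (hw : w ∈ Z) (hwt : t ≤ w) : gapRight Z t ≤ w := by
  rw [gapRight, if_pos ⟨w, hw, hwt⟩]
  exact csInf_le ⟨t, fun _ hx => hx.2⟩ ⟨hw, hwt⟩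

/-- Monotonicity gives measurability of the gap ends. Beyond all of `Z` the default value `t` of
`gapRight` exceeds every point of `Z`, so monotonicity survives there. -/
theorem IsContactSet.monotone_gapRight (hZ : IsContactSet Z) : Monotone (gapRight Z) := by
  intro s t hst
  by_cases ht : t ∈ notBeyond Z
  · have h := hZ.gapRight_mem ht
    exact gapRight_le h.1 (hst.trans h.2)
  · have h1 : ¬ (Z ∩ Ici t).Nonempty := fun ⟨w, hw, htw⟩ => ht ⟨w, hw, htw⟩
    rw [show gapRight Z t = t by rw [gapRight, if_neg h1]]
    by_cases hs : s ∈ notBeyond Z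
    · have h := hZ.gapRight_mem hs
      exact (not_le.1 fun h' => ht ⟨_, h.1, h'⟩).le
    · have h1 : ¬ (Z ∩ Ici s).Nonempty := fun ⟨w, hw, htw⟩ => hs ⟨w, hw, htw⟩
      rwa [gapRight, if_neg h1]

theorem measurableSet_notBeyond : MeasurableSet (notBeyond Z) := by
  refine OrdConnected.measurableSet ⟨fun a _ b hb c hc => ?_⟩
  obtain ⟨w, hw, hbw⟩ := hb
  exact ⟨w, hw, hc.2.trans hbw⟩

theorem IsContactSet.gapLeft_lt (hZ : IsContactSet Z) {t : ℝ} (ht : 0 ≤ t) (htZ : t ∉ Z) :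
    gapLeft Z t < t :=
  lt_of_le_of_ne (hZ.gapLeft_mem ht).2 fun h => htZ (h ▸ (hZ.gapLeft_mem ht).1)

theorem IsContactSet.lt_gapRight (hZ : IsContactSet Z) {t : ℝ} (ht : t ∈ notBeyond Z)
    (htZ : t ∉ Z) : t < gapRight Z t :=
  lt_of_le_of_ne (hZ.gapRight_mem ht).2 fun h => htZ (h.symm ▸ (hZ.gapRight_mem ht).1)

theorem notMem_of_mem_gap {s z : ℝ} (hz : z ∈ Ioo (gapLeft Z s) (gapRight Z s)) : z ∉ Z := by
  intro hzZ
  rcases le_total z s with h | h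
  · exact absurd (le_gapLeft hzZ h) (not_le.2 hz.1)
  · exact absurd (gapRight_le hzZ h) (not_le.2 hz.2)

/-- Points in the same gap have the same gap. -/
theorem IsContactSet.gap_eq (hZ : IsContactSet Z) {s z : ℝ} (hs : s ∈ notBeyond Z)
    (hs0 : 0 ≤ s)
    (hz : z ∈ Ioo (gapLeft Z s) (gapRight Z s)) :
    gapLeft Z z = gapLeft Z s ∧ gapRight Z z = gapRight Z s ∧ z ∈ notBeyond Z := by
  have hl := hZ.gapLeft_mem hs0
  have hr := hZ.gapRight_mem hs
  have hnot : ∀ w ∈ Z, w ≤ gapLeft Z s ∨ gapRight Z s ≤ w := by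
    intro w hw
    by_contra! h
    exact notMem_of_mem_gap ⟨h.1, h.2⟩ hw
  have h1 : Z ∩ Iic z = Z ∩ Iic s := by
    ext w
    refine and_congr_right fun hw => ⟨fun h => ?_, fun h => ?_⟩
    · rcases hnot w hw with h' | h'
      · exact h'.trans hl.2
      · exact absurd (h'.trans h) (not_le.2 hz.2)
    · exact (le_gapLeft hw h).trans hz.1.le
  have h2 : Z ∩ Ici z = Z ∩ Ici s := by
    ext w
    refine and_congr_right fun hw => ⟨fun h => ?_, fun h => ?_⟩
    · rcases hnot w hw with h' | h'
      · exact absurd (le_trans h h') (not_le.2 hz.1)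
      · exact le_trans hr.2 h'
    · exact hz.2.le.trans (gapRight_le hw h)
  exact ⟨by rw [gapLeft, gapLeft, h1], by
    rw [gapRight, gapRight, h2, if_pos (nonempty_inter_Ici hs), if_pos (nonempty_inter_Ici hs)],
    ⟨_, hr.1, hz.2.le⟩⟩

end Gaps

/-! ### Averaging over the gaps -/

section GapAverages

open CompatibleCouple

variable {𝕜 : Type*} [RCLike 𝕜]

open Classical in
/-- Average `h` over the bounded gaps of `Z`, and replace it by a generalized limit of its means
on the unbounded gap, if there is one. -/
noncomputable def gapAverage (Z : Set ℝ) (B : ℕ → Set ℝ) (h : L0 𝕜) (s : ℝ) : 𝕜 :=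
  if s ∈ Z then h s
  else if s ∈ notBeyond Z then
    (((gapRight Z s - gapLeft Z s)⁻¹ : ℝ) : 𝕜) * ∫ z in Ioo (gapLeft Z s) (gapRight Z s), h z
  else limAverage B h

variable {Z : Set ℝ} {B : ℕ → Set ℝ} {a : ℝ} {y : ℕ → ℝ}

theorem measurable_gapAverage (hZ : IsContactSet Z) (B : ℕ → Set ℝ) (h : L0 𝕜) :
    Measurable (gapAverage Z B h) := by
  refine Measurable.ite hZ.closed.measurableSet h.stronglyMeasurable.measurable
    (Measurable.ite measurableSet_notBeyond ?_ measurable_const)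
  exact (RCLike.measurable_ofReal.comp (hZ.monotone_gapRight.measurable.sub
    hZ.monotone_gapLeft.measurable).inv).mul (stronglyMeasurable_integral_Ioo
      hZ.monotone_gapLeft.measurable hZ.monotone_gapRight.measurable
      h.stronglyMeasurable).measurable

theorem enorm_gapAverage_le (hZ : IsContactSet Z) (B : ℕ → Set ℝ) (h : L0 𝕜) {s : ℝ}
    (hs0 : 0 ≤ s) (hs : s ∈ notBeyond Z) (hsZ : s ∉ Z) :
    ‖gapAverage Z B h s‖ₑ ≤ ENNReal.ofReal (gapRight Z s - gapLeft Z s)⁻¹ *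
      ∫⁻ z in Ioo (gapLeft Z s) (gapRight Z s), ‖h z‖ₑ := by
  have hpos : 0 ≤ (gapRight Z s - gapLeft Z s)⁻¹ :=
    inv_nonneg.2 (by linarith [hZ.gapLeft_lt hs0 hsZ, hZ.lt_gapRight hs hsZ])
  rw [gapAverage, if_neg hsZ, if_pos hs, enorm_mul, enorm_ofReal_eq hpos]
  gcongr
  exact enorm_integral_le_lintegral_enorm _

/-- On `Z` nothing changes. Off `Z` the kernel is the reciprocal of the gap length on the square of
each gap, so its integral in the first variable is one. The set `E` must contain every gap it meets,
for otherwise mass from outside would enter the averages. -/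
theorem lintegral_gapAverage_le (hZ : IsContactSet Z) (B : ℕ → Set ℝ) (h : L0 𝕜) {E : Set ℝ}
    (hE : MeasurableSet E) (hE0 : E ⊆ Ioi 0) (hER : E ⊆ notBeyond Z)
    (hsat : ∀ s ∈ E, s ∉ Z → Ioo (gapLeft Z s) (gapRight Z s) ⊆ E) :
    ∫⁻ s in E, ‖gapAverage Z B h s‖ₑ ≤ ∫⁻ s in E, ‖h s‖ₑ := by
  have hZm := hZ.closed.measurableSet
  rw [← lintegral_inter_add_sdiff _ E hZm, ← lintegral_inter_add_sdiff (fun s => ‖h s‖ₑ) E hZm]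
  refine add_le_add (le_of_eq ?_) ?_
  · refine setLIntegral_congr_fun (hE.inter hZm) fun s hs => ?_
    rw [gapAverage, if_pos hs.2]
  · calc ∫⁻ s in E \ Z, ‖gapAverage Z B h s‖ₑ
        ≤ ∫⁻ s in E \ Z, ENNReal.ofReal (gapRight Z s - gapLeft Z s)⁻¹ *
            ∫⁻ z in Ioo (gapLeft Z s) (gapRight Z s), ‖h z‖ₑ := by
          refine lintegral_mono_ae ?_
          filter_upwards [ae_restrict_mem (hE.diff hZm)] with s hs
          exact enorm_gapAverage_le hZ B h (le_of_lt (hE0 hs.1)) (hER hs.1) hs.2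
      _ ≤ 1 * ∫⁻ z in E \ Z, ‖h z‖ₑ := by
          refine lintegral_mul_lintegral_Ioo_le hZ.monotone_gapLeft.measurable
            hZ.monotone_gapRight.measurable (hZ.monotone_gapRight.measurable.sub
            hZ.monotone_gapLeft.measurable).inv.ennreal_ofReal
            h.stronglyMeasurable.measurable.enorm (hE.diff hZm) fun z => ?_
          have hm : MeasurableSet {s | gapLeft Z s < z ∧ z < gapRight Z s} :=
            (measurableSet_lt hZ.monotone_gapLeft.measurable measurable_const).inter
              (measurableSet_lt measurable_const hZ.monotone_gapRight.measurable)
          rw [lintegral_indicator hm, Measure.restrict_restrict hm]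
          by_cases hz : z ∈ E \ Z
          · rw [indicator_of_mem hz]
            have hlt : gapLeft Z z < gapRight Z z :=
              (hZ.gapLeft_lt (le_of_lt (hE0 hz.1)) hz.2).trans (hZ.lt_gapRight (hER hz.1) hz.2)
            have heq : ∀ s ∈ {s | gapLeft Z s < z ∧ z < gapRight Z s} ∩ (E \ Z),
                gapLeft Z z = gapLeft Z s ∧ gapRight Z z = gapRight Z s := fun s hs =>
              let h := hZ.gap_eq (hER hs.2.1) (le_of_lt (hE0 hs.2.1)) hs.1
              ⟨h.1, h.2.1⟩
            calc ∫⁻ s in {s | gapLeft Z s < z ∧ z < gapRight Z s} ∩ (E \ Z),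
                  ENNReal.ofReal (gapRight Z s - gapLeft Z s)⁻¹
                = ∫⁻ s in {s | gapLeft Z s < z ∧ z < gapRight Z s} ∩ (E \ Z),
                  ENNReal.ofReal (gapRight Z z - gapLeft Z z)⁻¹ := by
                  refine setLIntegral_congr_fun (hm.inter (hE.diff hZm)) fun s hs => ?_
                  rw [(heq s hs).1, (heq s hs).2]
              _ ≤ ∫⁻ s in Ioo (gapLeft Z z) (gapRight Z z),
                  ENNReal.ofReal (gapRight Z z - gapLeft Z z)⁻¹ := by
                  refine lintegral_mono_set fun s hs => ?_
                  rw [(heq s hs).1, (heq s hs).2]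
                  exact ⟨hZ.gapLeft_lt (le_of_lt (hE0 hs.2.1)) hs.2.2,
                    hZ.lt_gapRight (hER hs.2.1) hs.2.2⟩
              _ = 1 := by
                  rw [setLIntegral_const, Real.volume_Ioo,
                    ← ENNReal.ofReal_mul (inv_nonneg.2 (by linarith)),
                    inv_mul_cancel₀ (by linarith), ENNReal.ofReal_one]
          · have hempty : {s | gapLeft Z s < z ∧ z < gapRight Z s} ∩ (E \ Z) = ∅ := by
              ext s
              simp only [mem_empty_iff_false, iff_false]
              rintro ⟨h1, h2⟩
              exact hz ⟨hsat s h2.1 h2.2 h1, notMem_of_mem_gap h1⟩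
            rw [hempty, Measure.restrict_empty, lintegral_zero_measure]
            exact zero_le
      _ = _ := one_mul _

/-- The sets over which `gapAverage` takes means on the unbounded gap. -/
structure IsMeanSequence (Z : Set ℝ) (a : ℝ) (y : ℕ → ℝ) : Prop where
  nonneg : 0 ≤ a
  add_one_le : ∀ n, a + 1 ≤ y n
  tendsto : Tendsto y atTop atTop
  greatest : ∀ s, s ∉ notBeyond Z → IsGreatest Z a

theorem IsMeanSequence.volume_eq (hy : IsMeanSequence Z a y) (n : ℕ) :
    volume.real (Ioo a (y n)) = y n - a :=
  Real.volume_real_Ioo_of_le (by linarith [hy.add_one_le n])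

theorem IsMeanSequence.subset (hy : IsMeanSequence Z a y) (n : ℕ) : Ioo a (y n) ⊆ Ioi 0 :=
  fun _ hx => hy.nonneg.trans_lt hx.1

theorem realPrimitive_le_of_levelNorm {h : L0 𝕜} (hh : levelNorm h < ∞) {t : ℝ} (ht : 0 ≤ t) :
    realPrimitive h t ≤ (levelNorm h).toReal * t := by
  rcases ht.eq_or_lt with rfl | ht
  · rw [realPrimitive_of_nonpos h le_rfl, mul_zero]
  have h1 := lintegral_le_levelNorm h ht
  rw [← ofReal_realPrimitive (mem_sum_right (X := coupleL1LevelLinfty 𝕜) hh),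
    ← ENNReal.ofReal_toReal hh.ne, ← ENNReal.ofReal_mul ENNReal.toReal_nonneg] at h1
  exact (ENNReal.ofReal_le_ofReal_iff (by positivity)).1 h1

/-- The integral up to `y n` is at most the level norm times `y n`, while the length is `y n - a`.
The quotient `y n / (y n - a)` tends to one, so the limit functional has norm at most one on
`(L^∞)ᵒ`. -/
theorem IsMeanSequence.setAverage_le (hy : IsMeanSequence Z a y) {h : L0 𝕜}
    (hh : levelNorm h < ∞) (n : ℕ) :
    ⨍ x in Ioo a (y n), ‖h x‖ ≤ (levelNorm h).toReal * (1 + a * (y n - a)⁻¹) := by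
  have h1 := hy.add_one_le n
  have hmem : h ∈ (coupleL1LevelLinfty 𝕜).sum := mem_sum_right hh
  rw [setAverage_eq, hy.volume_eq, smul_eq_mul, ← realPrimitive_sub hmem hy.nonneg (by linarith)]
  have hya : 0 < y n - a := by linarith
  have h2 := realPrimitive_le_of_levelNorm hh (t := y n) (by linarith [hy.nonneg])
  have h3 := realPrimitive_nonneg h a
  rw [inv_mul_le_iff₀ hya]
  have h4 : (y n - a) * ((levelNorm h).toReal * (1 + a * (y n - a)⁻¹)) =
      (levelNorm h).toReal * y n := by
    field_simp; ring
  linarith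

theorem IsMeanSequence.hasBoundedAverages (hy : IsMeanSequence Z a y) {h : L0 𝕜}
    (hh : h ∈ (coupleL1LevelLinfty 𝕜).sum) : HasBoundedAverages (fun n => Ioo a (y n)) h := by
  obtain ⟨u, v, hu, hv, rfl⟩ := mem_sum_iff.1 hh
  refine HasBoundedAverages.add hy.subset (hasBoundedAverages_of_L1 hy.subset (fun n => ?_) hu)
    ⟨fun n => ?_, (levelNorm v).toReal * (1 + a), fun n => (hy.setAverage_le hv n).trans ?_⟩
  · rw [hy.volume_eq]; linarith [hy.add_one_le n]
  · exact (integrableOn_Ioo (mem_sum_right hv) (y n)).mono_set (Ioo_subset_Ioo_left hy.nonneg)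
  · have h1 : (y n - a)⁻¹ ≤ 1 := inv_le_one_of_one_le₀ (by linarith [hy.add_one_le n])
    have h2 : a * (y n - a)⁻¹ ≤ a := mul_le_of_le_one_right hy.nonneg h1
    gcongr

theorem IsMeanSequence.norm_limAverage_le (hy : IsMeanSequence Z a y) {h : L0 𝕜}
    (hh : levelNorm h < ∞) :
    ‖limAverage (fun n => Ioo a (y n)) h‖ ≤ (levelNorm h).toReal := by
  refine CalderonMityagin.norm_limAverage_le (hy.hasBoundedAverages (mem_sum_right hh))
    (hy.setAverage_le hh) ?_
  have h1 : Tendsto (fun n => (y n - a)⁻¹) atTop (𝓝 0) :=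
    tendsto_inv_atTop_zero.comp (tendsto_atTop_add_const_right _ _ hy.tendsto)
  simpa using ((h1.const_mul a).const_add 1).const_mul (levelNorm h).toReal

theorem IsMeanSequence.limAverage_of_L1 (hy : IsMeanSequence Z a y) {h : L0 𝕜}
    (hh : (lebesgue 𝕜 1 le_rfl).nrm h < ∞) : limAverage (fun n => Ioo a (y n)) h = 0 := by
  refine CalderonMityagin.limAverage_of_L1 hy.subset (fun n => ?_) ?_ hh
  · rw [hy.volume_eq]; linarith [hy.add_one_le n]
  · simp only [hy.volume_eq]
    exact tendsto_atTop_add_const_right _ _ hy.tendsto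

/-- Averaging can increase `∫₀ᵗ |h|` at points inside a gap, but not beyond the line `M t`: at gap
ends the primitive is at most `M t`, and inside a gap linear interpolation between the ends stays
below that line. -/
theorem levelNorm_gapAverage_le (hZ : IsContactSet Z) (hy : IsMeanSequence Z a y) {h : L0 𝕜}
    (hh : levelNorm h < ∞) {t : ℝ} (ht : 0 < t) :
    ∫⁻ s in Ioo 0 t, ‖gapAverage Z (fun n => Ioo a (y n)) h s‖ₑ ≤
      levelNorm h * ENNReal.ofReal t := by
  have hmem : h ∈ (coupleL1LevelLinfty 𝕜).sum := mem_sum_right hh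
  set M := (levelNorm h).toReal with hM
  have hM0 : 0 ≤ M := ENNReal.toReal_nonneg
  set l := gapLeft Z t with hl
  have hlm := hZ.gapLeft_mem ht.le
  have hl0 : 0 ≤ l := hZ.gapLeft_nonneg t
  have hlt : l ≤ t := hlm.2
  set V := realPrimitive h with hV
  have hVl : V l ≤ M * l := realPrimitive_le_of_levelNorm hh hl0
  have h1 : ∫⁻ s in Ioo 0 l, ‖gapAverage Z (fun n => Ioo a (y n)) h s‖ₑ ≤ ENNReal.ofReal (V l) := by
    rw [hV, ofReal_realPrimitive hmem]
    refine lintegral_gapAverage_le hZ _ h measurableSet_Ioo Ioo_subset_Ioi_self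
      (fun s hs => ⟨l, hlm.1, hs.2.le⟩) fun s hs hsZ z hz => ?_
    exact ⟨(hZ.gapLeft_nonneg s).trans_lt hz.1, hz.2.trans_le (gapRight_le hlm.1 hs.2.le)⟩
  -- Between the left gap end `l` and `t` the averaged function is bounded by a constant `c`: zero
  -- if the interval is empty, the mean of `|h|` in a bounded gap, and `M` in the unbounded one.
  obtain ⟨c, hc0, hcM, hc⟩ : ∃ c : ℝ, 0 ≤ c ∧ V l + c * (t - l) ≤ M * t ∧
      ∀ s ∈ Ioo l t, ‖gapAverage Z (fun n => Ioo a (y n)) h s‖ₑ ≤ ENNReal.ofReal c := by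
    by_cases htZ : t ∈ Z
    · have : l = t := le_antisymm hlt (le_gapLeft htZ le_rfl)
      refine ⟨0, le_rfl, by rw [← this]; linarith, fun s hs => ?_⟩
      rw [this] at hs
      exact absurd hs.1 (not_lt.2 hs.2.le)
    by_cases htR : t ∈ notBeyond Z
    · set r := gapRight Z t with hr
      have htr : t < r := hZ.lt_gapRight htR htZ
      have hlt' : l < t := hZ.gapLeft_lt ht.le htZ
      have hVr : V r ≤ M * r := realPrimitive_le_of_levelNorm hh (by linarith)
      have hVlr : V l ≤ V r := monotone_realPrimitive hmem (by linarith)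
      refine ⟨(r - l)⁻¹ * (V r - V l), mul_nonneg (inv_nonneg.2 (by linarith)) (by linarith), ?_,
        fun s hs => ?_⟩
      · have hrl : 0 < r - l := by linarith
        have h2 : (V l + (r - l)⁻¹ * (V r - V l) * (t - l)) * (r - l) =
            V l * (r - t) + V r * (t - l) := by
          field_simp; ring
        refine le_of_mul_le_mul_right ?_ hrl
        rw [h2]
        nlinarith
      · have hst : s ∈ Ioo l r := ⟨hs.1, hs.2.trans htr⟩
        have hg := hZ.gap_eq htR ht.le hst
        refine (enorm_gapAverage_le hZ _ h (hl0.trans hs.1.le) hg.2.2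
          (notMem_of_mem_gap hst)).trans (le_of_eq ?_)
        rw [hg.1, hg.2.1, ENNReal.ofReal_mul (inv_nonneg.2 (by linarith)),
          realPrimitive_sub hmem hl0 (by linarith),
          ofReal_integral_norm_eq_lintegral_enorm
            ((integrableOn_Ioo hmem r).mono_set (Ioo_subset_Ioo_left hl0))]
    · have ha := hy.greatest t htR
      have hal : a = l := by
        refine le_antisymm (le_gapLeft ha.1 ?_) (ha.2 hlm.1)
        exact (not_le.1 fun h' => htR ⟨a, ha.1, h'⟩).le
      refine ⟨M, hM0, by linarith, fun s hs => ?_⟩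
      have hsR : s ∉ notBeyond Z := by
        rintro ⟨w, hw, hsw⟩
        have := ha.2 hw
        linarith [hs.1]
      have hsZ : s ∉ Z := fun h' => hsR ⟨s, h', le_rfl⟩
      rw [gapAverage, if_neg hsZ, if_neg hsR, ← ofReal_norm]
      exact ENNReal.ofReal_le_ofReal (hy.norm_limAverage_le hh)
  calc ∫⁻ s in Ioo 0 t, ‖gapAverage Z (fun n => Ioo a (y n)) h s‖ₑ
      ≤ ∫⁻ s in Ioc 0 l ∪ Ioo l t, ‖gapAverage Z (fun n => Ioo a (y n)) h s‖ₑ := by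
        refine lintegral_mono_set fun s hs => ?_
        rcases le_or_gt s l with h' | h'
        · exact Or.inl ⟨hs.1, h'⟩
        · exact Or.inr ⟨h', hs.2⟩
    _ ≤ (∫⁻ s in Ioc 0 l, ‖gapAverage Z (fun n => Ioo a (y n)) h s‖ₑ) +
        ∫⁻ s in Ioo l t, ‖gapAverage Z (fun n => Ioo a (y n)) h s‖ₑ := lintegral_union_le _ _ _
    _ ≤ ENNReal.ofReal (V l) + ∫⁻ s in Ioo l t, ENNReal.ofReal c := by
        refine add_le_add ?_ (setLIntegral_mono measurable_const hc)
        rw [setLIntegral_congr Ioo_ae_eq_Ioc.symm]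
        exact h1
    _ = ENNReal.ofReal (V l + c * (t - l)) := by
        rw [setLIntegral_const, Real.volume_Ioo, ← ENNReal.ofReal_mul hc0,
          ENNReal.ofReal_add (realPrimitive_nonneg h l) (mul_nonneg hc0 (by linarith))]
    _ ≤ ENNReal.ofReal (M * t) := ENNReal.ofReal_le_ofReal hcM
    _ = levelNorm h * ENNReal.ofReal t := by
        rw [ENNReal.ofReal_mul hM0, hM, ENNReal.ofReal_toReal hh.ne]

theorem isImage_gapAverage (hZ : IsContactSet Z) (hy : IsMeanSequence Z a y) {f v : L0 𝕜}
    (hf : f ∈ (coupleL1LevelLinfty 𝕜).sum)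
    (hv : v =ᵐ[halfLine] gapAverage Z (fun n => Ioo a (y n)) f) :
    IsImage 1 (coupleL1LevelLinfty 𝕜) (coupleL1LevelLinfty 𝕜) f v := by
  have hsub : ∀ s, 0 ≤ s → Ioo (gapLeft Z s) (gapRight Z s) ⊆ Ioo 0 (gapRight Z s) := fun s _ =>
    Ioo_subset_Ioo_left (hZ.gapLeft_nonneg s)
  have hinteg : ∀ h ∈ (coupleL1LevelLinfty 𝕜).sum, ∀ s, 0 ≤ s →
      IntegrableOn h (Ioo (gapLeft Z s) (gapRight Z s)) := fun h hh s hs =>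
    (integrableOn_Ioo hh _).mono_set (hsub s hs)
  refine isImage_of_fun (gapAverage Z fun n => Ioo a (y n))
    (fun h _ => (measurable_gapAverage hZ _ h).aestronglyMeasurable)
    (fun h hh k hk => ?_) (fun r h hh => ?_) (fun h k hh hk => ?_) (fun h k hh hk => ?_) hf hv
  · filter_upwards [AEEqFun.coeFn_add h k, ae_restrict_mem measurableSet_Ioi] with s hs hs0
    have hs0' : (0 : ℝ) ≤ s := le_of_lt hs0
    simp only [gapAverage]
    split_ifs
    · rw [hs, Pi.add_apply]
    · rw [← mul_add, ← integral_add (hinteg h hh s hs0') (hinteg k hk s hs0')]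
      congr 1
      refine integral_congr_ae
        (ae_restrict_of_subset_Ioi ((hsub s hs0').trans Ioo_subset_Ioi_self) ?_)
      filter_upwards [AEEqFun.coeFn_add h k] with z hz
      rw [hz, Pi.add_apply]
    · exact limAverage_add hy.subset (hy.hasBoundedAverages hh) (hy.hasBoundedAverages hk)
  · filter_upwards [AEEqFun.coeFn_smul r h, ae_restrict_mem measurableSet_Ioi] with s hs hs0
    have hs0' : (0 : ℝ) ≤ s := le_of_lt hs0
    simp only [gapAverage]
    split_ifs
    · rw [hs, Pi.smul_apply, smul_eq_mul]
    · rw [mul_left_comm, ← integral_const_mul r]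
      congr 1
      refine integral_congr_ae
        (ae_restrict_of_subset_Ioi ((hsub s hs0').trans Ioo_subset_Ioi_self) ?_)
      filter_upwards [AEEqFun.coeFn_smul r h] with z hz
      rw [hz, Pi.smul_apply, smul_eq_mul]
    · exact limAverage_smul hy.subset r (hy.hasBoundedAverages hh)
  · rw [ENNReal.coe_one, one_mul]
    refine (nrm_L1 k).trans_le (le_trans ?_ (nrm_L1 h).ge)
    rw [lintegral_congr_ae (g := fun s => ‖gapAverage Z (fun n => Ioo a (y n)) h s‖ₑ)
      (by filter_upwards [hk] with s hs; rw [hs])]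
    rw [← lintegral_inter_add_sdiff _ (Ioi (0 : ℝ)) (measurableSet_notBeyond (Z := Z))]
    have h1 : ∫⁻ s in Ioi 0 ∩ notBeyond Z, ‖gapAverage Z (fun n => Ioo a (y n)) h s‖ₑ ≤
        ∫⁻ s in Ioi 0 ∩ notBeyond Z, ‖h s‖ₑ := by
      refine lintegral_gapAverage_le hZ _ h (measurableSet_Ioi.inter measurableSet_notBeyond)
        inter_subset_left inter_subset_right fun s hs hsZ z hz => ?_
      exact ⟨(hZ.gapLeft_nonneg s).trans_lt hz.1, _, (hZ.gapRight_mem hs.2).1, hz.2.le⟩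
    have h2 : ∫⁻ s in Ioi 0 \ notBeyond Z, ‖gapAverage Z (fun n => Ioo a (y n)) h s‖ₑ = 0 := by
      rw [← lintegral_zero (μ := volume.restrict (Ioi 0 \ notBeyond Z))]
      refine setLIntegral_congr_fun (measurableSet_Ioi.diff measurableSet_notBeyond)
        fun s hs => ?_
      have hsZ : s ∉ Z := fun h' => hs.2 ⟨s, h', le_rfl⟩
      rw [gapAverage, if_neg hsZ, if_neg hs.2, hy.limAverage_of_L1 hh, enorm_zero]
    rw [h2, add_zero]
    exact h1.trans (lintegral_mono_set inter_subset_left)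
  · rw [ENNReal.coe_one, one_mul]
    refine (levelNorm_le_iff k _).2 fun t ht => ?_
    rw [lintegral_congr_ae (g := fun s => ‖gapAverage Z (fun n => Ioo a (y n)) h s‖ₑ)
      (by filter_upwards [ae_Ioo hk t] with s hs; rw [hs])]
    exact levelNorm_gapAverage_le hZ hy hh ht

end GapAverages

/-! ### The level function as an image -/

section LevelFunctions

open CompatibleCouple

/-- This says that `g t / t` decreases. No value at zero is available, so slopes are compared from a
point `e > 0`, where `g e ≥ 0`, and then `e` tends to zero. -/
theorem mul_le_mul_of_concaveOn {g : ℝ → ℝ} (hg : ConcaveOn ℝ (Ioi 0) g)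
    (h0 : ∀ t, 0 < t → 0 ≤ g t) {u v : ℝ} (hu : 0 < u) (huv : u < v) : u * g v ≤ v * g u := by
  have key : ∀ e ∈ Ioo 0 u, (g v - g u) * (u - e) ≤ g u * (v - u) := by
    intro e he
    have h := hg.slope_anti_adjacent he.1 (show v ∈ Ioi (0 : ℝ) from hu.trans huv) he.2 huv
    rw [div_le_div_iff₀ (by linarith) (by linarith [he.2])] at h
    nlinarith [h0 e he.1]
  have hlim : Tendsto (fun e => (g v - g u) * (u - e)) (𝓝[>] 0) (𝓝 ((g v - g u) * (u - 0))) :=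
    (Continuous.tendsto (by fun_prop) 0).mono_left nhdsWithin_le_nhds
  have := le_of_tendsto hlim (by filter_upwards [Ioo_mem_nhdsGT hu] with e he using key e he)
  nlinarith

variable {𝕜 : Type*} [RCLike 𝕜]

open Classical in
/-- The least concave majorant of the primitive of `|f|`, with real values and extended by zero. -/
noncomputable def levelMajorant (f : L0 𝕜) (t : ℝ) : ℝ :=
  if 0 < t then (leastConcaveMajorant (primitive fun x => ‖f x‖ₑ) t).toReal else 0

variable {f : L0 𝕜}

theorem levelMajorant_of_pos (f : L0 𝕜) {t : ℝ} (ht : 0 < t) :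
    levelMajorant f t = (leastConcaveMajorant (primitive fun x => ‖f x‖ₑ) t).toReal := if_pos ht

theorem levelMajorant_of_nonpos (f : L0 𝕜) {t : ℝ} (ht : t ≤ 0) : levelMajorant f t = 0 :=
  if_neg (not_lt.2 ht)

theorem levelMajorant_nonneg (f : L0 𝕜) (t : ℝ) : 0 ≤ levelMajorant f t := by
  rw [levelMajorant]
  split_ifs
  · exact ENNReal.toReal_nonneg
  · exact le_rfl

theorem levelMajorant_le (hf : f ∈ (coupleL1LevelLinfty 𝕜).sum) {ψ : ℝ → ℝ}
    (hψ : ConcaveOn ℝ (Ioi 0) ψ) (h : ∀ t, 0 < t → realPrimitive f t ≤ ψ t) {t : ℝ} (ht : 0 < t) :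
    levelMajorant f t ≤ ψ t := by
  rw [levelMajorant_of_pos f ht]
  refine toReal_lcm_le ⟨hψ, fun y hy => ⟨(realPrimitive_nonneg f y).trans (h y hy), ?_⟩⟩ ht
  rw [primitive_eq_ofReal hf]
  exact ENNReal.ofReal_le_ofReal (h y hy)

theorem realPrimitive_le_levelMajorant (hf : f ∈ (coupleL1LevelLinfty 𝕜).sum) (t : ℝ) :
    realPrimitive f t ≤ levelMajorant f t := by
  rcases le_or_gt t 0 with ht | ht
  · rw [realPrimitive_of_nonpos f ht, levelMajorant_of_nonpos f ht]
  · rw [levelMajorant_of_pos f ht]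
    refine (ENNReal.ofReal_le_iff_le_toReal (lcm_primitive_ne_top hf t)).1 ?_
    rw [← primitive_eq_ofReal hf]
    exact le_leastConcaveMajorant ht

/-- Away from zero everything is inherited from the infimum of concave majorants. At zero, concavity
of the extension is the decrease of `g t / t`, and continuity uses that the primitive of `|f|` tends
to zero. -/
theorem isLeastConcaveMajorant_levelMajorant (hf : f ∈ (coupleL1LevelLinfty 𝕜).sum) :
    IsLeastConcaveMajorant (realPrimitive f) (levelMajorant f) := by
  have hc : ConcaveOn ℝ (Ioi 0) (levelMajorant f) :=
    (concaveOn_lcm fun y _ => lcm_primitive_ne_top hf y).congr fun t ht =>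
      (levelMajorant_of_pos f ht).symm
  have h0 : levelMajorant f 0 = 0 := levelMajorant_of_nonpos f le_rfl
  have hstar := fun u v : ℝ => mul_le_mul_of_concaveOn hc
    (fun t _ => levelMajorant_nonneg f t) (u := u) (v := v)
  refine ⟨monotone_realPrimitive hf, realPrimitive_nonneg f, continuous_realPrimitive hf, ?_, ?_,
    h0, fun t _ => realPrimitive_le_levelMajorant hf t,
    fun ψ hψ h t ht => levelMajorant_le hf hψ h ht⟩
  · refine concaveOn_of_slope_anti_adjacent (convex_Ici 0) fun {x y z} hx hz hxy hyz => ?_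
    rcases (show (0 : ℝ) ≤ x from hx).eq_or_lt with rfl | hx
    · have h := hstar y z hxy hyz
      rw [h0, div_le_div_iff₀ (by linarith) (by linarith)]
      nlinarith
    · exact hc.slope_anti_adjacent hx (show (0 : ℝ) < z by linarith) hxy hyz
  · intro t ht
    rcases (show (0 : ℝ) ≤ t from ht).eq_or_lt with rfl | ht
    · have hlim : Tendsto (levelMajorant f) (𝓝[≥] 0) (𝓝 0) := by
        refine tendsto_order.2 ⟨fun b hb => Eventually.of_forall fun t =>
          hb.trans_le (levelMajorant_nonneg f t), fun b hb => ?_⟩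
        have hF : Tendsto (realPrimitive f) (𝓝[>] 0) (𝓝 0) := by
          have := (continuous_realPrimitive hf).tendsto 0
          rw [realPrimitive_of_nonpos f le_rfl] at this
          exact this.mono_left nhdsWithin_le_nhds
        obtain ⟨δ, hδb, hδ⟩ := ((hF.eventually (gt_mem_nhds (half_pos hb))).and
          self_mem_nhdsWithin).exists
        have hδ' : (0 : ℝ) < δ := hδ
        set C := levelMajorant f δ / δ with hC
        have hC0 : 0 ≤ C := div_nonneg (levelMajorant_nonneg f δ) hδ'.le
        -- An affine majorant with small intercept: up to `δ` the primitive is below `b / 2`, and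
        -- after `δ` the majorant lies below the line through the origin and its point at `δ`.
        have hmaj : ∀ t, 0 < t → levelMajorant f t ≤ b / 2 + C * t := fun t ht => by
          refine levelMajorant_le hf (concaveOn_affine (b / 2) C _ (convex_Ioi 0)) (fun u hu => ?_) ht
          rcases le_or_gt u δ with h | h
          · have h1 := monotone_realPrimitive hf h
            have h2 := mul_nonneg hC0 hu.le
            linarith
          · have h1 := hstar δ u hδ' h
            have h2 : levelMajorant f u ≤ C * u := by
              rw [hC, div_mul_eq_mul_div, le_div_iff₀ hδ']
              linarith
            linarith [realPrimitive_le_levelMajorant hf u]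
        have hlim2 : Tendsto (fun t => b / 2 + C * t) (𝓝[≥] 0) (𝓝 (b / 2 + C * 0)) :=
          (Continuous.tendsto (by fun_prop) 0).mono_left nhdsWithin_le_nhds
        filter_upwards [hlim2.eventually (gt_mem_nhds (show b / 2 + C * 0 < b by linarith)),
          self_mem_nhdsWithin] with t ht ht0
        rcases (show (0 : ℝ) ≤ t from ht0).eq_or_lt with rfl | ht0
        · rwa [h0]
        · exact (hmaj t ht0).trans_lt ht
      rw [ContinuousWithinAt, h0]
      exact hlim
    · exact ((hc.continuousOn isOpen_Ioi).continuousAt (Ioi_mem_nhds ht)).continuousWithinAt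

open Classical in
/-- The right derivative of the least concave majorant of the primitive of `|f|`. -/
noncomputable def levelSlope (f : L0 𝕜) (t : ℝ) : ℝ :=
  if 0 < t then derivWithin (levelMajorant f) (Ioi t) t else 0

theorem levelSlope_of_pos (f : L0 𝕜) {t : ℝ} (ht : 0 < t) :
    levelSlope f t = derivWithin (levelMajorant f) (Ioi t) t := if_pos ht

theorem measurable_levelSlope (f : L0 𝕜) : Measurable (levelSlope f) :=
  Measurable.ite measurableSet_Ioi (measurable_derivWithin_Ioi _) measurable_const

theorem levelSlope_eq (f : L0 𝕜) {t m : ℝ} (ht : 0 < t) (h : HasDerivAt (levelMajorant f) m t) :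
    levelSlope f t = m := by
  rw [levelSlope_of_pos f ht]
  exact h.hasDerivWithinAt.derivWithin (uniqueDiffWithinAt_Ioi t)

theorem hasDerivWithinAt_levelMajorant (hf : f ∈ (coupleL1LevelLinfty 𝕜).sum) {t : ℝ}
    (ht : 0 < t) : HasDerivWithinAt (levelMajorant f) (levelSlope f t) (Ioi t) t := by
  have hc := (isLeastConcaveMajorant_levelMajorant hf).concave
  have h := hc.neg.differentiableWithinAt_Ioi_of_mem_interior (x := t)
    (by rwa [interior_Ici])
  rw [levelSlope_of_pos f ht]
  have h2 := h.neg
  rw [neg_neg] at h2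
  exact h2.hasDerivWithinAt

theorem antitoneOn_levelSlope (hf : f ∈ (coupleL1LevelLinfty 𝕜).sum) :
    AntitoneOn (levelSlope f) (Ioi 0) := by
  have hc := (isLeastConcaveMajorant_levelMajorant hf).concave
  intro s hs t ht hst
  have h := hc.neg.monotoneOn_rightDeriv (by rwa [interior_Ici]) (by rwa [interior_Ici]) hst
  simp only [derivWithin.neg] at h
  rw [levelSlope_of_pos f hs, levelSlope_of_pos f ht]
  exact neg_le_neg_iff.1 h

theorem monotoneOn_levelMajorant (hf : f ∈ (coupleL1LevelLinfty 𝕜).sum) :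
    MonotoneOn (levelMajorant f) (Ioi 0) :=
  monotoneOn_of_concaveOn ((isLeastConcaveMajorant_levelMajorant hf).concave.subset
    Ioi_subset_Ici_self (convex_Ioi 0)) (levelMajorant_nonneg f)

theorem levelSlope_nonneg (hf : f ∈ (coupleL1LevelLinfty 𝕜).sum) (t : ℝ) :
    0 ≤ levelSlope f t := by
  rw [levelSlope]
  split_ifs with ht
  · exact ((monotoneOn_levelMajorant hf).mono (Ioi_subset_Ioi ht.le)).derivWithin_nonneg
  · exact le_rfl

/-- The majorant is continuous, vanishes at zero and has a right derivative everywhere, so the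
fundamental theorem of calculus for right derivatives applies. -/
theorem lintegral_levelSlope (hf : f ∈ (coupleL1LevelLinfty 𝕜).sum) {t : ℝ} (ht : 0 < t) :
    ∫⁻ x in Ioo 0 t, ENNReal.ofReal (levelSlope f x) = ENNReal.ofReal (levelMajorant f t) := by
  have H := isLeastConcaveMajorant_levelMajorant hf
  have hcont : ContinuousOn (levelMajorant f) (Icc 0 t) := H.cont.mono Icc_subset_Ici_self
  have hder : ∀ x ∈ Ioo 0 t, HasDerivWithinAt (levelMajorant f) (levelSlope f x) (Ioi x) x :=
    fun x hx => hasDerivWithinAt_levelMajorant hf hx.1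
  have hinteg : IntegrableOn (levelSlope f) (Ioc 0 t) :=
    intervalIntegral.integrableOn_deriv_right_of_nonneg hcont hder
      fun x _ => levelSlope_nonneg hf x
  have h := intervalIntegral.integral_eq_sub_of_hasDeriv_right
    (by rwa [uIcc_of_le ht.le]) (by rwa [min_eq_left ht.le, max_eq_right ht.le])
    ((intervalIntegrable_iff_integrableOn_Ioc_of_le ht.le).2 hinteg)
  rw [H.zero, sub_zero, intervalIntegral.integral_of_le ht.le] at h
  rw [setLIntegral_congr Ioo_ae_eq_Ioc, ← ofReal_integral_eq_lintegral_ofReal hinteg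
    (ae_of_all _ fun x => levelSlope_nonneg hf x), h]

theorem ae_differentiableAt_levelMajorant (hf : f ∈ (coupleL1LevelLinfty 𝕜).sum) :
    ∀ᵐ x ∂halfLine, DifferentiableAt ℝ (levelMajorant f) x := by
  have h := (ae_restrict_iff' measurableSet_Ioi).2
    (monotoneOn_levelMajorant hf).ae_differentiableWithinAt_of_mem
  filter_upwards [h, ae_restrict_mem measurableSet_Ioi] with x hx hx0
  exact hx.differentiableAt (Ioi_mem_nhds hx0)

theorem levelFunction_eq_levelSlope (hf : f ∈ (coupleL1LevelLinfty 𝕜).sum) :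
    ∀ᵐ x ∂halfLine, ((levelFunction fun y => ‖f y‖ₑ) x).toReal = levelSlope f x := by
  filter_upwards [ae_differentiableAt_levelMajorant hf, ae_restrict_mem measurableSet_Ioi]
    with x hx hx0
  have h5 : (fun y => (leastConcaveMajorant (primitive fun x => ‖f x‖ₑ) y).toReal) =ᶠ[𝓝 x]
      levelMajorant f := by
    filter_upwards [Ioi_mem_nhds hx0] with y hy using (levelMajorant_of_pos f hy).symm
  rw [levelFunction_eq_levelDeriv hf, levelDeriv, h5.deriv_eq, ← levelSlope_eq f hx0 hx.hasDerivAt,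
    ENNReal.toReal_ofReal (levelSlope_nonneg hf x)]

/-- The set where the primitive of `|f|` meets its least concave majorant. -/
def contactSet (f : L0 𝕜) : Set ℝ := {t | 0 ≤ t ∧ realPrimitive f t = levelMajorant f t}

theorem isContactSet_contactSet (hf : f ∈ (coupleL1LevelLinfty 𝕜).sum) :
    IsContactSet (contactSet f) := by
  have H := isLeastConcaveMajorant_levelMajorant hf
  refine ⟨?_, ⟨le_rfl, ?_⟩, fun t ht => ht.1⟩
  · have h := (H.cont_left.continuousOn.sub H.cont).preimage_isClosed_of_isClosed isClosed_Ici
      (isClosed_singleton (x := (0 : ℝ)))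
    convert h using 1
    ext t
    exact and_congr_right fun _ => sub_eq_zero.symm
  · rw [realPrimitive_of_nonpos f le_rfl, levelMajorant_of_nonpos f le_rfl]

theorem lt_levelMajorant (hf : f ∈ (coupleL1LevelLinfty 𝕜).sum) {t : ℝ} (ht : 0 ≤ t)
    (htZ : t ∉ contactSet f) : realPrimitive f t < levelMajorant f t :=
  lt_of_le_of_ne (realPrimitive_le_levelMajorant hf t) fun h => htZ ⟨ht, h⟩

/-- At a contact point the difference of majorant and primitive has a minimum, so the two
derivatives agree wherever both exist. -/
theorem levelSlope_of_mem_contactSet (hf : f ∈ (coupleL1LevelLinfty 𝕜).sum) :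
    ∀ᵐ x ∂halfLine, x ∈ contactSet f → levelSlope f x = ‖f x‖ := by
  filter_upwards [ae_differentiableAt_levelMajorant hf, ae_hasDerivAt_realPrimitive hf,
    ae_restrict_mem measurableSet_Ioi] with x h1 h2 hx0 hx
  have h3 : IsLocalMin (fun t => levelMajorant f t - realPrimitive f t) x := by
    refine Eventually.of_forall fun t => ?_
    simp only
    rw [hx.2, sub_self]
    exact sub_nonneg.2 (realPrimitive_le_levelMajorant hf t)
  have h4 := h3.hasDerivAt_eq_zero (h1.hasDerivAt.sub h2)
  rw [levelSlope_eq f hx0 h1.hasDerivAt]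
  linarith

/-- On a bounded gap the majorant is the chord of the primitive between two contact points, whose
slope is the mean of `|f|` over the gap. -/
theorem levelSlope_of_mem_gap (hf : f ∈ (coupleL1LevelLinfty 𝕜).sum) {s : ℝ} (hs0 : 0 < s)
    (hs : s ∈ notBeyond (contactSet f)) (hsZ : s ∉ contactSet f) :
    levelSlope f s = (gapRight (contactSet f) s - gapLeft (contactSet f) s)⁻¹ *
      ∫ z in Ioo (gapLeft (contactSet f) s) (gapRight (contactSet f) s), ‖f z‖ := by
  have H := isLeastConcaveMajorant_levelMajorant hf
  have hZ := isContactSet_contactSet hf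
  set l := gapLeft (contactSet f) s with hl
  set r := gapRight (contactSet f) s with hr
  have hls : l < s := hZ.gapLeft_lt hs0.le hsZ
  have hsr : s < r := hZ.lt_gapRight hs hsZ
  have hl0 : 0 ≤ l := hZ.gapLeft_nonneg s
  have hlZ := (hZ.gapLeft_mem hs0.le).1
  have hrZ := (hZ.gapRight_mem hs).1
  have haff := fun t (ht : t ∈ Icc l r) => H.affine hl0 (hls.trans hsr)
    (fun u hu => lt_levelMajorant hf (hl0.trans hu.1.le) (notMem_of_mem_gap hu)) ht
  set m := (levelMajorant f r - levelMajorant f l) / (r - l) with hm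
  have hder : HasDerivAt (levelMajorant f) m s := by
    have h1 : HasDerivAt (fun t => levelMajorant f l + m * (t - l)) m s := by
      simpa using (((hasDerivAt_id s).sub_const l).const_mul m).const_add (levelMajorant f l)
    refine h1.congr_of_eventuallyEq ?_
    filter_upwards [Ioo_mem_nhds hls hsr] with t ht using haff t (Ioo_subset_Icc_self ht)
  rw [levelSlope_eq f hs0 hder, ← realPrimitive_sub hf hl0 (hls.trans hsr).le, hm, div_eq_inv_mul,
    show realPrimitive f r = levelMajorant f r from hrZ.2,
    show realPrimitive f l = levelMajorant f l from hlZ.2]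

/-- The modulus of an element of `L⁰`. -/
noncomputable def absL0 (f : L0 𝕜) : L0 𝕜 :=
  AEEqFun.mk (fun x => ((‖f x‖ : ℝ) : 𝕜))
    (RCLike.measurable_ofReal.comp f.stronglyMeasurable.measurable.norm).aestronglyMeasurable

theorem coeFn_absL0 (f : L0 𝕜) : ∀ᵐ x ∂halfLine, absL0 f x = ((‖f x‖ : ℝ) : 𝕜) :=
  AEEqFun.coeFn_mk _ _

theorem enorm_absL0 (f : L0 𝕜) : ∀ᵐ x ∂halfLine, ‖absL0 f x‖ₑ = ‖f x‖ₑ := by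
  filter_upwards [coeFn_absL0 f] with x hx
  rw [hx, enorm_ofReal_eq (norm_nonneg _), ofReal_norm]

theorem integral_absL0 (f : L0 𝕜) {s : Set ℝ} (hs : s ⊆ Ioi 0) :
    ∫ x in s, absL0 f x = ((∫ x in s, ‖f x‖ : ℝ) : 𝕜) := by
  rw [← integral_ofReal]
  exact integral_congr_ae (ae_restrict_of_subset_Ioi hs (coeFn_absL0 f))

/-- On an unbounded gap the slope of the majorant need not be the limit of all mean slopes of the
primitive, only their upper limit. Choosing intervals along which it is attained makes the limit
functional give the right value. Without such a gap any sequence will do. -/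
theorem exists_isMeanSequence (hf : f ∈ (coupleL1LevelLinfty 𝕜).sum) :
    ∃ (a : ℝ) (y : ℕ → ℝ), IsMeanSequence (contactSet f) a y ∧
      ∀ s, s ∉ notBeyond (contactSet f) →
        limAverage (fun n => Ioo a (y n)) (absL0 f) = ((levelSlope f s : ℝ) : 𝕜) := by
  have H := isLeastConcaveMajorant_levelMajorant hf
  have hZ := isContactSet_contactSet hf
  by_cases hb : ∃ s, s ∉ notBeyond (contactSet f)
  · obtain ⟨s₀, hs₀⟩ := hb
    have hbdd : BddAbove (contactSet f) := ⟨s₀, fun w hw => (not_le.1 fun h => hs₀ ⟨w, hw, h⟩).le⟩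
    set a := sSup (contactSet f) with ha
    have haZ : a ∈ contactSet f := hZ.closed.csSup_mem ⟨0, hZ.zero_mem⟩ hbdd
    have hgr : IsGreatest (contactSet f) a := ⟨haZ, fun w hw => le_csSup hbdd hw⟩
    have ha0 : 0 ≤ a := haZ.1
    obtain ⟨m, haff, hm⟩ := H.affine_unbounded ha0 fun t ht =>
      lt_levelMajorant hf (ha0.trans ht.le) fun h => absurd (hgr.2 h) (not_le.2 ht)
    choose y hyY hy using fun n : ℕ => hm (1 / ((n : ℝ) + 1)) (by positivity) (a + 1 + n)
    have hy1 : ∀ n, a + 1 ≤ y n := fun n => by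
      have := hyY n
      have : (0 : ℝ) ≤ n := n.cast_nonneg
      linarith
    refine ⟨a, y, ⟨ha0, hy1, ?_, fun _ _ => hgr⟩, fun s hs => ?_⟩
    · refine tendsto_atTop_mono (fun n => ?_) tendsto_natCast_atTop_atTop
      linarith [hyY n]
    · have has : a < s := not_le.1 fun h => hs ⟨a, haZ, h⟩
      have hder : HasDerivAt (levelMajorant f) m s := by
        have h1 : HasDerivAt (fun t => levelMajorant f a + m * (t - a)) m s := by
          simpa using (((hasDerivAt_id s).sub_const a).const_mul m).const_add (levelMajorant f a)
        refine h1.congr_of_eventuallyEq ?_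
        filter_upwards [Ioi_mem_nhds has] with t ht using haff t (le_of_lt ht)
      rw [levelSlope_eq f (ha0.trans_lt has) hder]
      refine limAverage_eq ?_
      have hval : ∀ n, ⨍ x in Ioo a (y n), absL0 f x =
          (((realPrimitive f (y n) - realPrimitive f a) / (y n - a) : ℝ) : 𝕜) := fun n => by
        have h1 := hy1 n
        rw [setAverage_eq, Real.volume_real_Ioo_of_le (by linarith),
          integral_absL0 f fun x hx => ha0.trans_lt hx.1, ← realPrimitive_sub hf ha0 (by linarith),
          RCLike.real_smul_eq_coe_mul, ← RCLike.ofReal_mul, div_eq_inv_mul]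
      simp only [hval]
      refine (RCLike.continuous_ofReal.tendsto m).comp ?_
      -- The lower bound is the choice of `y n`. The upper bound holds since the primitive lies
      -- below the majorant, which is affine with slope `m` from the contact point `a` on.
      refine tendsto_of_tendsto_of_tendsto_of_le_of_le
        (g := fun n : ℕ => m - 1 / ((n : ℝ) + 1)) (h := fun _ => m) ?_ tendsto_const_nhds
        (fun n => ?_) (fun n => ?_)
      · simpa using tendsto_const_nhds.sub (tendsto_one_div_add_atTop_nhds_zero_nat (𝕜 := ℝ))
      · simp only
        rw [le_div_iff₀ (by linarith [hy1 n])]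
        linarith [hy n]
      · simp only
        rw [div_le_iff₀ (by linarith [hy1 n]), haZ.2]
        have h1 := haff (y n) (by linarith [hy1 n])
        linarith [realPrimitive_le_levelMajorant hf (y n)]
  · push Not at hb
    refine ⟨0, fun n => n + 1, ⟨le_rfl, fun n => ?_, ?_, fun s hs => absurd (hb s) hs⟩,
      fun s hs => absurd (hb s) hs⟩
    · have : (0 : ℝ) ≤ n := n.cast_nonneg
      linarith
    · exact tendsto_atTop_add_const_right _ _ tendsto_natCast_atTop_atTop

/-- The level function of `f`, as an element of `L⁰`. -/
noncomputable def levelL0 (f : L0 𝕜) : L0 𝕜 :=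
  AEEqFun.mk (fun x => ((levelSlope f x : ℝ) : 𝕜))
    (RCLike.measurable_ofReal.comp (measurable_levelSlope f)).aestronglyMeasurable

theorem coeFn_levelL0 (f : L0 𝕜) : ∀ᵐ x ∂halfLine, levelL0 f x = ((levelSlope f x : ℝ) : 𝕜) :=
  AEEqFun.coeFn_mk _ _

theorem isDecreasing_levelL0 (hf : f ∈ (coupleL1LevelLinfty 𝕜).sum) :
    IsDecreasing (levelL0 f) :=
  ⟨levelSlope f, measurable_levelSlope f, antitoneOn_levelSlope hf, levelSlope_nonneg hf,
    coeFn_levelL0 f⟩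

theorem levelL0_eq_levelFunction (hf : f ∈ (coupleL1LevelLinfty 𝕜).sum) :
    ∀ᵐ x ∂halfLine, levelL0 f x = (((levelFunction fun y => ‖f y‖ₑ) x).toReal : 𝕜) := by
  filter_upwards [coeFn_levelL0 f, levelFunction_eq_levelSlope hf] with x h1 h2
  rw [h1, h2]

/-- Pass from `f` to `|f|` by a unimodular multiplier, then average over the gaps of the contact set
of `f`. -/
theorem isImage_levelL0 (hf : f ∈ (coupleL1LevelLinfty 𝕜).sum) :
    IsImage 1 (coupleL1LevelLinfty 𝕜) (coupleL1LevelLinfty 𝕜) f (levelL0 f) := by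
  have h1 : IsImage 1 (coupleL1LevelLinfty 𝕜) (coupleL1LevelLinfty 𝕜) f (absL0 f) :=
    isImage_of_enorm_le solid_level hf ((enorm_absL0 f).mono fun _ hx => hx.le)
  obtain ⟨a, y, hy, hlim⟩ := exists_isMeanSequence hf
  have hZ := isContactSet_contactSet hf
  have h2 : IsImage 1 (coupleL1LevelLinfty 𝕜) (coupleL1LevelLinfty 𝕜) (absL0 f) (levelL0 f) := by
    refine isImage_gapAverage hZ hy h1.mem_right ?_
    filter_upwards [coeFn_levelL0 f, coeFn_absL0 f, levelSlope_of_mem_contactSet hf,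
      ae_restrict_mem measurableSet_Ioi] with s h1 h2 h3 hs0
    rw [h1, gapAverage]
    split_ifs with hs hs'
    · rw [h2, h3 hs]
    · rw [integral_absL0 f fun x hx => (hZ.gapLeft_nonneg s).trans_lt hx.1, ← RCLike.ofReal_mul,
        levelSlope_of_mem_gap hf hs0 hs' hs]
    · exact (hlim s hs').symm
  simpa using h1.trans h2

theorem levelL0_mem_sum (hf : f ∈ (coupleL1LevelLinfty 𝕜).sum) :
    levelL0 f ∈ (coupleL1LevelLinfty 𝕜).sum := (isImage_levelL0 hf).mem_right

/-- The primitive of the level function is a majorant of that of `|f|`, so transport to the right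
applies. -/
theorem isImage_of_levelL0 (hf : f ∈ (coupleL1LevelLinfty 𝕜).sum) :
    IsImage 1 (coupleL1LevelLinfty 𝕜) (coupleL1LevelLinfty 𝕜) (levelL0 f) f := by
  refine isImage_of_lintegral_le (levelL0_mem_sum hf) hf fun t ht => ?_
  rw [← ofReal_realPrimitive hf]
  refine (ENNReal.ofReal_le_ofReal (realPrimitive_le_levelMajorant hf t)).trans ?_
  rw [← lintegral_levelSlope hf (by exact_mod_cast ht)]
  refine le_of_eq (lintegral_congr_ae ?_)
  filter_upwards [ae_Ioo (coeFn_levelL0 f) t] with x hx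
  rw [hx, enorm_ofReal_eq (levelSlope_nonneg hf x)]

end LevelFunctions

/-! ### Transfer between functions of equal distribution -/

section Transfer

open CompatibleCouple ProbabilityTheory

/-- The masses of `(s, ∞)` are finite for `s > c` but may blow up as `s` decreases to `c`. Equality
is therefore checked on an exhausting sequence of sets of finite measure that stay away from `c`, up
to the null set `Iic c`. -/
theorem map_eq_of_distribution_eq {m₁ m₂ : Measure ℝ} {c : ℝ} (h₁ : m₁ (Iic c) = 0)
    (h₂ : m₂ (Iic c) = 0) (h : ∀ s, c < s → m₁ (Ioi s) = m₂ (Ioi s))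
    (hfin : ∀ s, c < s → m₁ (Ioi s) ≠ ∞) : m₁ = m₂ ∧ SigmaFinite m₁ := by
  let s : ℕ → ℝ := fun n => c + 1 / ((n : ℝ) + 1)
  have hs : ∀ n, c < s n := fun n => lt_add_of_pos_right _ (by positivity)
  let S : ℕ → Set ℝ := fun n => Iic c ∪ Ioi (s n)
  have hSm : ∀ n, MeasurableSet (S n) := fun n => measurableSet_Iic.union measurableSet_Ioi
  have hSu : ⋃ n, S n = univ := by
    refine eq_univ_of_forall fun x => mem_iUnion.2 ?_
    rcases le_or_gt x c with hx | hx
    · exact ⟨0, Or.inl hx⟩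
    · obtain ⟨n, hn⟩ := exists_nat_one_div_lt (sub_pos.2 hx)
      exact ⟨n, Or.inr (show c + 1 / ((n : ℝ) + 1) < x by linarith)⟩
  have hSf : ∀ n, m₁ (S n) < ∞ := fun n => by
    refine (measure_union_le _ _).trans_lt ?_
    rw [h₁, zero_add]
    exact lt_top_iff_ne_top.2 (hfin _ (hs n))
  have key : ∀ (m : Measure ℝ), m (Iic c) = 0 → (∀ s, c < s → m (Ioi s) ≠ ∞) → ∀ n a,
      m.restrict (S n) (Iic a) = if a < s n then 0 else m (Ioi (s n)) - m (Ioi a) := by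
    intro m hm hmf n a
    rw [Measure.restrict_apply measurableSet_Iic]
    split_ifs with ha
    · refine measure_mono_null ?_ hm
      rintro x ⟨hx, hx' | hx'⟩
      · exact hx'
      · exact absurd (lt_trans hx' (lt_of_le_of_lt hx ha)) (lt_irrefl _)
    · have ha' : s n ≤ a := not_lt.1 ha
      rw [← measure_sdiff (Ioi_subset_Ioi ha') measurableSet_Ioi.nullMeasurableSet
        (hmf a ((hs n).trans_le ha'))]
      refine measure_congr ?_
      have hnull : ∀ᵐ x ∂m, x ∉ Iic c := measure_eq_zero_iff_ae_notMem.1 hm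
      filter_upwards [hnull] with x hx
      refine propext ⟨fun h' => ?_, fun h' => ?_⟩
      · rcases h' with ⟨h1, h2 | h2⟩
        · exact absurd h2 hx
        · exact ⟨h2, fun h3 => not_lt_of_ge (mem_Iic.1 h1) (mem_Ioi.1 h3)⟩
      · exact ⟨mem_Iic.2 (le_of_not_gt fun h3 => h'.2 (mem_Ioi.2 h3)), Or.inr h'.1⟩
  refine ⟨(Measure.ext_iff_of_iUnion_eq_univ hSu).2 fun n => ?_,
    ⟨⟨⟨S, fun _ => trivial, hSf, hSu⟩⟩⟩⟩
  have : IsFiniteMeasure (m₁.restrict (S n)) := ⟨by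
    rw [Measure.restrict_apply_univ]; exact hSf n⟩
  refine Measure.ext_of_Iic _ _ fun a => ?_
  rw [key m₁ h₁ hfin, key m₂ h₂ (fun s hs => h s hs ▸ hfin s hs)]
  split_ifs with ha
  · rfl
  · rw [h _ (hs n), h a ((hs n).trans_le (not_lt.1 ha))]

/-- Disintegration over the common law of `u` and `v`. -/
theorem exists_transfer_kernel {m₁ m₂ : Measure ℝ} {u v : ℝ → ℝ} (hu : Measurable u)
    (hv : Measurable v) (h : Measure.map u m₁ = Measure.map v m₂)
    (hσ : SigmaFinite (Measure.map u m₁)) :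
    ∃ κ : Kernel ℝ ℝ, IsMarkovKernel κ ∧ ∀ φ : ℝ × ℝ → ℝ≥0∞, Measurable φ →
      ∫⁻ t, ∫⁻ z, φ (v t, z) ∂κ (v t) ∂m₂ = ∫⁻ z, φ (u z, z) ∂m₁ := by
  -- The common law is only σ-finite, while disintegration is applied to a finite measure. A
  -- positive weight `W` depending only on the value of `u` makes the measure finite and cancels
  -- after conditioning on that value.
  obtain ⟨W, hW0, hWm, hW⟩ := exists_pos_lintegral_lt_of_sigmaFinite (Measure.map u m₁)
    one_ne_zero
  have hWm' : Measurable fun s => (W s : ℝ≥0∞) := hWm.coe_nnreal_ennreal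
  have hWu : Measurable fun z => (W (u z) : ℝ≥0∞) := hWm'.comp hu
  have hfin : IsFiniteMeasure (m₁.withDensity fun z => (W (u z) : ℝ≥0∞)) := by
    refine isFiniteMeasure_withDensity ?_
    rw [lintegral_map hWm' hu] at hW
    exact (hW.trans ENNReal.one_lt_top).ne
  have hum : Measurable fun z => (u z, z) := hu.prodMk measurable_id
  set ρ := Measure.map (fun z => (u z, z)) (m₁.withDensity fun z => (W (u z) : ℝ≥0∞)) with hρ
  have hρint : ∀ ψ : ℝ × ℝ → ℝ≥0∞, Measurable ψ →
      ∫⁻ q, ψ q ∂ρ = ∫⁻ z, W (u z) * ψ (u z, z) ∂m₁ := fun ψ hψ => by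
    rw [hρ, lintegral_map hψ hum]
    exact lintegral_withDensity_eq_lintegral_mul _ hWu (hψ.comp hum)
  refine ⟨ρ.condKernel, inferInstance, fun φ hφ => ?_⟩
  have hψ : Measurable fun q : ℝ × ℝ => φ q * (W q.1 : ℝ≥0∞)⁻¹ :=
    hφ.mul (hWm'.comp measurable_fst).inv
  have hcancel : ∀ (s : ℝ) (r : ℝ≥0∞), (W s : ℝ≥0∞) * (r * (W s : ℝ≥0∞)⁻¹) = r := fun s r => by
    rw [mul_left_comm, ENNReal.mul_inv_cancel (by exact_mod_cast (hW0 s).ne') ENNReal.coe_ne_top,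
      mul_one]
  have hΘ : Measurable fun s => ∫⁻ z, φ (s, z) ∂ρ.condKernel s := hφ.lintegral_kernel_prod_right'
  have hinner : ∀ s, ∫⁻ z, φ (s, z) * (W s : ℝ≥0∞)⁻¹ ∂ρ.condKernel s =
      (∫⁻ z, φ (s, z) ∂ρ.condKernel s) * (W s : ℝ≥0∞)⁻¹ := fun s =>
    lintegral_mul_const _ (hφ.comp measurable_prodMk_left)
  have hΘW : Measurable fun s => (∫⁻ z, φ (s, z) ∂ρ.condKernel s) * (W s : ℝ≥0∞)⁻¹ :=
    hΘ.mul hWm'.inv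
  calc ∫⁻ t, ∫⁻ z, φ (v t, z) ∂ρ.condKernel (v t) ∂m₂
      = ∫⁻ s, ∫⁻ z, φ (s, z) ∂ρ.condKernel s ∂Measure.map u m₁ := by
        rw [h, lintegral_map hΘ hv]
    _ = ∫⁻ z, W (u z) * ((∫⁻ z', φ (u z, z') ∂ρ.condKernel (u z)) * (W (u z) : ℝ≥0∞)⁻¹) ∂m₁ := by
        rw [lintegral_map hΘ hu]
        simp only [hcancel]
    _ = ∫⁻ q, (∫⁻ z', φ (q.1, z') ∂ρ.condKernel q.1) * (W q.1 : ℝ≥0∞)⁻¹ ∂ρ :=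
        (hρint _ (hΘW.comp measurable_fst)).symm
    _ = ∫⁻ s, (∫⁻ z', φ (s, z') ∂ρ.condKernel s) * (W s : ℝ≥0∞)⁻¹ ∂ρ.fst := by
        rw [Measure.fst, lintegral_map hΘW measurable_fst]
    _ = ∫⁻ q, φ q * (W q.1 : ℝ≥0∞)⁻¹ ∂ρ := by
        rw [← Measure.lintegral_condKernel hψ]
        simp only [hinner]
    _ = ∫⁻ z, φ (u z, z) ∂m₁ := by
        rw [hρint _ hψ]
        simp only [hcancel]

variable {𝕜 : Type*} [RCLike 𝕜]

/-- Truncating a set of infinite measure to a long enough bounded interval gives finite measure as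
large as wanted. -/
theorem exists_meanSets {u : ℝ → ℝ} (hu : Measurable u) {c : ℝ}
    (hc : ∀ ε, 0 < ε → halfLine {x | |u x - c| ≤ ε} = ∞) :
    ∃ B : ℕ → Set ℝ, ∀ n, MeasurableSet (B n) ∧ B n ⊆ Ioi 0 ∧ volume (B n) ≠ ∞ ∧
      (n : ℝ) + 1 ≤ volume.real (B n) ∧ ∀ x ∈ B n, |u x - c| ≤ 1 / ((n : ℝ) + 1) := by
  have : ∀ n : ℕ, ∃ B : Set ℝ, MeasurableSet B ∧ B ⊆ Ioi 0 ∧ volume B ≠ ∞ ∧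
      (n : ℝ) + 1 ≤ volume.real B ∧ ∀ x ∈ B, |u x - c| ≤ 1 / ((n : ℝ) + 1) := by
    intro n
    set S := {x | |u x - c| ≤ 1 / ((n : ℝ) + 1)} with hS
    have hSm : MeasurableSet S := measurableSet_le (hu.sub_const c).norm measurable_const
    have h1 : volume (⋃ k : ℕ, S ∩ Ioo (0 : ℝ) (k + 1)) = ∞ := by
      rw [← inter_iUnion, ← Ioi_eq_iUnion_Ioo, ← Measure.restrict_apply hSm]
      exact hc _ (by positivity)
    have hmono : Monotone fun k : ℕ => S ∩ Ioo (0 : ℝ) (k + 1) := fun k l hkl =>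
      inter_subset_inter_right _ (Ioo_subset_Ioo_right (by
        have : (k : ℝ) ≤ l := by exact_mod_cast hkl
        linarith))
    rw [hmono.measure_iUnion] at h1
    obtain ⟨k, hk⟩ := lt_iSup_iff.1 (h1 ▸ ENNReal.ofReal_lt_top :
      ENNReal.ofReal ((n : ℝ) + 1) < ⨆ k : ℕ, volume (S ∩ Ioo (0 : ℝ) (k + 1)))
    have hfin : volume (S ∩ Ioo (0 : ℝ) (k + 1)) ≠ ∞ :=
      ne_top_of_le_ne_top (by simp) (measure_mono inter_subset_right)
    refine ⟨S ∩ Ioo (0 : ℝ) (k + 1), hSm.inter measurableSet_Ioo, fun x hx => hx.2.1, hfin, ?_,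
      fun x hx => hx.1⟩
    exact (ENNReal.ofReal_le_iff_le_toReal hfin).1 hk.le
  choose B hB using this
  exact ⟨B, hB⟩

theorem norm_le_of_Linfty {h : L0 𝕜} (hh : (lebesgue 𝕜 ∞ le_top).nrm h < ∞) :
    ∀ᵐ x ∂halfLine, ‖h x‖ ≤ ((lebesgue 𝕜 ∞ le_top).nrm h).toReal := by
  filter_upwards [(nrm_Linfty_le_iff h _).1 le_rfl] with x hx
  rw [← toReal_enorm]
  exact ENNReal.toReal_mono hh.ne hx

/-- A functional on `L¹ + L^∞` of norm at most one that vanishes on `L¹` and takes at `U` the value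
`c`, if `U` is close to `c` on sets of infinite measure. -/
theorem exists_limit_functional {u : ℝ → ℝ} (hu : Measurable u) {c : ℝ}
    (hc : ∀ ε, 0 < ε → halfLine {x | |u x - c| ≤ ε} = ∞) {U : L0 𝕜}
    (hU : ∀ᵐ x ∂halfLine, U x = (u x : 𝕜)) :
    ∃ Λ : L0 𝕜 → 𝕜,
      (∀ h ∈ (coupleL1Linfty 𝕜).sum, ∀ k ∈ (coupleL1Linfty 𝕜).sum, Λ (h + k) = Λ h + Λ k) ∧
      (∀ (r : 𝕜), ∀ h ∈ (coupleL1Linfty 𝕜).sum, Λ (r • h) = r * Λ h) ∧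
      (∀ h, (lebesgue 𝕜 1 le_rfl).nrm h < ∞ → Λ h = 0) ∧
      (∀ h, (lebesgue 𝕜 ∞ le_top).nrm h < ∞ → ‖Λ h‖ₑ ≤ (lebesgue 𝕜 ∞ le_top).nrm h) ∧
      Λ U = (c : 𝕜) := by
  obtain ⟨B, hB⟩ := exists_meanSets hu hc
  have hBs : ∀ n, B n ⊆ Ioi 0 := fun n => (hB n).2.1
  have hvol : ∀ n : ℕ, (n : ℝ) + 1 ≤ volume.real (B n) := fun n => (hB n).2.2.2.1
  have hvol1 : ∀ n, 1 ≤ volume.real (B n) := fun n => by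
    have : (0 : ℝ) ≤ n := n.cast_nonneg
    linarith [hvol n]
  have hvol' : Tendsto (fun n => volume.real (B n)) atTop atTop :=
    tendsto_atTop_mono (fun n => by linarith [hvol n]) tendsto_natCast_atTop_atTop
  have hinteg : ∀ n (h : L0 𝕜), (lebesgue 𝕜 ∞ le_top).nrm h < ∞ → IntegrableOn h (B n) := by
    intro n h hh
    refine Measure.integrableOn_of_bounded (hB n).2.2.1
      h.stronglyMeasurable.aestronglyMeasurable
      (M := ((lebesgue 𝕜 ∞ le_top).nrm h).toReal) ?_
    exact ae_restrict_of_subset_Ioi (hBs n) (norm_le_of_Linfty hh)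
  have havg : ∀ n (h : L0 𝕜), (lebesgue 𝕜 ∞ le_top).nrm h < ∞ →
      ⨍ x in B n, ‖h x‖ ≤ ((lebesgue 𝕜 ∞ le_top).nrm h).toReal := by
    intro n h hh
    have hpos : 0 < volume.real (B n) := by linarith [hvol1 n]
    rw [setAverage_eq, smul_eq_mul, inv_mul_le_iff₀ hpos]
    have h1 := integral_mono_ae (μ := volume.restrict (B n)) (hinteg n h hh).norm
      (integrableOn_const (hB n).2.2.1 (C := ((lebesgue 𝕜 ∞ le_top).nrm h).toReal))
      (ae_restrict_of_subset_Ioi (hBs n) (norm_le_of_Linfty hh))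
    rwa [setIntegral_const, smul_eq_mul] at h1
  have hbI : ∀ h : L0 𝕜, (lebesgue 𝕜 ∞ le_top).nrm h < ∞ → HasBoundedAverages B h := fun h hh =>
    ⟨fun n => hinteg n h hh, _, fun n => havg n h hh⟩
  have hb : ∀ h ∈ (coupleL1Linfty 𝕜).sum, HasBoundedAverages B h := by
    intro h hh
    obtain ⟨a, b, ha, hb', rfl⟩ := mem_sum_iff.1 hh
    exact (hasBoundedAverages_of_L1 hBs hvol1 ha).add hBs (hbI b hb')
  refine ⟨limAverage B, fun h hh k hk => limAverage_add hBs (hb h hh) (hb k hk),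
    fun r h hh => limAverage_smul hBs r (hb h hh), fun h hh => limAverage_of_L1 hBs hvol1 hvol' hh,
    fun h hh => ?_, limAverage_eq ?_⟩
  · rw [← ofReal_norm, ENNReal.ofReal_le_iff_le_toReal hh.ne]
    exact norm_limAverage_le (hbI h hh) (fun n => havg n h hh) tendsto_const_nhds
  · have hval : ∀ n, ⨍ x in B n, U x = ((⨍ x in B n, u x : ℝ) : 𝕜) := fun n => by
      rw [setAverage_eq, setAverage_eq, RCLike.real_smul_eq_coe_mul, smul_eq_mul,
        RCLike.ofReal_mul, ← integral_ofReal]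
      congr 1
      exact integral_congr_ae (ae_restrict_of_subset_Ioi (hBs n) hU)
    simp only [hval]
    refine (RCLike.continuous_ofReal.tendsto c).comp ?_
    refine tendsto_iff_norm_sub_tendsto_zero.2 (squeeze_zero (fun _ => norm_nonneg _)
      (fun n => ?_) (tendsto_one_div_add_atTop_nhds_zero_nat (𝕜 := ℝ)))
    have hpos : 0 < volume.real (B n) := by linarith [hvol1 n]
    have huint : IntegrableOn u (B n) := by
      refine Measure.integrableOn_of_bounded (hB n).2.2.1 hu.aestronglyMeasurable
        (M := 1 / ((n : ℝ) + 1) + |c|) ?_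
      filter_upwards [ae_restrict_mem (hB n).1] with x hx
      have h1 := (hB n).2.2.2.2 x hx
      calc ‖u x‖ = |(u x - c) + c| := by rw [sub_add_cancel, Real.norm_eq_abs]
        _ ≤ |u x - c| + |c| := abs_add_le _ _
        _ ≤ _ := by linarith
    have h2 : (⨍ x in B n, u x) - c = (volume.real (B n))⁻¹ * ∫ x in B n, (u x - c) := by
      rw [integral_sub huint (integrableOn_const (hB n).2.2.1), setIntegral_const, setAverage_eq,
        smul_eq_mul, smul_eq_mul, mul_sub, ← mul_assoc, inv_mul_cancel₀ hpos.ne', one_mul]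
    rw [h2, norm_mul, norm_inv, Real.norm_of_nonneg hpos.le, inv_mul_le_iff₀ hpos]
    have h3 := norm_setIntegral_le_of_norm_le_const (μ := volume) (s := B n)
      (f := fun x => u x - c) (C := 1 / ((n : ℝ) + 1)) (lt_top_iff_ne_top.2 (hB n).2.2.1)
      (fun x hx => (hB n).2.2.2.2 x hx)
    linarith

/-- Two functions with the same distribution above the level `c`, the first of which is close to
`c` on sets of infinite measure while the second is arbitrary below `c`. -/
theorem isImage_of_distribution_eq {u v : ℝ → ℝ} (hu : Measurable u) (hv : Measurable v)
    (hv0 : ∀ x, 0 ≤ v x) {c : ℝ} (hc0 : 0 ≤ c)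
    (hc : ∀ ε, 0 < ε → halfLine {x | |u x - c| ≤ ε} = ∞)
    (hdist : ∀ s, c < s → halfLine {x | s < u x} = halfLine {x | s < v x})
    (hfin : ∀ s, c < s → halfLine {x | s < u x} ≠ ∞) {U V : L0 𝕜}
    (hU : ∀ᵐ x ∂halfLine, U x = (u x : 𝕜)) (hV : ∀ᵐ x ∂halfLine, V x = (v x : 𝕜))
    (hUs : U ∈ (coupleL1Linfty 𝕜).sum) :
    IsImage 1 (coupleL1Linfty 𝕜) (coupleL1Linfty 𝕜) U V := by
  classical
  obtain ⟨Λ, hΛadd, hΛsmul, hΛ1, hΛi, hΛU⟩ := exists_limit_functional hu hc hU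
  have hA : MeasurableSet {x | c < u x} := measurableSet_lt measurable_const hu
  have hA' : MeasurableSet {x | c < v x} := measurableSet_lt measurable_const hv
  set m₁ := halfLine.restrict {x | c < u x} with hm₁
  set m₂ := halfLine.restrict {x | c < v x} with hm₂
  have hIoi : ∀ (w : ℝ → ℝ), Measurable w → ∀ s, c < s →
      Measure.map w (halfLine.restrict {x | c < w x}) (Ioi s) = halfLine {x | s < w x} := by
    intro w hw s hs
    rw [Measure.map_apply hw measurableSet_Ioi, Measure.restrict_apply (hw measurableSet_Ioi)]
    congr 1
    ext x
    exact ⟨fun h => h.1, fun h => ⟨h, hs.trans h⟩⟩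
  have hIic : ∀ (w : ℝ → ℝ), Measurable w →
      Measure.map w (halfLine.restrict {x | c < w x}) (Iic c) = 0 := by
    intro w hw
    rw [Measure.map_apply hw measurableSet_Iic, Measure.restrict_apply (hw measurableSet_Iic)]
    convert measure_empty (μ := halfLine)
    ext x
    simp only [mem_inter_iff, mem_preimage, mem_Iic, mem_ofPred_eq, mem_empty_iff_false, iff_false]
    rintro ⟨h1, h2⟩
    linarith
  obtain ⟨hmap, hσ⟩ := map_eq_of_distribution_eq (hIic u hu) (hIic v hv)
    (fun s hs => by rw [hIoi u hu s hs, hIoi v hv s hs, hdist s hs])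
    (fun s hs => by rw [hIoi u hu s hs]; exact hfin s hs)
  obtain ⟨κ, hκ, hφ⟩ := exists_transfer_kernel hu hv hmap hσ
  have hm₁le : ∀ {P : ℝ → Prop}, (∀ᵐ x ∂halfLine, P x) → ∀ᵐ x ∂m₁, P x := fun h =>
    ae_restrict_of_ae h
  -- The transfer identity, applied to the indicator of `N`, shows that null sets of the source are
  -- negligible for almost every kernel measure.
  have htrans : ∀ N : Set (ℝ × ℝ), MeasurableSet N → (∀ᵐ z ∂m₁, (u z, z) ∉ N) →
      ∀ᵐ t ∂m₂, ∀ᵐ z ∂κ (v t), (v t, z) ∉ N := by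
    intro N hN hN0
    have h1 := hφ (N.indicator 1) (measurable_one.indicator hN)
    have h2 : ∫⁻ z, N.indicator (1 : ℝ × ℝ → ℝ≥0∞) (u z, z) ∂m₁ = 0 := by
      rw [← lintegral_zero (μ := m₁)]
      refine lintegral_congr_ae ?_
      filter_upwards [hN0] with z hz using indicator_of_notMem hz _
    have hmeas : Measurable fun s => ∫⁻ z, N.indicator (1 : ℝ × ℝ → ℝ≥0∞) (s, z) ∂κ s :=
      (measurable_one.indicator hN).lintegral_kernel_prod_right'
    rw [h2] at h1
    filter_upwards [(lintegral_eq_zero_iff (hmeas.comp hv)).1 h1] with t ht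
    have h3 := (lintegral_eq_zero_iff
      ((measurable_one.indicator hN).comp measurable_prodMk_left)).1 ht
    filter_upwards [h3] with z hz hzN
    simp [hzN] at hz
  have htransP : ∀ {P : ℝ → Prop}, (∀ᵐ x ∂halfLine, P x) →
      ∀ᵐ t ∂m₂, ∀ᵐ z ∂κ (v t), P z := by
    intro P hP
    obtain ⟨N, hPN, hNm, hN0⟩ := exists_measurable_superset_of_null (ae_iff.1 (hm₁le hP))
    filter_upwards [htrans (Prod.snd ⁻¹' N) (measurable_snd hNm)
      (measure_eq_zero_iff_ae_notMem.1 hN0)] with t ht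
    filter_upwards [ht] with z hz
    by_contra hc
    exact hz (hPN hc)
  -- The kernel measure at `v t` lives on the fibre where `u` equals `v t`; averaging `U` over it
  -- thus returns `v t`.
  have huv : ∀ᵐ t ∂m₂, ∀ᵐ z ∂κ (v t), u z = v t := by
    have hN : MeasurableSet {q : ℝ × ℝ | u q.2 ≠ q.1} :=
      (measurableSet_eq_fun (hu.comp measurable_snd) measurable_fst).compl
    filter_upwards [htrans _ hN (ae_of_all _ fun z hz => hz rfl)] with t ht
    filter_upwards [ht] with z hz
    exact not_not.1 hz
  have hL1 : ∀ h : L0 𝕜, ∫⁻ t, ∫⁻ z, ‖h z‖ₑ ∂κ (v t) ∂m₂ ≤ ∫⁻ z in Ioi 0, ‖h z‖ₑ := by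
    intro h
    rw [hφ (fun q => ‖h q.2‖ₑ) (h.stronglyMeasurable.measurable.enorm.comp measurable_snd)]
    exact lintegral_mono' Measure.restrict_le_self le_rfl
  have hinteg : ∀ h ∈ (coupleL1Linfty 𝕜).sum, ∀ᵐ t ∂m₂, Integrable h (κ (v t)) := by
    intro h hh
    obtain ⟨a, b, ha, hb, rfl⟩ := mem_sum_iff.1 hh
    have hmeas : Measurable fun t => ∫⁻ z, ‖a z‖ₑ ∂κ (v t) :=
      (a.stronglyMeasurable.measurable.enorm.lintegral_kernel).comp hv
    have ha' : ∀ᵐ t ∂m₂, ∫⁻ z, ‖a z‖ₑ ∂κ (v t) < ∞ := by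
      refine ae_lt_top hmeas (ne_top_of_le_ne_top ?_ (hL1 a))
      rw [← nrm_L1]
      exact ha.ne
    filter_upwards [ha', htransP (norm_le_of_Linfty hb), htransP (AEEqFun.coeFn_add a b)]
      with t h1 h2 h3
    have hia : Integrable a (κ (v t)) := ⟨a.stronglyMeasurable.aestronglyMeasurable, h1⟩
    have hib : Integrable b (κ (v t)) :=
      Integrable.of_bound b.stronglyMeasurable.aestronglyMeasurable _ h2
    exact (hia.add hib).congr (h3.mono fun z hz => hz.symm)
  have hpull : ∀ {P : ℝ → Prop}, (∀ᵐ t ∂m₂, P t) → ∀ᵐ t ∂halfLine, c < v t → P t := fun h =>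
    (ae_restrict_iff' hA').1 h
  -- Above the level `c`, average over the fibre of `u` with the same value. Below it, multiply by
  -- `v / c ≤ 1` a functional that vanishes on `L¹` and takes the value `c` at `U`.
  let T : L0 𝕜 → ℝ → 𝕜 := fun h t =>
    if c < v t then ∫ z, h z ∂κ (v t) else ((v t / c : ℝ) : 𝕜) * Λ h
  have hm : ∀ h : L0 𝕜, Measurable (T h) := fun h =>
    Measurable.ite hA' ((h.stronglyMeasurable.integral_kernel (κ := κ)).measurable.comp hv)
      ((RCLike.measurable_ofReal.comp (hv.div_const c)).mul_const _)
  refine isImage_of_fun T (fun h _ => (hm h).aestronglyMeasurable) (fun h hh k hk => ?_)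
    (fun r h hh => ?_) (fun h k hh hk => ?_) (fun h k hh hk => ?_) hUs ?_
  · filter_upwards [hpull (hinteg h hh), hpull (hinteg k hk), hpull (htransP (AEEqFun.coeFn_add h k))]
      with t h1 h2 h3
    simp only [T]
    split_ifs with ht
    · rw [← integral_add (h1 ht) (h2 ht)]
      exact integral_congr_ae (h3 ht)
    · rw [hΛadd h hh k hk, mul_add]
  · filter_upwards [hpull (htransP (AEEqFun.coeFn_smul r h))] with t h1
    simp only [T]
    split_ifs with ht
    · rw [← integral_const_mul]
      exact integral_congr_ae (h1 ht)
    · rw [hΛsmul r h hh]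
      ring
  · rw [ENNReal.coe_one, one_mul]
    refine (nrm_L1 k).trans_le (le_trans ?_ (nrm_L1 h).ge)
    refine le_trans ?_ (hL1 h)
    rw [hm₂, ← lintegral_indicator hA']
    refine lintegral_mono_ae ?_
    filter_upwards [hk] with t ht
    rw [ht]
    by_cases hct : c < v t
    · rw [indicator_of_mem (show t ∈ {x | c < v x} from hct)]
      simp only [T, if_pos hct]
      exact enorm_integral_le_lintegral_enorm _
    · simp only [T, if_neg hct]
      rw [hΛ1 h hh, mul_zero, enorm_zero]
      exact zero_le
  · rw [ENNReal.coe_one, one_mul]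
    refine (nrm_Linfty_le_iff k _).2 ?_
    filter_upwards [hk, hpull (htransP ((nrm_Linfty_le_iff h _).1 le_rfl))] with t ht h1
    rw [ht]
    by_cases hct : c < v t
    · simp only [T, if_pos hct]
      refine (enorm_integral_le_lintegral_enorm _).trans ((lintegral_mono_ae (h1 hct)).trans ?_)
      rw [lintegral_const, measure_univ, mul_one]
      exact le_rfl
    · simp only [T, if_neg hct]
      rw [enorm_mul, enorm_ofReal_eq (div_nonneg (hv0 t) hc0)]
      refine (mul_le_of_le_one_left' ?_).trans (hΛi h hh)
      rw [ENNReal.ofReal_le_one]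
      exact div_le_one_of_le₀ (not_lt.1 hct) hc0
  · filter_upwards [hV, hpull huv, hpull (htransP hU)] with t h1 h2 h3
    rw [h1]
    by_cases hct : c < v t
    · simp only [T, if_pos hct]
      rw [integral_congr_ae (g := fun _ => (v t : 𝕜))]
      · simp
      · filter_upwards [h2 hct, h3 hct] with z hz hz'
        rw [hz', hz]
    · simp only [T, if_neg hct]
      rw [hΛU, ← RCLike.ofReal_mul]
      congr 1
      -- For `c = 0` the quotient defaults to zero, and so does `v t`, being nonnegative and at most
      -- `c`.
      rcases hc0.eq_or_lt with h0 | h0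
      · have : v t = 0 := le_antisymm (by rw [h0]; exact not_lt.1 hct) (hv0 t)
        rw [this, zero_div, zero_mul]
      · rw [div_mul_cancel₀ _ h0.ne']

end Transfer

/-! ### The decreasing rearrangement -/

section Rearrangement

open CompatibleCouple

/-- The distribution function of `u` on the half line. -/
noncomputable def distribution (u : ℝ → ℝ) (s : ℝ) : ℝ≥0∞ := halfLine {x | s < u x}

theorem antitone_distribution (u : ℝ → ℝ) : Antitone (distribution u) := fun _ _ hst =>
  measure_mono fun _ hx => lt_of_le_of_lt hst hx

/-- The infimum of the levels above which `u` lives on a set of finite measure. -/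
noncomputable def essLimit (u : ℝ → ℝ) : ℝ := sInf {s | distribution u s ≠ ∞}

open Classical in
/-- The decreasing rearrangement of `u`. -/
noncomputable def rearrangement (u : ℝ → ℝ) (t : ℝ) : ℝ :=
  -- For nonnegative `u` the distribution is infinite below `essLimit u`, so the first condition
  -- excludes nothing; it keeps the set bounded below without a sign hypothesis.
  if 0 < t then sInf {s | essLimit u ≤ s ∧ distribution u s ≤ ENNReal.ofReal t} else 0

/-- The distribution function of `u` is eventually arbitrarily small. -/
def VanishesAtTop (u : ℝ → ℝ) : Prop :=
  ∀ t : ℝ, 0 < t → ∃ s, distribution u s ≤ ENNReal.ofReal t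

variable {u : ℝ → ℝ}

theorem distribution_of_neg (hu0 : ∀ x, 0 ≤ u x) {s : ℝ} (hs : s < 0) :
    distribution u s = ∞ := by
  have : {x | s < u x} = univ := eq_univ_of_forall fun x => hs.trans_le (hu0 x)
  rw [distribution, this, Measure.restrict_apply_univ, Real.volume_Ioi]

theorem bddBelow_finite_levels (hu0 : ∀ x, 0 ≤ u x) : BddBelow {s | distribution u s ≠ ∞} :=
  ⟨0, fun _ hs => not_lt.1 fun h => hs (distribution_of_neg hu0 h)⟩

theorem essLimit_nonneg (hu0 : ∀ x, 0 ≤ u x) : 0 ≤ essLimit u :=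
  Real.sInf_nonneg fun _ hs => not_lt.1 fun h => hs (distribution_of_neg hu0 h)

theorem distribution_of_lt_essLimit (hu0 : ∀ x, 0 ≤ u x) {s : ℝ} (hs : s < essLimit u) :
    distribution u s = ∞ := by
  by_contra h
  exact notMem_of_lt_csInf hs (bddBelow_finite_levels hu0) h

theorem distribution_ne_top (hv : VanishesAtTop u) {s : ℝ} (hs : essLimit u < s) :
    distribution u s ≠ ∞ := by
  obtain ⟨s₀, hs₀⟩ := hv 1 one_pos
  obtain ⟨r, hr, hrs⟩ := exists_lt_of_csInf_lt
    ⟨s₀, ne_top_of_le_ne_top ENNReal.ofReal_ne_top hs₀⟩ hs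
  exact ne_top_of_le_ne_top hr (antitone_distribution u hrs.le)

/-- Right continuity of the distribution function, by exhausting `{u > s}` from inside. -/
theorem distribution_le_of_forall_gt {s : ℝ} {C : ℝ≥0∞}
    (h : ∀ r, s < r → distribution u r ≤ C) : distribution u s ≤ C := by
  have hU : {x | s < u x} = ⋃ n : ℕ, {x | s + 1 / ((n : ℝ) + 1) < u x} := by
    ext x
    simp only [mem_ofPred_eq, mem_iUnion]
    refine ⟨fun hx => ?_, fun ⟨n, hn⟩ => ?_⟩
    · obtain ⟨n, hn⟩ := exists_nat_one_div_lt (sub_pos.2 hx)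
      exact ⟨n, by linarith⟩
    · have : 0 < 1 / ((n : ℝ) + 1) := by positivity
      linarith
  have hmono : Monotone fun n : ℕ => {x | s + 1 / ((n : ℝ) + 1) < u x} := fun m n hmn x hx => by
    have : 1 / ((n : ℝ) + 1) ≤ 1 / ((m : ℝ) + 1) := Nat.one_div_le_one_div hmn
    have hx' : s + 1 / ((m : ℝ) + 1) < u x := hx
    show s + 1 / ((n : ℝ) + 1) < u x
    linarith
  rw [distribution, hU, hmono.measure_iUnion]
  exact iSup_le fun n => h _ (lt_add_of_pos_right _ (by positivity))

theorem rearrangement_set_nonempty (hv : VanishesAtTop u) {t : ℝ} (ht : 0 < t) :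
    {s | essLimit u ≤ s ∧ distribution u s ≤ ENNReal.ofReal t}.Nonempty := by
  obtain ⟨s, hs⟩ := hv t ht
  exact ⟨max s (essLimit u), le_max_right _ _,
    (antitone_distribution u (le_max_left _ _)).trans hs⟩

/-- By right continuity the infimum is attained. This Galois connection yields monotonicity and
equality of the distributions. -/
theorem rearrangement_le_iff (hv : VanishesAtTop u) {s t : ℝ} (ht : 0 < t)
    (hs : essLimit u ≤ s) :
    rearrangement u t ≤ s ↔ distribution u s ≤ ENNReal.ofReal t := by
  rw [rearrangement, if_pos ht]
  refine ⟨fun h => distribution_le_of_forall_gt fun r hr => ?_,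
    fun h => csInf_le ⟨essLimit u, fun _ hr => hr.1⟩ ⟨hs, h⟩⟩
  obtain ⟨q, hq, hqr⟩ := exists_lt_of_csInf_lt (rearrangement_set_nonempty hv ht)
    (h.trans_lt hr)
  exact (antitone_distribution u hqr.le).trans hq.2

theorem essLimit_le_rearrangement (hv : VanishesAtTop u) {t : ℝ} (ht : 0 < t) :
    essLimit u ≤ rearrangement u t := by
  rw [rearrangement, if_pos ht]
  exact le_csInf (rearrangement_set_nonempty hv ht) fun _ hs => hs.1

theorem rearrangement_nonneg (hu0 : ∀ x, 0 ≤ u x) (hv : VanishesAtTop u) (t : ℝ) :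
    0 ≤ rearrangement u t := by
  rcases le_or_gt t 0 with ht | ht
  · rw [rearrangement, if_neg (not_lt.2 ht)]
  · exact (essLimit_nonneg hu0).trans (essLimit_le_rearrangement hv ht)

theorem antitoneOn_rearrangement (hv : VanishesAtTop u) :
    AntitoneOn (rearrangement u) (Ioi 0) := fun _ hs _ ht hst =>
  (rearrangement_le_iff hv ht (essLimit_le_rearrangement hv hs)).2
    (((rearrangement_le_iff hv hs (essLimit_le_rearrangement hv hs)).1 le_rfl).trans
      (ENNReal.ofReal_le_ofReal hst))

theorem measurable_rearrangement (hv : VanishesAtTop u) : Measurable (rearrangement u) := by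
  refine measurable_of_Iic fun s => ?_
  have h1 : MeasurableSet (Ioi 0 ∩ rearrangement u ⁻¹' Iic s) := by
    refine OrdConnected.measurableSet ⟨fun a ha b _ x hx => ?_⟩
    have hx0 : (0 : ℝ) < x := lt_of_lt_of_le ha.1 hx.1
    exact ⟨hx0, (antitoneOn_rearrangement hv ha.1 hx0 hx.1).trans ha.2⟩
  have h2 : MeasurableSet (Iic 0 ∩ rearrangement u ⁻¹' Iic s) := by
    by_cases hs : 0 ≤ s
    · convert measurableSet_Iic (a := (0 : ℝ)) using 1
      refine inter_eq_left.2 fun x hx => ?_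
      rw [mem_preimage, rearrangement, if_neg (not_lt.2 hx)]
      exact hs
    · convert MeasurableSet.empty (α := ℝ) using 1
      ext x
      simp only [mem_empty_iff_false, iff_false]
      rintro ⟨hx, hx'⟩
      rw [mem_preimage, rearrangement, if_neg (not_lt.2 hx)] at hx'
      exact hs hx'
  have h3 : rearrangement u ⁻¹' Iic s =
      (Ioi 0 ∩ rearrangement u ⁻¹' Iic s) ∪ (Iic 0 ∩ rearrangement u ⁻¹' Iic s) := by
    rw [← union_inter_distrib_right, union_comm, Iic_union_Ioi, univ_inter]
  rw [h3]
  exact h1.union h2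

/-- By the Galois connection the set where the rearrangement exceeds `s` is an initial interval of
`(0, ∞)` whose length is the distribution of `u` at `s`. -/
theorem distribution_rearrangement (hv : VanishesAtTop u) {s : ℝ} (hs : essLimit u ≤ s) :
    distribution (rearrangement u) s = distribution u s := by
  have h1 : {x | s < rearrangement u x} ∩ Ioi 0 =
      {x | ENNReal.ofReal x < distribution u s} ∩ Ioi 0 := by
    ext t
    refine and_congr_left fun ht => ?_
    rw [mem_ofPred_eq, mem_ofPred_eq, ← not_le, ← not_le, rearrangement_le_iff hv ht hs]
  rw [distribution, Measure.restrict_apply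
    (measurableSet_lt measurable_const (measurable_rearrangement hv)), h1]
  rcases eq_or_ne (distribution u s) ∞ with h | h
  · have h2 : {x : ℝ | ENNReal.ofReal x < distribution u s} = univ :=
      eq_univ_of_forall fun x => by rw [mem_ofPred_eq, h]; exact ENNReal.ofReal_lt_top
    rw [h2, univ_inter, Real.volume_Ioi, h]
  · have h2 : {x | ENNReal.ofReal x < distribution u s} ∩ Ioi 0 =
        Ioo 0 (distribution u s).toReal := by
      ext x
      constructor
      · rintro ⟨h1, h2⟩
        exact ⟨h2, (ENNReal.ofReal_lt_iff_lt_toReal (le_of_lt h2) h).1 h1⟩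
      · rintro ⟨h1, h2⟩
        exact ⟨(ENNReal.ofReal_lt_iff_lt_toReal h1.le h).2 h2, h1⟩
    rw [h2, Real.volume_Ioo, sub_zero, ENNReal.ofReal_toReal h]

/-- The distribution is infinite just below `essLimit u` and finite just above it, so the values in
between are taken on a set of infinite measure. -/
theorem measure_near_essLimit (hu0 : ∀ x, 0 ≤ u x) (hv : VanishesAtTop u) {ε : ℝ} (hε : 0 < ε) :
    halfLine {x | |u x - essLimit u| ≤ ε} = ∞ := by
  have h1 : distribution u (essLimit u - ε) = ∞ :=
    distribution_of_lt_essLimit hu0 (by linarith)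
  have h2 : distribution u (essLimit u + ε) ≠ ∞ := distribution_ne_top hv (by linarith)
  have h3 : distribution u (essLimit u - ε) ≤
      halfLine {x | |u x - essLimit u| ≤ ε} + distribution u (essLimit u + ε) := by
    refine (measure_mono fun x hx => ?_).trans (measure_union_le _ _)
    have hx' : essLimit u - ε < u x := hx
    rcases le_or_gt (u x) (essLimit u + ε) with h | h
    · exact Or.inl (show |u x - essLimit u| ≤ ε from abs_le.2 ⟨by linarith, by linarith⟩)
    · exact Or.inr h
  rw [h1, top_le_iff, ENNReal.add_eq_top] at h3
  exact h3.resolve_right h2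

theorem measure_rearrangement_near_essLimit (hv : VanishesAtTop u) {ε : ℝ} (hε : 0 < ε) :
    halfLine {x | |rearrangement u x - essLimit u| ≤ ε} = ∞ := by
  have h2 : distribution u (essLimit u + ε) ≠ ∞ := distribution_ne_top hv (by linarith)
  have hm : MeasurableSet {x | |rearrangement u x - essLimit u| ≤ ε} :=
    measurableSet_le ((measurable_rearrangement hv).sub_const _).norm measurable_const
  rw [Measure.restrict_apply hm, ← top_le_iff,
    ← Real.volume_Ioi (a := (distribution u (essLimit u + ε)).toReal)]
  refine measure_mono fun t ht => ?_
  have ht0 : 0 < t := lt_of_le_of_lt ENNReal.toReal_nonneg ht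
  have h3 : rearrangement u t ≤ essLimit u + ε :=
    (rearrangement_le_iff hv ht0 (by linarith)).2
      ((ENNReal.le_ofReal_iff_toReal_le h2 ht0.le).2 (le_of_lt ht))
  have h4 := essLimit_le_rearrangement hv ht0
  exact ⟨show |rearrangement u t - essLimit u| ≤ ε from abs_le.2 ⟨by linarith, by linarith⟩, ht0⟩

variable {𝕜 : Type*} [RCLike 𝕜]

theorem vanishesAtTop_norm {x : L0 𝕜} (hx : x ∈ (coupleL1Linfty 𝕜).sum) :
    VanishesAtTop fun z => ‖x z‖ := by
  obtain ⟨a, b, ha, hb, rfl⟩ := mem_sum_iff.1 hx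
  intro t ht
  set M := ((lebesgue 𝕜 ∞ le_top).nrm b).toReal with hM
  set A := (∫⁻ x in Ioi 0, ‖a x‖ₑ).toReal with hA
  have hAtop : ∫⁻ x in Ioi 0, ‖a x‖ₑ ≠ ∞ := by rw [← nrm_L1]; exact ha.ne
  have hA0 : 0 ≤ A := ENNReal.toReal_nonneg
  -- Where the modulus of the sum exceeds `M + r`, the `L¹` part exceeds `r`; by Chebyshev's
  -- inequality this set has measure at most `A / r ≤ t`.
  set r := A / t + 1 with hr
  have hr0 : 0 < r := by positivity
  refine ⟨M + r, ?_⟩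
  have h1 : distribution (fun z => ‖(a + b : L0 𝕜) z‖) (M + r) ≤
      halfLine {x | ENNReal.ofReal r ≤ ‖a x‖ₑ} := by
    refine measure_mono_ae ?_
    filter_upwards [norm_le_of_Linfty hb, AEEqFun.coeFn_add a b] with z h1 h2 h3
    have h3' : M + r < ‖(a + b : L0 𝕜) z‖ := h3
    rw [h2, Pi.add_apply] at h3'
    have h4 := norm_add_le (a z) (b z)
    change ENNReal.ofReal r ≤ ‖a z‖ₑ
    rw [← ofReal_norm]
    exact ENNReal.ofReal_le_ofReal (by
      have : ‖b z‖ ≤ M := h1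
      linarith)
  refine h1.trans ?_
  have h2 := mul_meas_ge_le_lintegral (μ := halfLine) a.stronglyMeasurable.measurable.enorm
    (ENNReal.ofReal r)
  rw [← ENNReal.ofReal_toReal hAtop] at h2
  have hr' : ENNReal.ofReal r ≠ 0 := (ENNReal.ofReal_pos.2 hr0).ne'
  have h3 : halfLine {x | ENNReal.ofReal r ≤ ‖a x‖ₑ} ≤ ENNReal.ofReal A / ENNReal.ofReal r :=
    (ENNReal.le_div_iff_mul_le (Or.inl hr') (Or.inl ENNReal.ofReal_ne_top)).2 (by rwa [mul_comm])
  refine h3.trans ?_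
  rw [← ENNReal.ofReal_div_of_pos hr0]
  refine ENNReal.ofReal_le_ofReal ?_
  rw [div_le_iff₀ hr0, hr]
  have : t * (A / t + 1) = A + t := by field_simp
  linarith

/-- Every element of `L¹ + L^∞` is equivalent, under operators of norm at most one, to a decreasing
function. -/
theorem exists_rearrangement {x : L0 𝕜} (hx : x ∈ (coupleL1Linfty 𝕜).sum) :
    ∃ w : L0 𝕜, IsDecreasing w ∧ IsImage 1 (coupleL1Linfty 𝕜) (coupleL1Linfty 𝕜) x w ∧
      IsImage 1 (coupleL1Linfty 𝕜) (coupleL1Linfty 𝕜) w x := by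
  set u : ℝ → ℝ := fun z => ‖x z‖ with hu
  have hum : Measurable u := x.stronglyMeasurable.measurable.norm
  have hu0 : ∀ z, 0 ≤ u z := fun z => norm_nonneg _
  have hv : VanishesAtTop u := vanishesAtTop_norm hx
  have hwm := measurable_rearrangement hv
  have hw0 := rearrangement_nonneg hu0 hv
  let w : L0 𝕜 := AEEqFun.mk (fun t => ((rearrangement u t : ℝ) : 𝕜))
    (RCLike.measurable_ofReal.comp hwm).aestronglyMeasurable
  have hw : ∀ᵐ t ∂halfLine, w t = ((rearrangement u t : ℝ) : 𝕜) := AEEqFun.coeFn_mk _ _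
  have h1 : IsImage 1 (coupleL1Linfty 𝕜) (coupleL1Linfty 𝕜) x (absL0 x) :=
    isImage_of_enorm_le solid_Linfty hx ((enorm_absL0 x).mono fun _ h => h.le)
  have h2 : IsImage 1 (coupleL1Linfty 𝕜) (coupleL1Linfty 𝕜) (absL0 x) x :=
    isImage_of_enorm_le solid_Linfty h1.mem_right ((enorm_absL0 x).mono fun _ h => h.ge)
  have h3 : IsImage 1 (coupleL1Linfty 𝕜) (coupleL1Linfty 𝕜) (absL0 x) w :=
    isImage_of_distribution_eq hum hwm hw0 (essLimit_nonneg hu0)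
      (fun ε hε => measure_near_essLimit hu0 hv hε)
      (fun s hs => (distribution_rearrangement hv hs.le).symm)
      (fun s hs => distribution_ne_top hv hs) (coeFn_absL0 x) hw h1.mem_right
  have h4 : IsImage 1 (coupleL1Linfty 𝕜) (coupleL1Linfty 𝕜) w (absL0 x) :=
    isImage_of_distribution_eq hwm hum hu0 (essLimit_nonneg hu0)
      (fun ε hε => measure_rearrangement_near_essLimit hv hε)
      (fun s hs => distribution_rearrangement hv hs.le)
      (fun s hs => by
        have := distribution_ne_top hv hs
        rwa [← distribution_rearrangement hv hs.le] at this) hw (coeFn_absL0 x) h3.mem_right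
  refine ⟨w, ⟨_, hwm, antitoneOn_rearrangement hv, hw0, hw⟩, ?_, ?_⟩
  · simpa using h1.trans h3
  · simpa using h4.trans h2

end Rearrangement

/-! ### The Calderón–Mityagin properties -/

open CompatibleCouple

variable {𝕜 : Type*} [RCLike 𝕜]

theorem isRelativeCMPair_of_isImage {c : ℝ≥0} {X Y : CompatibleCouple 𝕜 (L0 𝕜)}
    (h : ∀ x ∈ X.sum, ∀ y ∈ Y.sum, (∀ t : ℝ≥0, 0 < t → Y.K t y ≤ X.K t x) →
      IsImage c X Y x y) : IsRelativeCMPair c X Y := fun x y hxy => by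
  obtain ⟨_, _, T, hT, hTx⟩ := h x x.2 y y.2 hxy
  exact ⟨T, hT, hTx⟩

theorem K_level_le_K (t : ℝ≥0) (x : L0 𝕜) :
    (coupleL1LevelLinfty 𝕜).K t x ≤ (coupleL1Linfty 𝕜).K t x :=
  le_iInf₂ fun _ b => le_iInf fun hab => (K_le_add _ t hab).trans
    (add_le_add le_rfl (mul_le_mul le_rfl (levelNorm_le_eLpNorm b) zero_le zero_le))

theorem isLevelConstant_two : IsLevelConstant 𝕜 2 := fun f => by
  have h := (isImage_levelL0 f.2).trans
    (isImage_two_of_isDecreasing (levelL0_mem_sum f.2) (isDecreasing_levelL0 f.2))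
  rw [mul_one] at h
  obtain ⟨_, _, T, hT, hTf⟩ := h
  refine ⟨T, hT, ?_⟩
  rw [hTf]
  exact levelL0_eq_levelFunction f.2

/-- Through `xᵒ`: since `xᵒ → x`, the `K`-functional of `x` is at most that of `xᵒ`, hence at most
`∫₀ᵗ xᵒ`, and it dominates `∫₀ᵗ |y|`. So `xᵒ → y` by transport. -/
theorem isImage_level_level {x y : L0 𝕜} (hx : x ∈ (coupleL1LevelLinfty 𝕜).sum)
    (hy : y ∈ (coupleL1LevelLinfty 𝕜).sum)
    (h : ∀ t : ℝ≥0, 0 < t →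
      (coupleL1LevelLinfty 𝕜).K t y ≤ (coupleL1LevelLinfty 𝕜).K t x) :
    IsImage 1 (coupleL1LevelLinfty 𝕜) (coupleL1LevelLinfty 𝕜) x y := by
  rw [← mul_one 1]
  refine (isImage_levelL0 hx).trans (isImage_of_lintegral_le (levelL0_mem_sum hx) hy fun t ht => ?_)
  exact (lintegral_le_K y ht).trans <| (h t ht).trans <| ((isImage_of_levelL0 hx).K_le ht).trans <|
    (K_level_le_K t _).trans (K_le_lintegral (isDecreasing_levelL0 hx) ht)

/-- Through the rearrangement `w` of `x`: only after entering the larger couple by the identity can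
`w` be transported to `y`. -/
theorem isImage_Linfty_level {x y : L0 𝕜} (hx : x ∈ (coupleL1Linfty 𝕜).sum)
    (hy : y ∈ (coupleL1LevelLinfty 𝕜).sum)
    (h : ∀ t : ℝ≥0, 0 < t → (coupleL1LevelLinfty 𝕜).K t y ≤ (coupleL1Linfty 𝕜).K t x) :
    IsImage 1 (coupleL1Linfty 𝕜) (coupleL1LevelLinfty 𝕜) x y := by
  obtain ⟨w, hw, hxw, hwx⟩ := exists_rearrangement hx
  have h1 : IsImage 1 (coupleL1LevelLinfty 𝕜) (coupleL1LevelLinfty 𝕜) w y :=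
    isImage_of_lintegral_le (sum_le_sum_level hxw.mem_right) hy fun t ht =>
      (lintegral_le_K y ht).trans <| (h t ht).trans <| (hwx.K_le ht).trans (K_le_lintegral hw ht)
  simpa only [mul_one] using (hxw.trans (isImage_id hxw.mem_right)).trans h1

/-- Through the rearrangement `w` of `y`. All the steps have norm one except the passage of `w` from
one couple to the other, which costs `n`. -/
theorem isImage_level_Linfty {n : ℝ≥0} (hn : IsLevelConstant 𝕜 n) {x y : L0 𝕜}
    (hx : x ∈ (coupleL1LevelLinfty 𝕜).sum) (hy : y ∈ (coupleL1Linfty 𝕜).sum)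
    (h : ∀ t : ℝ≥0, 0 < t → (coupleL1Linfty 𝕜).K t y ≤ (coupleL1LevelLinfty 𝕜).K t x) :
    IsImage n (coupleL1LevelLinfty 𝕜) (coupleL1Linfty 𝕜) x y := by
  obtain ⟨w, hw, hyw, hwy⟩ := exists_rearrangement hy
  have hwo : w ∈ (coupleL1LevelLinfty 𝕜).sum := sum_le_sum_level hyw.mem_right
  have h1 : IsImage 1 (coupleL1LevelLinfty 𝕜) (coupleL1LevelLinfty 𝕜) x w :=
    isImage_level_level hx hwo fun t ht =>
      (K_level_le_K t w).trans <| (hyw.K_le ht).trans (h t ht)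
  -- The operator produces the level function of `w`, which is `w` itself because `w` is decreasing.
  have h2 : IsImage n (coupleL1LevelLinfty 𝕜) (coupleL1Linfty 𝕜) w w := by
    obtain ⟨N, hN, hNw⟩ := hn ⟨w, hwo⟩
    refine ⟨hwo, hyw.mem_right, N, hN, Subtype.ext (AEEqFun.ext ?_)⟩
    filter_upwards [hNw, levelFunction_of_isDecreasing hwo hw] with z h1 h2
    rw [h1, h2]
  simpa only [mul_one, one_mul] using (h1.trans h2).trans hwy

/-! ### The counterexample to exactness -/

variable (𝕜) in
/-- The characteristic function of `[a, b)`. -/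
noncomputable def indicatorIco (a b : ℝ) : L0 𝕜 :=
  AEEqFun.mk ((Ico a b).indicator fun _ => (1 : 𝕜))
    (measurable_const.indicator measurableSet_Ico).aestronglyMeasurable

theorem coeFn_indicatorIco (a b : ℝ) :
    ∀ᵐ x ∂halfLine, indicatorIco 𝕜 a b x = (Ico a b).indicator (fun _ => (1 : 𝕜)) x :=
  AEEqFun.coeFn_mk _ _

theorem enorm_indicatorIco (a b : ℝ) : ∀ᵐ x ∂halfLine,
    ‖indicatorIco 𝕜 a b x‖ₑ = (Ico a b).indicator (fun _ => (1 : ℝ≥0∞)) x := by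
  filter_upwards [coeFn_indicatorIco (𝕜 := 𝕜) a b] with x hx
  rw [hx]
  by_cases h : x ∈ Ico a b <;> simp [h]

theorem indicatorIco_add {a b c : ℝ} (hab : a ≤ b) (hbc : b ≤ c) :
    indicatorIco 𝕜 a b + indicatorIco 𝕜 b c = indicatorIco 𝕜 a c := by
  refine AEEqFun.ext ?_
  filter_upwards [AEEqFun.coeFn_add (indicatorIco 𝕜 a b) (indicatorIco 𝕜 b c),
    coeFn_indicatorIco (𝕜 := 𝕜) a b, coeFn_indicatorIco (𝕜 := 𝕜) b c,
    coeFn_indicatorIco (𝕜 := 𝕜) a c] with x h1 h2 h3 h4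
  rw [h1, Pi.add_apply, h2, h3, h4, ← Ico_union_Ico_eq_Ico hab hbc, indicator_union_of_disjoint
    (Ico_disjoint_Ico_same)]

theorem setLIntegral_indicatorIco_le {s : Set ℝ} (hs : s ⊆ Ioi 0) (a b : ℝ) :
    ∫⁻ x in s, ‖indicatorIco 𝕜 a b x‖ₑ ≤ volume (Ico a b ∩ s) := by
  rw [lintegral_congr_ae (ae_restrict_of_ae_restrict_of_subset hs (enorm_indicatorIco a b)),
    lintegral_indicator_const measurableSet_Ico, one_mul, Measure.restrict_apply measurableSet_Ico]

theorem levelNorm_indicatorIco_le_one (a b : ℝ) : levelNorm (indicatorIco 𝕜 a b) ≤ 1 :=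
  (levelNorm_le_iff _ _).2 fun x hx =>
    (setLIntegral_indicatorIco_le Ioo_subset_Ioi_self a b).trans <|
      (measure_mono inter_subset_right).trans (by rw [Real.volume_Ioo, sub_zero, one_mul])

/-- The mean over `(0, x)` is largest at `x = 2`. The level norm is half the `L^∞` norm, and this
discrepancy is what rules out exactness. -/
theorem levelNorm_indicatorIco_one_two :
    levelNorm (indicatorIco 𝕜 1 2) ≤ ENNReal.ofReal (1 / 2) := by
  refine (levelNorm_le_iff _ _).2 fun x hx =>
    (setLIntegral_indicatorIco_le Ioo_subset_Ioi_self 1 2).trans ?_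
  calc volume (Ico 1 2 ∩ Ioo 0 x) ≤ volume (Ico 1 (min 2 x)) :=
        measure_mono fun z hz => ⟨hz.1.1, lt_min hz.1.2 hz.2.2⟩
    _ ≤ ENNReal.ofReal (1 / 2) * ENNReal.ofReal x := by
        rw [Real.volume_Ico, ← ENNReal.ofReal_mul (by norm_num)]
        refine ENNReal.ofReal_le_ofReal ?_
        rcases le_total x 2 with h | h
        · rw [min_eq_right h]; linarith
        · rw [min_eq_left h]; linarith

theorem nrm_L1_indicatorIco_le (a b : ℝ) :
    (lebesgue 𝕜 1 le_rfl).nrm (indicatorIco 𝕜 a b) ≤ ENNReal.ofReal (b - a) := by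
  rw [nrm_L1, ← Real.volume_Ico]
  exact (setLIntegral_indicatorIco_le subset_rfl a b).trans (measure_mono inter_subset_left)

variable (𝕜) in
/-- The step function with the values `2` on `[0, 1)`, `1` on `[1, 2)` and `0` elsewhere. -/
noncomputable def staircase : L0 𝕜 := indicatorIco 𝕜 0 1 + indicatorIco 𝕜 0 2

theorem isDecreasing_staircase : IsDecreasing (staircase 𝕜) := by
  refine ⟨fun x => (Iio 1).indicator (fun _ => (1 : ℝ)) x + (Iio 2).indicator (fun _ => 1) x,
    (measurable_const.indicator measurableSet_Iio).add
      (measurable_const.indicator measurableSet_Iio), ?_, fun x => ?_, ?_⟩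
  · have h : ∀ c : ℝ, Antitone ((Iio c).indicator fun _ => (1 : ℝ)) := fun c x y hxy => by
      by_cases hy : y < c
      · rw [indicator_of_mem (show y ∈ Iio c from hy),
          indicator_of_mem (show x ∈ Iio c from hxy.trans_lt hy)]
      · rw [indicator_of_notMem (show y ∉ Iio c from hy)]
        exact indicator_nonneg (fun _ _ => zero_le_one) x
    exact ((h 1).add (h 2)).antitoneOn _
  · exact add_nonneg (indicator_nonneg (fun _ _ => zero_le_one) x)
      (indicator_nonneg (fun _ _ => zero_le_one) x)
  · filter_upwards [AEEqFun.coeFn_add (indicatorIco 𝕜 0 1) (indicatorIco 𝕜 0 2),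
      coeFn_indicatorIco (𝕜 := 𝕜) 0 1, coeFn_indicatorIco (𝕜 := 𝕜) 0 2,
      ae_restrict_mem measurableSet_Ioi] with x h1 h2 h3 hx
    have hx' : 0 ≤ x := le_of_lt hx
    rw [staircase, h1, Pi.add_apply, h2, h3]
    simp only [indicator, mem_Ico, mem_Iio, hx', true_and, RCLike.ofReal_add]
    split_ifs <;> simp

theorem le_of_Linfty_le {h : L0 𝕜} {M : ℝ} (hM : 0 ≤ M)
    (hh : (lebesgue 𝕜 ∞ le_top).nrm h ≤ ENNReal.ofReal M) : ∀ᵐ x ∂halfLine, ‖h x‖ ≤ M := by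
  filter_upwards [(nrm_Linfty_le_iff h _).1 hh] with x hx
  rwa [← ofReal_norm, ENNReal.ofReal_le_ofReal_iff hM] at hx

/-- Let `u`, `v`, `w` be the images of the characteristic functions of `[0, 1)`, `[1, 2)`, `[0, 2)`.
Then `|v| ≤ 1/2`, `|w| ≤ 1` and `‖u‖₁ ≤ 1`. On `[0, 1)` the identity `u + w = 2` forces `|u| ≥ 1`.
On `[1, 2)` the identity `2 u + v = 1` forces `|u| ≥ 1/4`. So `‖u‖₁ ≥ 5/4`, a contradiction. -/
theorem not_isImage_staircase :
    ¬ IsImage 1 (coupleL1LevelLinfty 𝕜) (coupleL1Linfty 𝕜) (staircase 𝕜) (staircase 𝕜) := by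
  rintro ⟨hf, hf', T, hT, hTf⟩
  have hbd : ∀ (e : L0 𝕜) (he : e ∈ (coupleL1LevelLinfty 𝕜).sum) {M : ℝ}, 0 ≤ M →
      levelNorm e ≤ ENNReal.ofReal M → ∀ᵐ x ∂halfLine, ‖(T ⟨e, he⟩ : L0 𝕜) x‖ ≤ M := by
    intro e he M hM h
    have h1 := hT.2 ⟨e, he⟩ (h.trans_lt ENNReal.ofReal_lt_top)
    rw [ENNReal.coe_one, one_mul] at h1
    exact le_of_Linfty_le hM (h1.trans h)
  have hmem : ∀ a b, indicatorIco 𝕜 a b ∈ (coupleL1LevelLinfty 𝕜).sum := fun a b =>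
    mem_sum_right ((levelNorm_indicatorIco_le_one a b).trans_lt ENNReal.one_lt_top)
  set u : L0 𝕜 := (T ⟨indicatorIco 𝕜 0 1, hmem 0 1⟩).1 with hu
  set v : L0 𝕜 := (T ⟨indicatorIco 𝕜 1 2, hmem 1 2⟩).1 with hv
  set w : L0 𝕜 := (T ⟨indicatorIco 𝕜 0 2, hmem 0 2⟩).1 with hw
  have hone : (1 : ℝ≥0∞) ≤ ENNReal.ofReal 1 := by simp
  have hv1 := hbd _ (hmem 1 2) (by norm_num) levelNorm_indicatorIco_one_two
  have hw1 := hbd _ (hmem 0 2) zero_le_one ((levelNorm_indicatorIco_le_one 0 2).trans hone)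
  have huv : u + v = w := by
    rw [hu, hv, hw, ← Submodule.coe_add, ← map_add]
    congr 2
    exact Subtype.ext (indicatorIco_add zero_le_one one_le_two)
  have huw : u + w = staircase 𝕜 := by
    rw [hu, hw, ← Submodule.coe_add, ← map_add]
    exact congrArg Subtype.val hTf
  have hu1 : ∫⁻ x in Ioi 0, ‖u x‖ₑ ≤ 1 := by
    have h1 := hT.1 ⟨_, hmem 0 1⟩ ((nrm_L1_indicatorIco_le 0 1).trans_lt ENNReal.ofReal_lt_top)
    rw [ENNReal.coe_one, one_mul] at h1
    exact ((nrm_L1 u).ge.trans h1).trans ((nrm_L1_indicatorIco_le 0 1).trans (by simp))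
  have hlow : ∀ᵐ x ∂halfLine, (Ico 0 1).indicator (fun _ => (1 : ℝ≥0∞)) x +
      (Ico 1 2).indicator (fun _ => ENNReal.ofReal (1 / 4)) x ≤ ‖u x‖ₑ := by
    have h1 := AEEqFun.coeFn_add u v
    have h2 := AEEqFun.coeFn_add u w
    have h3 := AEEqFun.coeFn_add (indicatorIco 𝕜 0 1) (indicatorIco 𝕜 0 2)
    rw [huv] at h1
    rw [huw] at h2
    filter_upwards [h1, h2, h3, hv1, hw1, coeFn_indicatorIco (𝕜 := 𝕜) 0 1,
      coeFn_indicatorIco (𝕜 := 𝕜) 0 2] with x h1 h2 h3 h4 h5 h6 h7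
    rw [Pi.add_apply] at h1 h2
    rw [staircase, h3, Pi.add_apply, h6, h7] at h2
    rw [← ofReal_norm (u x)]
    by_cases hx : x ∈ Ico (0 : ℝ) 1
    · have hx2 : x ∈ Ico (0 : ℝ) 2 := ⟨hx.1, hx.2.trans one_lt_two⟩
      have hx3 : x ∉ Ico (1 : ℝ) 2 := fun h => absurd hx.2 (not_lt.2 h.1)
      rw [indicator_of_mem hx, indicator_of_mem hx2] at h2
      rw [indicator_of_mem hx, indicator_of_notMem hx3, add_zero, ← ENNReal.ofReal_one]
      refine ENNReal.ofReal_le_ofReal ?_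
      have h8 : ‖(2 : 𝕜)‖ ≤ ‖u x‖ + ‖w x‖ := by
        rw [show (2 : 𝕜) = u x + w x by rw [← h2]; norm_num]
        exact norm_add_le _ _
      rw [RCLike.norm_two] at h8
      linarith
    by_cases hx3 : x ∈ Ico (1 : ℝ) 2
    · have hx2 : x ∈ Ico (0 : ℝ) 2 := ⟨zero_le_one.trans hx3.1, hx3.2⟩
      rw [indicator_of_notMem hx, indicator_of_mem hx2, zero_add] at h2
      rw [indicator_of_notMem hx, indicator_of_mem hx3, zero_add]
      refine ENNReal.ofReal_le_ofReal ?_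
      have h8 : ‖(1 : 𝕜)‖ ≤ ‖u x‖ + ‖u x‖ + ‖v x‖ := by
        rw [show (1 : 𝕜) = u x + u x + v x by rw [h2, h1]; ring]
        exact norm_add₃_le
      rw [norm_one] at h8
      linarith
    · rw [indicator_of_notMem hx, indicator_of_notMem hx3, add_zero]
      exact zero_le
  have hsum := (lintegral_mono_ae hlow).trans hu1
  rw [lintegral_add_left (measurable_const.indicator measurableSet_Ico),
    lintegral_indicator_const measurableSet_Ico, lintegral_indicator_const measurableSet_Ico,
    Measure.restrict_apply measurableSet_Ico, Measure.restrict_apply measurableSet_Ico] at hsum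
  have hm1 : (1 : ℝ≥0∞) ≤ volume (Ico (0 : ℝ) 1 ∩ Ioi 0) := by
    refine le_trans ?_ (measure_mono (show Ioo (0 : ℝ) 1 ⊆ _ from
      fun x hx => ⟨⟨hx.1.le, hx.2⟩, hx.1⟩))
    simp
  have hm2 : (1 : ℝ≥0∞) ≤ volume (Ico (1 : ℝ) 2 ∩ Ioi 0) := by
    rw [inter_eq_left.2 (show Ico (1 : ℝ) 2 ⊆ Ioi 0 from fun x hx => zero_lt_one.trans_le hx.1),
      Real.volume_Ico]
    norm_num
  have hfin : ENNReal.ofReal 1 + ENNReal.ofReal (1 / 4) ≤ ENNReal.ofReal 1 := by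
    rw [ENNReal.ofReal_one]
    refine le_trans (add_le_add ?_ ?_) hsum
    · rw [one_mul]; exact hm1
    · exact le_mul_of_one_le_right' hm2
  rw [← ENNReal.ofReal_add zero_le_one (by norm_num),
    ENNReal.ofReal_le_ofReal_iff zero_le_one] at hfin
  norm_num at hfin

/-- The staircase is decreasing, so its `K`-functional in `(L¹, L^∞)` is at most its integral over
`(0, t)`, hence at most the one in `(L¹, (L^∞)ᵒ)`. Exactness would thus make the staircase an image
of itself. -/
theorem not_isExactRelativeCMPair_level_Linfty :
    ¬ IsExactRelativeCMPair (coupleL1LevelLinfty 𝕜) (coupleL1Linfty 𝕜) := fun h => by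
  have hf' : staircase 𝕜 ∈ (coupleL1Linfty 𝕜).sum := by
    refine add_mem (mem_sum_left ?_) (mem_sum_left ?_) <;>
      exact (nrm_L1_indicatorIco_le _ _).trans_lt ENNReal.ofReal_lt_top
  obtain ⟨T, hT, hTf⟩ := h ⟨staircase 𝕜, sum_le_sum_level hf'⟩ ⟨staircase 𝕜, hf'⟩ fun t ht =>
    (K_le_lintegral isDecreasing_staircase ht).trans (lintegral_le_K _ ht)
  exact not_isImage_staircase ⟨_, _, T, hT, hTf⟩

end CalderonMityagin

open CalderonMityagin
theorem theorem3p6 (𝕜 : Type*) [RCLike 𝕜] :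
    IsLevelConstant 𝕜 2 ∧
    ∀ n : NNReal, IsLevelConstant 𝕜 n →
      CompatibleCouple.IsExactCMCouple (coupleL1LevelLinfty 𝕜) ∧
      CompatibleCouple.IsExactRelativeCMPair (coupleL1Linfty 𝕜) (coupleL1LevelLinfty 𝕜) ∧
      CompatibleCouple.IsRelativeCMPair n (coupleL1LevelLinfty 𝕜) (coupleL1Linfty 𝕜) ∧
      ¬ CompatibleCouple.IsExactRelativeCMPair (coupleL1LevelLinfty 𝕜) (coupleL1Linfty 𝕜) :=
  ⟨isLevelConstant_two, fun _ hn =>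
    ⟨isRelativeCMPair_of_isImage fun _ hx _ hy => isImage_level_level hx hy,
      isRelativeCMPair_of_isImage fun _ hx _ hy => isImage_Linfty_level hx hy,
      isRelativeCMPair_of_isImage fun _ hx _ hy => isImage_level_Linfty hn hx hy,
      not_isExactRelativeCMPair_level_Linfty⟩⟩
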